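/- Let $\mathbf H$ be the hyperbolic plane (upper half-plane) with $\mu=dx\,dy/y^2$, $\Delta=y^2(\partial_x^2+\partial_y^2)$, and let $u(z,w)=\cosh r(z,w)=1+\frac{|z-w|^2}{2\,\Im z\,\Im w}$, where $r$ is the hyperbolic distance, and $L(u)=\frac1{4\pi}\log\frac{u+1}{u-1}$. Let $\Gamma\subset\mathrm{SL}_2(\mathbf R)$ be a cofinite Fuchsian group, i.e. a discrete subgroup such that $\Gamma\backslash\mathbf H$ has finite volume. Integration over $\Gamma\backslash\mathbf H$ means $1/\#(\Gamma\cap\{\pm1\})$ times integration with respect to $\mu$ over a fundamental domain, and $\mathrm{vol}_\Gamma=\int_{\Gamma\backslash\mathbf H}\mu$. Let $\Delta_\Gamma$ be the self-adjoint extension of $\Delta$ on smooth bounded $\Gamma$-invariant functions to $L^2(\Gamma\backslash\mathbf H)$, and let $G_\Gamma$ be the unique bounded self-adjoint operator on $L^2(\Gamma\backslash\mathbf H)$ such that $\Delta_\Gamma G_\Gamma f=f-\frac1{\mathrm{vol}_\Gamma}\int_{\Gamma\backslash\mathbf H}f\mu$ and $\int_{\Gamma\backslash\mathbf H}G_\Gamma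 f\,\mu=0$ for all smooth bounded $\Gamma$-invariant $f$. The Green function $\mathrm{gr}_\Gamma$ is the unique real function on $\mathbf H\times\mathbf H$ that is $\Gamma$-invariant in both variables separately, symmetric, smooth except for logarithmic singularities at the points $(z,\gamma z)$ with $\gamma\in\Gamma$, and satisfies $G_\Gamma f(z)=\int_{w\in\Gamma\backslash\mathbf H}\mathrm{gr}_\Gamma(z,w)f(w)\mu(w)$ for all smooth bounded $\Gamma$-invariant $f$. A cusp $\mathfrak c$ of $\Gamma$ is a $\Gamma$-orbit of fixed points in $\mathbf P^1(\mathbf R)$ of parabolic elements of $\Gamma$. For every cusp $\mathfrak c$ fix $\sigma_{\mathfrak c}\in\mathrm{SL}_2(\mathbf R)$ such that $\sigma_{\mathfrak c}\infty$ represents $\mathfrak c$ and such that, with $\Gamma_{\mathfrak c}$ the stabiliser of $\sigma_{\mathfrak c}\infty$ in $\Gamma$, one has $\{\pm1\}\sigma_{\mathfrak c}^{-1}\Gamma_{\mathfrak c}\sigma_{\mathfrak c}=\{\pm1\}\{\begin{pmatrix}1&b\\0&1\end{pmatrix}: b\in\mathbf Z\}$. Put $q_{\mathfrak c}(z)=\exp(2\pi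 i\,\sigma_{\mathfrak c}^{-1}z)$, $y_{\mathfrak c}(z)=\Im\sigma_{\mathfrak c}^{-1}z$, and $C_{\mathfrak c}(\gamma)=|c|$ if $\sigma_{\mathfrak c}^{-1}\gamma\sigma_{\mathfrak c}=\begin{pmatrix}a&b\\c&d\end{pmatrix}$. Let $D_{\mathfrak c}(\epsilon)\subset\Gamma\backslash\mathbf H$ be the image of $\{\sigma_{\mathfrak c}(x+iy): 0\le x<1,\ y>1/\epsilon\}$. For $z\in\mathbf H$ and $S\subset\Gamma\backslash\mathbf H$, write $z\in S$ if the image of $z$ lies in $S$; whenever $z\in D_{\mathfrak c}(\epsilon)$ and $y_{\mathfrak c}(z)$ or $q_{\mathfrak c}(z)$ occurs below, the representative $z$ of its $\Gamma$-orbit is taken with $y_{\mathfrak c}(z)>1/\epsilon$. Let $\delta>1$, and for every cusp $\mathfrak c$ let $\epsilon'_{\mathfrak c}>\epsilon_{\mathfrak c}>0$ be real numbers satisfying $$\epsilon'_{\mathfrak c}\bigl(\delta+\sqrt{\delta^2-1}\bigr)^{1/2}\le\min_{\gamma\in\Gamma,\ \gamma\notin\Gamma_{\mathfrak c}}C_{\mathfrak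 c}(\gamma)\quad\text{and}\quad\bigl(\delta+\sqrt{\delta^2-1}\bigr)\epsilon_{\mathfrak c}\le\epsilon'_{\mathfrak c},$$ and such that the discs $D_{\mathfrak c}(\epsilon'_{\mathfrak c})$ are pairwise disjoint. Let $Y=(\Gamma\backslash\mathbf H)\setminus\bigsqcup_{\mathfrak c}D_{\mathfrak c}(\epsilon_{\mathfrak c})$, and let $A$, $B$ be real numbers satisfying $$A\le\mathrm{gr}_\Gamma(z,w)+\sum_{\gamma\in\Gamma,\ u(z,\gamma w)\le\delta}\bigl(L(u(z,\gamma w))-L(\delta)\bigr)\le B\quad\text{for all }z,w\in Y\text{ with }z\notin\Gamma w.$$ (a) If $\mathfrak c$ is a cusp such that $z\in D_{\mathfrak c}(\epsilon_{\mathfrak c})$, $w\in Y$ and $w\notin D_{\mathfrak c}(\epsilon'_{\mathfrak c})$, then $$A\le\mathrm{gr}_\Gamma(z,w)-\frac1{\mathrm{vol}_\Gamma}\log(\epsilon_{\mathfrak c}y_{\mathfrak c}(z))\le B.$$ (a$'$) If $\mathfrak c$ is a cusp such that $w\in D_{\mathfrak c}(\epsilon_{\mathfrak c})$, $z\in Y$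 and $z\notin D_{\mathfrak c}(\epsilon'_{\mathfrak c})$, then $$A\le\mathrm{gr}_\Gamma(z,w)-\frac1{\mathrm{vol}_\Gamma}\log(\epsilon_{\mathfrak c}y_{\mathfrak c}(w))\le B.$$ (b) If $\mathfrak c$, $\mathfrak d$ are two distinct cusps such that $z\in D_{\mathfrak c}(\epsilon_{\mathfrak c})$ and $w\in D_{\mathfrak d}(\epsilon_{\mathfrak d})$, then $$A\le\mathrm{gr}_\Gamma(z,w)-\frac1{\mathrm{vol}_\Gamma}\log(\epsilon_{\mathfrak c}y_{\mathfrak c}(z))-\frac1{\mathrm{vol}_\Gamma}\log(\epsilon_{\mathfrak d}y_{\mathfrak d}(w))\le B.$$ (c) If $\mathfrak c$ is a cusp such that $z,w\in D_{\mathfrak c}(\epsilon'_{\mathfrak c})$ and $z\notin\Gamma w$, then $$\tilde A_{\mathfrak c}\le\mathrm{gr}_\Gamma(z,w)-\#(\Gamma\cap\{\pm1\})\frac1{2\pi}\log|q_{\mathfrak c}(z)-q_{\mathfrak c}(w)|-\frac1{\mathrm{vol}_\Gamma}\log(\epsilon'_{\mathfrak c}y_{\mathfrak c}(z))-\frac1{\mathrm{vol}_\Gamma}\log(\epsilon'_{\mathfrak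 c}y_{\mathfrak c}(w))\le\tilde B_{\mathfrak c},$$ where $$\tilde A_{\mathfrak c}=A+\#(\Gamma\cap\{\pm1\})\Bigl[\frac1{\epsilon'_{\mathfrak c}}\Bigl(1-\frac2\pi\arctan\sqrt{\tfrac{\delta-1}2}\Bigr)-\epsilon'_{\mathfrak c}r_\delta\Bigr],$$ $$\tilde B_{\mathfrak c}=B+\#(\Gamma\cap\{\pm1\})\Bigl[\frac1{\epsilon'_{\mathfrak c}}\Bigl(1-\frac2\pi\arctan\sqrt{\tfrac{\delta-1}2}\Bigr)+\epsilon'_{\mathfrak c}r_\delta\Bigr],$$ $$r_\delta=\frac1{24\pi}\Bigl(\sqrt{\tfrac2{\delta-1}}+\arctan\sqrt{\tfrac{\delta-1}2}\Bigr).$$ -/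

import Mathlib

open MeasureTheory UpperHalfPlane Topology
open scoped MatrixGroups ContDiff ENNReal

noncomputable section

namespace FuchsianGreen

/-! ### The hyperbolic plane -/

/-- `u(z,w) = cosh r(z,w)`, where `r` is the geodesic distance. -/
def u (z w : ℍ) : ℝ := Real.cosh (dist z w)

/-- `L(u) = (1/4π) log((u+1)/(u-1))`, so that `-L(u(z,w))` is the Green function of `ℍ`. -/
def L (t : ℝ) : ℝ := 1 / (4 * Real.pi) * Real.log ((t + 1) / (t - 1))

/-- Smooth real functions on `ℍ`, in the standard coordinate `z = x + iy`. -/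
def IsSmooth (f : ℍ → ℝ) : Prop :=
  ContDiffOn ℝ ∞ (fun p : ℂ => f (ofComplex p)) {p : ℂ | 0 < p.im}

/-- The Laplace--Beltrami operator `Δ = y² (∂ₓ² + ∂_y²)`. -/
def hypLaplacian (f : ℍ → ℝ) (z : ℍ) : ℝ :=
  z.im ^ 2 * Laplacian.laplacian (fun p : ℂ => f (ofComplex p)) (z : ℂ)

/-! ### Fuchsian groups and integration over `Γ \ ℍ` -/

/-- The group of transformations of `ℍ` induced by `Γ`; it is isomorphic to `Γ / (Γ ∩ {±1})`. -/
abbrev transformationGroup (Γ : Subgroup SL(2, ℝ)) : Subgroup (Equiv.Perm ℍ) :=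
  (MulAction.toPermHom Γ ℍ).range

/-- `#(Γ ∩ {±1})`. -/
def centreCard (Γ : Subgroup SL(2, ℝ)) : ℕ :=
  ((Γ : Set SL(2, ℝ)) ∩ {1, -1}).ncard

open scoped Classical in
/-- A fundamental domain for the action of `Γ` on `ℍ` (the empty set if there is none). -/
def fundamentalSet (Γ : Subgroup SL(2, ℝ)) : Set ℍ :=
  if h : HasFundamentalDomain (transformationGroup Γ) ℍ volume then
    h.ExistsIsFundamentalDomain.choose
  else ∅

/-- The measure by which `Γ`-invariant functions on `ℍ` are integrated over `Γ \ ℍ`. The factor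
`1 / #(Γ ∩ {±1})` makes the unfolding formula `∫_{Γ \ ℍ} ∑_{γ ∈ Γ} f(γ z) = ∫_ℍ f` hold for the sum
over all `γ ∈ Γ`. -/
def quotVolume (Γ : Subgroup SL(2, ℝ)) : Measure ℍ :=
  ((centreCard Γ : ℝ≥0∞)⁻¹) • (volume : Measure ℍ).restrict (fundamentalSet Γ)

/-- `vol_Γ`, the volume of `Γ \ ℍ`. -/
def vol (Γ : Subgroup SL(2, ℝ)) : ℝ := (quotVolume Γ).real Set.univ

/-- Cofinite Fuchsian groups: discrete subgroups of `SL₂(ℝ)` with a quotient of finite volume. -/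
structure IsCofinite (Γ : Subgroup SL(2, ℝ)) : Prop where
  discrete : DiscreteTopology Γ
  hasFundamentalDomain : HasFundamentalDomain (transformationGroup Γ) ℍ volume
  finite_volume : quotVolume Γ Set.univ < ⊤

/-- `f` is invariant under the action of `Γ`. -/
def IsInvariant (Γ : Subgroup SL(2, ℝ)) (f : ℍ → ℝ) : Prop :=
  ∀ γ ∈ Γ, ∀ z : ℍ, f (γ • z) = f z

/-- Smooth and bounded `Γ`-invariant functions on `ℍ`. -/
structure IsSmoothBounded (Γ : Subgroup SL(2, ℝ)) (f : ℍ → ℝ) : Prop where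
  smooth : IsSmooth f
  bounded : ∃ C : ℝ, ∀ z, |f z| ≤ C
  invariant : IsInvariant Γ f

/-! ### The Green function of a Fuchsian group -/

/-- The real Hilbert space `L²(Γ \ ℍ)`. -/
abbrev L2 (Γ : Subgroup SL(2, ℝ)) := Lp ℝ 2 (quotVolume Γ)

/-- `a` lies in the domain of the self-adjoint operator `Δ_Γ` and `Δ_Γ a = v`.
The Laplace operator on the smooth bounded invariant functions `φ` with `Δ φ` bounded is
essentially self-adjoint, so its self-adjoint extension `Δ_Γ` is its Hilbert space adjoint:
`⟨a, Δ φ⟩ = ⟨v, φ⟩` for all such `φ`. -/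
def HasLaplacian (Γ : Subgroup SL(2, ℝ)) (a v : L2 Γ) : Prop :=
  ∀ φ : ℍ → ℝ, IsSmoothBounded Γ φ → (∃ C : ℝ, ∀ z, |hypLaplacian φ z| ≤ C) →
    ∫ z, a z * hypLaplacian φ z ∂(quotVolume Γ) = ∫ z, v z * φ z ∂(quotVolume Γ)

/-- The bounded self-adjoint operator `G_Γ` on `L²(Γ \ ℍ)` that inverts `Δ_Γ` on the orthogonal
complement of the constants: for all smooth bounded `f` one has
`Δ_Γ G_Γ f = f - (1/vol_Γ) ∫ f` and `∫ G_Γ f = 0`. Here `F` and `F₀` are the elements of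
`L²(Γ \ ℍ)` given by the functions `f` and `f - (1/vol_Γ) ∫ f`. -/
structure IsGreenOperator (Γ : Subgroup SL(2, ℝ)) (G : L2 Γ →L[ℝ] L2 Γ) : Prop where
  selfAdjoint : IsSelfAdjoint G
  laplacian : ∀ f : ℍ → ℝ, IsSmoothBounded Γ f → ∀ F F₀ : L2 Γ, F =ᵐ[quotVolume Γ] f →
    F₀ =ᵐ[quotVolume Γ] (fun z => f z - 1 / vol Γ * ∫ w, f w ∂(quotVolume Γ)) →
    HasLaplacian Γ (G F) F₀
  integral_eq_zero : ∀ f : ℍ → ℝ, IsSmoothBounded Γ f → ∀ F : L2 Γ, F =ᵐ[quotVolume Γ] f →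
    ∫ z, G F z ∂(quotVolume Γ) = 0

/-- `gr` is the Green function `gr_Γ` of `Γ`: it is invariant in both variables, symmetric, smooth
except for logarithmic singularities at the points `(z, γ z)`, and it is the integral kernel of
the operator `G_Γ` on smooth bounded functions. These properties determine `gr z w` for all `z, w`
with `z ∉ Γ w`; the values of `gr` at the singularities play no role. -/
structure IsGreenFunction (Γ : Subgroup SL(2, ℝ)) (gr : ℍ → ℍ → ℝ) : Prop where
  invariant_left : ∀ γ ∈ Γ, ∀ z w : ℍ, gr (γ • z) w = gr z w
  invariant_right : ∀ γ ∈ Γ, ∀ z w : ℍ, gr z (γ • w) = gr z w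
  symm : ∀ z w : ℍ, gr z w = gr w z
  smooth : ContDiffOn ℝ ∞ (fun p : ℂ × ℂ => gr (ofComplex p.1) (ofComplex p.2))
    {p : ℂ × ℂ | 0 < p.1.im ∧ 0 < p.2.im ∧ ∀ γ ∈ Γ, ofComplex p.1 ≠ γ • ofComplex p.2}
  log_singularity : ∀ w : ℍ, ∃ c : ℝ,
    (fun z : ℍ => gr z w - c * Real.log ‖(z : ℂ) - (w : ℂ)‖) =O[𝓝[≠] w] (fun _ => (1 : ℝ))
  kernel : ∃ G : L2 Γ →L[ℝ] L2 Γ, IsGreenOperator Γ G ∧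
    ∀ f : ℍ → ℝ, IsSmoothBounded Γ f →
      (∀ z : ℍ, Integrable (fun w => gr z w * f w) (quotVolume Γ)) ∧
      ∀ F : L2 Γ, F =ᵐ[quotVolume Γ] f →
        G F =ᵐ[quotVolume Γ] fun z => ∫ w, gr z w * f w ∂(quotVolume Γ)

/-- The desingularised Green function
`gr_Γ(z,w) + ∑_{γ ∈ Γ, u(z,γ w) ≤ δ} (L(u(z,γ w)) - L(δ))`; the sum is finite. -/
def desingularised (Γ : Subgroup SL(2, ℝ)) (gr : ℍ → ℍ → ℝ) (δ : ℝ) (z w : ℍ) : ℝ :=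
  gr z w + ∑ᶠ (γ : SL(2, ℝ)) (_ : γ ∈ Γ ∧ u z (γ • w) ≤ δ), (L (u z (γ • w)) - L δ)

/-! ### Cusps -/

/-- `Γ` as a subgroup of `GL₂(ℝ)`. -/
abbrev toGL2 (Γ : Subgroup SL(2, ℝ)) : Subgroup (GL (Fin 2) ℝ) :=
  Γ.map (Matrix.SpecialLinearGroup.mapGL ℝ)

/-- The cusps of `Γ`: orbits of fixed points in `ℙ¹(ℝ)` of parabolic elements of `Γ`, which
correspond to conjugacy classes of non-trivial maximal parabolic subgroups. -/
abbrev Cusps (Γ : Subgroup SL(2, ℝ)) := CuspOrbits (toGL2 Γ)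

/-- `Γ_𝔠`, the stabiliser in `Γ` of the point `σ_𝔠 ∞` of `ℙ¹(ℝ)`, where `σ = σ_𝔠`. -/
def cuspStabiliser (Γ : Subgroup SL(2, ℝ)) (σ : SL(2, ℝ)) : Subgroup SL(2, ℝ) :=
  Γ ⊓ (MulAction.stabilizer (GL (Fin 2) ℝ)
    (Matrix.SpecialLinearGroup.mapGL ℝ σ • (OnePoint.infty : OnePoint ℝ))).comap
      (Matrix.SpecialLinearGroup.mapGL ℝ)

/-- The matrix `(1 b; 0 1)`. -/
def translation (b : ℤ) : SL(2, ℝ) :=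
  ⟨!![1, (b : ℝ); 0, 1], by simp⟩

/-- `σ` is an admissible choice of `σ_𝔠`: the point `σ ∞` represents the cusp `𝔠`, and
`{±1} σ⁻¹ Γ_𝔠 σ = {±1} {(1 b; 0 1) | b ∈ ℤ}`. -/
structure IsCuspScaling (Γ : Subgroup SL(2, ℝ)) (c : Cusps Γ) (σ : SL(2, ℝ)) : Prop where
  represents : ∃ x : cuspsSubMulAction (toGL2 Γ),
    (x : OnePoint ℝ) = Matrix.SpecialLinearGroup.mapGL ℝ σ • (OnePoint.infty : OnePoint ℝ) ∧
      (Quotient.mk _ x : Cusps Γ) = c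
  conj_eq : ∀ g : SL(2, ℝ),
    (∃ γ ∈ cuspStabiliser Γ σ, g = σ⁻¹ * γ * σ ∨ g = -(σ⁻¹ * γ * σ)) ↔
      ∃ b : ℤ, g = translation b ∨ g = -translation b

/-- `q_𝔠(z) = exp(2πi σ_𝔠⁻¹ z)`. -/
def qCusp (σ : SL(2, ℝ)) (z : ℍ) : ℂ :=
  Complex.exp (2 * Real.pi * Complex.I * ((σ⁻¹ • z : ℍ) : ℂ))

/-- `y_𝔠(z) = Im σ_𝔠⁻¹ z`. -/
def yCusp (σ : SL(2, ℝ)) (z : ℍ) : ℝ := (σ⁻¹ • z).im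

/-- `C_𝔠(γ) = |c|` if `σ_𝔠⁻¹ γ σ_𝔠 = (a b; c d)`. -/
def CCusp (σ γ : SL(2, ℝ)) : ℝ := |(σ⁻¹ * γ * σ) 1 0|

/-- The image of `z` in `Γ \ ℍ`. -/
def toQuot (Γ : Subgroup SL(2, ℝ)) (z : ℍ) : MulAction.orbitRel.Quotient Γ ℍ :=
  Quotient.mk _ z

/-- The (punctured) disc `D_𝔠(ε)` in `Γ \ ℍ`: the image under `ℍ → ℍ → Γ \ ℍ`, where the first
map is `σ_𝔠`, of the strip `{x + iy | 0 ≤ x < 1, y > 1/ε}`. -/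
def cuspDisc (Γ : Subgroup SL(2, ℝ)) (σ : SL(2, ℝ)) (ε : ℝ) :
    Set (MulAction.orbitRel.Quotient Γ ℍ) :=
  (fun z : ℍ => toQuot Γ (σ • z)) '' {z : ℍ | 0 ≤ z.re ∧ z.re < 1 ∧ 1 / ε < z.im}

/-- The complement `Y` in `Γ \ ℍ` of the union of the discs `D_𝔠(ε_𝔠)`. -/
def cuspComplement (Γ : Subgroup SL(2, ℝ)) (σ : Cusps Γ → SL(2, ℝ)) (ε : Cusps Γ → ℝ) :
    Set (MulAction.orbitRel.Quotient Γ ℍ) :=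
  (⋃ c, cuspDisc Γ (σ c) (ε c))ᶜ

/-- `r_δ = (1/24π) (√(2/(δ-1)) + arctan √((δ-1)/2))`. -/
def rDelta (δ : ℝ) : ℝ :=
  1 / (24 * Real.pi) * (Real.sqrt (2 / (δ - 1)) + Real.arctan (Real.sqrt ((δ - 1) / 2)))

/-- `#(Γ ∩ {±1}) [ (1/ε') (1 - (2/π) arctan √((δ-1)/2)) + s ε' r_δ ]`, the correction to `B`
(`s = 1`) and to `A` (`s = -1`) on the disc `D_𝔠(ε')`. -/
def discCorrection (Γ : Subgroup SL(2, ℝ)) (δ ε' s : ℝ) : ℝ :=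
  centreCard Γ * (1 / ε' * (1 - 2 / Real.pi * Real.arctan (Real.sqrt ((δ - 1) / 2)))
    + s * (ε' * rDelta δ))

end FuchsianGreen

end

open FuchsianGreen

/-! Write `n` for `#(Γ ∩ {±1})`. The bounds come from the maximum principle on a disc around a cusp,
applied to the Green function after its singularities have been removed.

Harmonicity. Testing the self-adjoint operator `G` against the Laplacian of a periodised test
function shows that, in the variable `p`, the Euclidean Laplacian of `gr z p - (1/vol) log Im p` is
`n` times the sum of the point masses at the points `t • z`, with `t` running over the
transformations induced by `Γ` (`integral_sub_log_mul_laplacian`). As `gr` is smooth off the orbit,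
this function is harmonic there; at a point with trivial stabiliser its logarithmic singularity has
coefficient `n / 2π`. Passing to the coordinate of a cusp changes `log Im p` only by a harmonic
function (`harmonicAt_smul`).

Growth. High in a cusp, the mean value property expresses `gr(·, w)` through `G f` for a periodised
bump `f` around `w`, so it is square integrable there. The mean value property in the other variable
turns this into `gr - (1/vol) log y = o(y)` (`exists_abs_sub_log_le_mul_im`). Since `y` is a
multiple of `log (1/|q|)`, this is exactly what makes the puncture `q = 0` negligible for the
maximum principle (`cusp_max_principle`). Bounds on a horocycle therefore extend to the disc above
it (`cusp_le`).

Bounds on horocycles. Heights in a ratio of at least `δ + √(δ² - 1) = exp (arcosh δ)` force `u ≥ δ`.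
If `z` has height `1/ε` and the orbit of `w` stays below height `1/ε'`, the hypothesis relating `ε`
and `ε'` makes the desingularising sum vanish, and `A`, `B` bound `gr` itself. This gives (a), (a')
by symmetry, and (b) by a second application at the other cusp.

For (c), let `z` and `w` both have height `y = 1/ε'`. The lower bound on `C_𝔠(γ)` leaves only
translations in the desingularising sum, which becomes an explicit lattice sum. It is compared with
`-(1/2π) log (2 sin πx)`, which is `-(1/2π) log |q(z) - q(w)| - y`, in
`abs_translate_sum_add_log_sin_le`: half of each term is handled by Stirling's formula and the
reflection formula for `Γ`, the other half by writing a logarithm as a positive superposition of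
truncated parabolas. The errors add up to `ε' r_δ`. The maximum principle in `z`, followed by the
one in `w`, moves both points from the horocycle into the disc. -/

/-! ### The Euclidean Laplacian: conformal covariance and Green's identity -/

open InnerProductSpace Filter in
-- By the chain rule, the second derivative in direction `v` is `D²f(m'v, m'v) + Df(m''v²)`. Summing
-- over `v = 1` and `v = i`, the `m''` terms cancel because `i² = -1`, and multiplication by `m'` is
-- a similarity of ratio `|m'|`.
theorem laplacian_comp_analytic {f : ℂ → ℝ} {m : ℂ → ℂ} {z : ℂ}
    (hm : AnalyticAt ℂ m z) (hf : ContDiffAt ℝ 2 f (m z)) :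
    Laplacian.laplacian (fun p => f (m p)) z =
      ‖deriv m z‖ ^ 2 * Laplacian.laplacian f (m z) := by
  have hmz := hm.eventually_analyticAt
  have hfz : ∀ᶠ p in 𝓝 z, DifferentiableAt ℝ f (m p) := by
    have := hf.eventually (by simp)
    exact (hm.continuousAt.eventually this).mono fun p hp => hp.differentiableAt (by simp)
  -- the first derivative in a direction
  have h1 : ∀ v : ℂ, (fun p => fderiv ℝ (fun p => f (m p)) p v) =ᶠ[𝓝 z]
      fun p => fderiv ℝ f (m p) (deriv m p * v) := by
    intro v
    filter_upwards [hmz, hfz] with p hp hfp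
    have hd : HasFDerivAt m ((ContinuousLinearMap.toSpanSingleton ℂ (deriv m p)).restrictScalars ℝ) p :=
      hp.differentiableAt.hasDerivAt.hasFDerivAt.restrictScalars ℝ
    change fderiv ℝ (f ∘ m) p v = _
    rw [(hfp.hasFDerivAt.comp p hd).fderiv]
    simp [mul_comm]
  have hf' : DifferentiableAt ℝ (fderiv ℝ f) (m z) :=
    (hf.fderiv_right (m := 1) (by norm_num)).differentiableAt (by simp)
  have hmd : HasFDerivAt m ((ContinuousLinearMap.toSpanSingleton ℂ (deriv m z)).restrictScalars ℝ) z :=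
    hm.differentiableAt.hasDerivAt.hasFDerivAt.restrictScalars ℝ
  have hmdd : HasFDerivAt (deriv m)
      ((ContinuousLinearMap.toSpanSingleton ℂ (deriv (deriv m) z)).restrictScalars ℝ) z :=
    hm.deriv.differentiableAt.hasDerivAt.hasFDerivAt.restrictScalars ℝ
  have hC : ContDiffAt ℝ 2 (fun p => f (m p)) z :=
    hf.comp z ((hm.contDiffAt (n := 2)).restrict_scalars ℝ)
  have hC' : DifferentiableAt ℝ (fderiv ℝ (fun p => f (m p))) z :=
    (hC.fderiv_right (m := 1) (by norm_num)).differentiableAt (by simp)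
  have h2 : ∀ v : ℂ, iteratedFDeriv ℝ 2 (fun p => f (m p)) z ![v, v] =
      fderiv ℝ (fderiv ℝ f) (m z) (deriv m z * v) (deriv m z * v) +
        fderiv ℝ f (m z) (deriv (deriv m) z * (v * v)) := by
    intro v
    rw [iteratedFDeriv_two_apply]
    simp only [Matrix.cons_val_zero, Matrix.cons_val_one]
    have e1 : fderiv ℝ (fderiv ℝ (fun p => f (m p))) z v v =
        fderiv ℝ (fun p => fderiv ℝ (fun p => f (m p)) p v) z v := by
      rw [fderiv_clm_apply hC' (differentiableAt_const v)]; simp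
    rw [e1, (h1 v).fderiv_eq]
    have hA : HasFDerivAt (fun p => fderiv ℝ f (m p)) _ z := hf'.hasFDerivAt.comp z hmd
    have hB := hmdd.mul_const v
    rw [(hA.clm_apply hB).fderiv]
    simp [mul_comm, mul_left_comm, add_comm]
  have key : ∀ (B : ℂ →L[ℝ] ℂ →L[ℝ] ℝ) (a : ℂ), (∀ x y, B x y = B y x) →
      B a a + B (a * Complex.I) (a * Complex.I) = ‖a‖ ^ 2 * (B 1 1 + B Complex.I Complex.I) := by
    intro B a hB
    have ha : a = a.re • (1 : ℂ) + a.im • Complex.I := by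
      apply Complex.ext <;> simp
    have hai : a * Complex.I = (-a.im) • (1 : ℂ) + a.re • Complex.I := by
      apply Complex.ext <;> simp
    have hn : ‖a‖ ^ 2 = a.re ^ 2 + a.im ^ 2 := by
      rw [← Complex.normSq_eq_norm_sq, Complex.normSq_apply]; ring
    rw [hai, hn]
    nth_rewrite 1 2 [ha]
    simp only [map_add, map_smul, add_apply, smul_apply,
      smul_eq_mul]
    rw [hB Complex.I 1]
    ring
  rw [laplacian_eq_iteratedFDeriv_complexPlane, laplacian_eq_iteratedFDeriv_complexPlane]
  simp only
  rw [h2, h2, iteratedFDeriv_two_apply, iteratedFDeriv_two_apply]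
  simp only [Matrix.cons_val_zero, Matrix.cons_val_one]
  rw [← key (fderiv ℝ (fderiv ℝ f) (m z)) (deriv m z)]
  · have : fderiv ℝ f (m z) (deriv (deriv m) z * (Complex.I * Complex.I)) =
      - fderiv ℝ f (m z) (deriv (deriv m) z * (1 * 1)) := by
      rw [← map_neg]; congr 1; simp
    rw [this]; simp only [mul_one]; ring
  · intro x y
    have := hf.isSymmSndFDerivAt (by simp)
    exact this x y

/-- Two integrations by parts in each of the directions `1` and `i`. Smoothness of `g` is needed
only near the support of `χ`, so `g` may be singular elsewhere. -/
theorem integral_mul_laplacian_eq {g χ : ℂ → ℝ} {U : Set ℂ} (hU : IsOpen U)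
    (hg : ContDiffOn ℝ 2 g U) (hχ : ContDiff ℝ 2 χ) (hc : HasCompactSupport χ)
    (hs : tsupport χ ⊆ U) :
    ∫ p, g p * Laplacian.laplacian χ p = ∫ p, Laplacian.laplacian g p * χ p := by
  have hgd : ∀ x ∈ U, ContDiffAt ℝ 2 g x := fun x hx => hg.contDiffAt (hU.mem_nhds hx)
  have hg1 : ∀ v, ContinuousOn (fun p => fderiv ℝ g p v) U := fun v x hx =>
    (((hgd x hx).fderiv_right (m := 1) (by norm_num)).continuousAt.clm_apply
      continuousAt_const).continuousWithinAt
  have hg1d : ∀ v, ∀ x ∈ U, DifferentiableAt ℝ (fun p => fderiv ℝ g p v) x := fun v x hx =>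
    (((hgd x hx).fderiv_right (m := 1) (by norm_num)).differentiableAt (by simp)).clm_apply
      (differentiableAt_const v)
  have hg2 : ∀ v, ContinuousOn (fun p => fderiv ℝ (fun p => fderiv ℝ g p v) p v) U := by
    intro v x hx
    have : ContDiffAt ℝ 1 (fun p => fderiv ℝ g p v) x :=
      ((hgd x hx).fderiv_right (m := 1) (by norm_num)).clm_apply contDiffAt_const
    exact ((this.fderiv_right (m := 0) (by norm_num)).continuousAt.clm_apply
      continuousAt_const).continuousWithinAt
  have hχ1 : ∀ v, ContDiff ℝ 1 (fun p => fderiv ℝ χ p v) := fun v =>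
    (hχ.fderiv_right (m := 1) (by norm_num)).clm_apply contDiff_const
  have hχ2 : ∀ v, Continuous (fun p => fderiv ℝ (fun p => fderiv ℝ χ p v) p v) := fun v =>
    ((hχ1 v).fderiv_right (m := 0) (by norm_num)).continuous.clm_apply continuous_const
  have hs1 : ∀ v, tsupport (fun p => fderiv ℝ χ p v) ⊆ tsupport χ := fun v =>
    tsupport_fderiv_apply_subset ℝ v
  have hs2 : ∀ v, tsupport (fun p => fderiv ℝ (fun p => fderiv ℝ χ p v) p v) ⊆ tsupport χ :=
    fun v => (tsupport_fderiv_apply_subset ℝ v).trans (hs1 v)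
  -- integrability of products
  have hint : ∀ a b : ℂ → ℝ, ContinuousOn a U → Continuous b → tsupport b ⊆ tsupport χ →
      Integrable (fun p => a p * b p) := by
    intro a b ha hb hbs
    have hcb : HasCompactSupport b := hc.of_isClosed_subset (isClosed_tsupport b) hbs
    have hcont : Continuous (fun p => a p * b p) := by
      rw [continuous_iff_continuousAt]
      intro x
      by_cases hx : x ∈ tsupport b
      · exact ((ha x (hs (hbs hx))).continuousAt (hU.mem_nhds (hs (hbs hx)))).mul hb.continuousAt
      · have : (fun p => a p * b p) =ᶠ[𝓝 x] fun _ => 0 := by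
          filter_upwards [notMem_tsupport_iff_eventuallyEq.mp hx] with p hp
          simp [hp]
        exact this.continuousAt
    exact hcont.integrable_of_hasCompactSupport (hcb.mul_left)
  have main : ∀ v, ∫ p, g p * fderiv ℝ (fun p => fderiv ℝ χ p v) p v =
      ∫ p, fderiv ℝ (fun p => fderiv ℝ g p v) p v * χ p := by
    intro v
    rw [integral_mul_fderiv_eq_neg_fderiv_mul_of_integrable
        (hint _ _ (hg1 v) (hχ1 v).continuous (hs1 v)) (hint _ _ hg.continuousOn (hχ2 v) (hs2 v))
        (hint _ _ hg.continuousOn (hχ1 v).continuous (hs1 v))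
        (fun x hx => (hgd x (hs (hs1 v hx))).differentiableAt (by simp))
        (fun x _ => (hχ1 v).differentiable (by simp) x)]
    rw [integral_mul_fderiv_eq_neg_fderiv_mul_of_integrable
        (hint _ _ (hg2 v) hχ.continuous le_rfl) (hint _ _ (hg1 v) (hχ1 v).continuous (hs1 v))
        (hint _ _ (hg1 v) hχ.continuous le_rfl)
        (fun x hx => hg1d v x (hs hx))
        (fun x _ => hχ.differentiable (by simp) x)]
    simp
  have lapχ : ∀ p, Laplacian.laplacian χ p =
      fderiv ℝ (fun p => fderiv ℝ χ p 1) p 1 +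
      fderiv ℝ (fun p => fderiv ℝ χ p Complex.I) p Complex.I := by
    intro p
    have hd : DifferentiableAt ℝ (fderiv ℝ χ) p :=
      (hχ.fderiv_right (m := 1) (by norm_num)).differentiable (by simp) p
    rw [InnerProductSpace.laplacian_eq_iteratedFDeriv_complexPlane]
    simp only [iteratedFDeriv_two_apply, Matrix.cons_val_zero, Matrix.cons_val_one]
    rw [fderiv_clm_apply hd (differentiableAt_const _),
      fderiv_clm_apply hd (differentiableAt_const _)]
    simp
  have lapg : ∀ p ∈ U, Laplacian.laplacian g p =
      fderiv ℝ (fun p => fderiv ℝ g p 1) p 1 +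
      fderiv ℝ (fun p => fderiv ℝ g p Complex.I) p Complex.I := by
    intro p hp
    have hd : DifferentiableAt ℝ (fderiv ℝ g) p :=
      ((hgd p hp).fderiv_right (m := 1) (by norm_num)).differentiableAt (by simp)
    rw [InnerProductSpace.laplacian_eq_iteratedFDeriv_complexPlane]
    simp only [iteratedFDeriv_two_apply, Matrix.cons_val_zero, Matrix.cons_val_one]
    rw [fderiv_clm_apply hd (differentiableAt_const _),
      fderiv_clm_apply hd (differentiableAt_const _)]
    simp
  calc ∫ p, g p * Laplacian.laplacian χ p
      = ∫ p, (g p * fderiv ℝ (fun p => fderiv ℝ χ p 1) p 1 +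
          g p * fderiv ℝ (fun p => fderiv ℝ χ p Complex.I) p Complex.I) := by
        congr 1; ext p; rw [lapχ]; ring
    _ = ∫ p, (fderiv ℝ (fun p => fderiv ℝ g p 1) p 1 * χ p +
          fderiv ℝ (fun p => fderiv ℝ g p Complex.I) p Complex.I * χ p) := by
        rw [integral_add (hint _ _ hg.continuousOn (hχ2 _) (hs2 _))
          (hint _ _ hg.continuousOn (hχ2 _) (hs2 _)), main, main,
          integral_add (hint _ _ (hg2 _) hχ.continuous le_rfl)
          (hint _ _ (hg2 _) hχ.continuous le_rfl)]
    _ = _ := by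
        congr 1; ext p
        by_cases hp : p ∈ tsupport χ
        · rw [lapg p (hs hp)]; ring
        · simp [image_eq_zero_of_notMem_tsupport hp]

/-! ### Second derivative test and mean values -/

section

open InnerProductSpace

/-- If the second derivative were positive, the point would also be a local minimum. The function
would then be locally constant, with vanishing second derivative. -/
theorem deriv_deriv_nonpos_of_isLocalMax {f : ℝ → ℝ} {a : ℝ} (h : IsLocalMax f a)
    (hf : ContDiffAt ℝ 2 f a) : deriv (deriv f) a ≤ 0 := by
  by_contra hpos
  push Not at hpos
  have hmin := isLocalMin_of_deriv_deriv_pos hpos h.deriv_eq_zero hf.continuousAt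
  have hconst : f =ᶠ[𝓝 a] fun _ => f a := by
    filter_upwards [h, hmin] with x h1 h2 using le_antisymm h1 h2
  have : deriv f =ᶠ[𝓝 a] fun _ => 0 := by
    refine hconst.deriv.trans ?_
    simp
  rw [this.deriv_eq] at hpos
  simp at hpos

theorem laplacian_nonpos_of_isLocalMax {f : ℂ → ℝ} {z : ℂ} (h : IsLocalMax f z)
    (hf : ContDiffAt ℝ 2 f z) : Laplacian.laplacian f z ≤ 0 := by
  have key : ∀ v : ℂ, iteratedFDeriv ℝ 2 f z ![v, v] ≤ 0 := by
    intro v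
    set ℓ : ℝ → ℂ := fun t => z + (t : ℂ) * v with hℓ
    have hℓ0 : ℓ 0 = z := by simp [hℓ]
    have hℓd : ∀ t, HasDerivAt ℓ v t := by
      intro t
      have := ((Complex.ofRealCLM.hasDerivAt (x := t)).mul_const v).const_add z
      simpa [hℓ] using this
    have hℓc : ContDiff ℝ 2 ℓ := by
      have : ContDiff ℝ 2 (fun t : ℝ => (t : ℂ)) := Complex.ofRealCLM.contDiff
      exact contDiff_const.add (this.mul contDiff_const)
    have hmax : IsLocalMax (f ∘ ℓ) 0 := by
      have : Filter.Tendsto ℓ (𝓝 0) (𝓝 z) := by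
        have := hℓc.continuous.tendsto 0
        rwa [hℓ0] at this
      filter_upwards [this.eventually h] with t ht
      simpa [hℓ0] using ht
    have hcd : ContDiffAt ℝ 2 (f ∘ ℓ) 0 := by
      refine ContDiffAt.comp 0 ?_ hℓc.contDiffAt
      rwa [hℓ0]
    have hev : ∀ᶠ p in 𝓝 z, DifferentiableAt ℝ f p :=
      (hf.eventually (by simp)).mono fun p hp => hp.differentiableAt (by simp)
    have hev' : ∀ᶠ t in 𝓝 (0 : ℝ), DifferentiableAt ℝ f (ℓ t) := by
      have := hℓc.continuous.tendsto 0
      rw [hℓ0] at this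
      exact this.eventually hev
    have h1 : deriv (f ∘ ℓ) =ᶠ[𝓝 0] fun t => fderiv ℝ f (ℓ t) v := by
      filter_upwards [hev'] with t ht
      exact (ht.hasFDerivAt.comp_hasDerivAt t (hℓd t)).deriv
    have hf' : DifferentiableAt ℝ (fderiv ℝ f) (ℓ 0) := by
      rw [hℓ0]
      exact (hf.fderiv_right (m := 1) (by norm_num)).differentiableAt (by simp)
    have h2 : deriv (deriv (f ∘ ℓ)) 0 = iteratedFDeriv ℝ 2 f z ![v, v] := by
      rw [h1.deriv_eq, iteratedFDeriv_two_apply]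
      simp only [Matrix.cons_val_zero, Matrix.cons_val_one]
      have := ((hf'.hasFDerivAt.comp_hasDerivAt 0 (hℓd 0)).clm_apply (hasDerivAt_const (0:ℝ) v)).deriv
      rw [hℓ0] at this
      simpa using this
    rw [← h2]
    exact deriv_deriv_nonpos_of_isLocalMax hmax hcd
  rw [laplacian_eq_iteratedFDeriv_complexPlane]
  have := key 1
  have := key Complex.I
  simp only
  linarith

theorem integral_eq_integral_circleAverage {F : ℂ → ℝ} (hF : Continuous F)
    (hc : HasCompactSupport F) (w : ℂ) :
    ∫ p, F p = ∫ r in Set.Ioi (0 : ℝ), 2 * Real.pi * r * Real.circleAverage F w r := by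
  rw [← integral_add_left_eq_self F w, ← Complex.integral_comp_polarCoord_symm, polarCoord_target,
    Measure.volume_eq_prod]
  have hsymm : ∀ p : ℝ × ℝ, w + Complex.polarCoord.symm p = circleMap w p.1 p.2 := by
    intro p
    rw [Complex.polarCoord_symm_apply, circleMap, Complex.exp_mul_I]
    push_cast
    ring
  simp only [hsymm]
  have hcont : Continuous (fun p : ℝ × ℝ => p.1 • F (circleMap w p.1 p.2)) := by
    refine continuous_fst.smul (hF.comp ?_)
    unfold circleMap
    fun_prop
  obtain ⟨R, hR⟩ := hc.isCompact.isBounded.subset_closedBall w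
  have hint : IntegrableOn (fun p : ℝ × ℝ => p.1 • F (circleMap w p.1 p.2))
      (Set.Ioi 0 ×ˢ Set.Ioo (-Real.pi) Real.pi) (volume.prod volume) := by
    have h1 : IntegrableOn (fun p : ℝ × ℝ => p.1 • F (circleMap w p.1 p.2))
        (Set.Icc 0 (|R|) ×ˢ Set.Icc (-Real.pi) Real.pi) (volume.prod volume) :=
      hcont.continuousOn.integrableOn_compact (isCompact_Icc.prod isCompact_Icc)
    refine h1.of_forall_sdiff_eq_zero (measurableSet_Ioi.prod measurableSet_Ioo) ?_
    rintro ⟨r, θ⟩ ⟨⟨hr, hθ⟩, hn⟩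
    have hrR : |R| < r := by
      by_contra hle
      exact hn ⟨⟨le_of_lt hr, not_lt.mp hle⟩, ⟨hθ.1.le, hθ.2.le⟩⟩
    have : circleMap w r θ ∉ tsupport F := by
      intro hmem
      have := hR hmem
      rw [Metric.mem_closedBall, Complex.dist_eq, circleMap_sub_center, norm_circleMap_zero] at this
      have := le_abs_self r
      have := le_abs_self R
      linarith
    simp [image_eq_zero_of_notMem_tsupport this]
  rw [setIntegral_prod _ hint]
  refine setIntegral_congr_fun measurableSet_Ioi fun r _ => ?_
  simp only [smul_eq_mul]
  rw [integral_const_mul, Real.circleAverage_def, ← integral_Ioc_eq_integral_Ioo,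
    ← intervalIntegral.integral_of_le (by linarith [Real.pi_pos])]
  have hper : Function.Periodic (fun θ => F (circleMap w r θ)) (2 * Real.pi) := by
    intro θ
    simp only [periodic_circleMap w r θ]
  have := hper.intervalIntegral_add_eq (-Real.pi) 0
  rw [show -Real.pi + 2 * Real.pi = Real.pi by ring, zero_add] at this
  rw [this, smul_eq_mul]
  field_simp

/-- In polar coordinates `ρ` is constant on each circle, and the mean value property replaces the
average of `H` by `H w`. Circles of radius greater than `R` contribute nothing, since `ρ` vanishes
there. -/
theorem integral_mul_radial_eq {H ρ : ℂ → ℝ} {w : ℂ} {R : ℝ}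
    (hH : HarmonicOnNhd H (Metric.closedBall w R)) (hρ : Continuous ρ) {b : ℝ → ℝ}
    (hb : ∀ p, ρ p = b ‖p - w‖) (hs : tsupport ρ ⊆ Metric.closedBall w R) :
    ∫ p, H p * ρ p = H w * ∫ p, ρ p := by
  have hρc : HasCompactSupport ρ :=
    (isCompact_closedBall w R).of_isClosed_subset (isClosed_tsupport ρ) hs
  have hcont : Continuous (fun p => H p * ρ p) := by
    rw [continuous_iff_continuousAt]
    intro x
    by_cases hx : x ∈ tsupport ρ
    · exact ((hH x (hs hx)).1.continuousAt).mul hρ.continuousAt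
    · have : (fun p => H p * ρ p) =ᶠ[𝓝 x] fun _ => 0 := by
        filter_upwards [notMem_tsupport_iff_eventuallyEq.mp hx] with p hp
        simp [hp]
      exact this.continuousAt
  rw [integral_eq_integral_circleAverage hcont hρc.mul_left w,
    integral_eq_integral_circleAverage hρ hρc w, ← integral_const_mul]
  refine setIntegral_congr_fun measurableSet_Ioi fun r hr => ?_
  have hr0 : (0 : ℝ) < r := hr
  have e1 : Real.circleAverage ρ w r = b r := by
    have : Set.EqOn ρ (fun _ => b r) (Metric.sphere w |r|) := by
      intro p hp
      rw [hb]
      rw [mem_sphere_iff_norm, abs_of_pos hr0] at hp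
      simp only [hp]
    rw [Real.circleAverage_congr_sphere this, Real.circleAverage_const]
  have e2 : Real.circleAverage (fun p => H p * ρ p) w r = Real.circleAverage H w r * b r := by
    have : Set.EqOn (fun p => H p * ρ p) (b r • H) (Metric.sphere w |r|) := by
      intro p hp
      rw [mem_sphere_iff_norm, abs_of_pos hr0] at hp
      simp only [hb, hp, Pi.smul_apply, smul_eq_mul]
      ring
    rw [Real.circleAverage_congr_sphere this, Real.circleAverage_smul, smul_eq_mul]
    ring
  rw [e1, e2]
  by_cases hrR : r ≤ R
  · rw [InnerProductSpace.HarmonicOnNhd.circleAverage_eq]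
    · ring
    · intro x hx
      refine hH x (Metric.closedBall_subset_closedBall ?_ hx)
      rwa [abs_of_pos hr0]
  · have : b r = 0 := by
      have h1 := hb (w + r)
      simp only [add_sub_cancel_left, Complex.norm_real, Real.norm_eq_abs, abs_of_pos hr0] at h1
      rw [← h1]
      apply image_eq_zero_of_notMem_tsupport
      intro hmem
      have := hs hmem
      rw [Metric.mem_closedBall, Complex.dist_eq] at this
      simp only [add_sub_cancel_left, Complex.norm_real, Real.norm_eq_abs, abs_of_pos hr0] at this
      exact hrR this
    simp [this]

/-- This bounded function has strictly positive Laplacian. Adding a small multiple of it to a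
harmonic function excludes interior maxima by the second derivative test alone. -/
theorem laplacian_exp_neg_im (p : ℂ) :
    ContDiff ℝ 2 (fun p : ℂ => Real.exp (-p.im)) ∧
    Laplacian.laplacian (fun p : ℂ => Real.exp (-p.im)) p = Real.exp (-p.im) := by
  have hd : ∀ p : ℂ, HasFDerivAt (fun p : ℂ => Real.exp (-p.im))
      (Real.exp (-p.im) • (-Complex.imCLM)) p := by
    intro p
    exact (Complex.imCLM.hasFDerivAt.neg).exp
  have hf : fderiv ℝ (fun p : ℂ => Real.exp (-p.im)) =
      fun p => Real.exp (-p.im) • (-Complex.imCLM) := funext fun p => (hd p).fderiv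
  refine ⟨Real.contDiff_exp.comp (Complex.imCLM.contDiff.neg), ?_⟩
  rw [laplacian_eq_iteratedFDeriv_complexPlane]
  simp only [iteratedFDeriv_two_apply, Matrix.cons_val_zero, Matrix.cons_val_one]
  rw [hf, ((hd p).smul_const (-Complex.imCLM)).fderiv]
  simp

/-! ### The maximum principle on a punctured disc, in the periodic coordinate -/

theorem exp_two_pi_I_add_one (p : ℂ) :
    Complex.exp (2 * Real.pi * Complex.I * (p + 1)) = Complex.exp (2 * Real.pi * Complex.I * p) := by
  rw [mul_add, mul_one, Complex.exp_add, Complex.exp_two_pi_mul_I, mul_one]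

theorem exp_two_pi_I_sub_int (p : ℂ) (k : ℤ) :
    Complex.exp (2 * Real.pi * Complex.I * (p - k)) =
      Complex.exp (2 * Real.pi * Complex.I * p) := by
  rw [mul_sub, mul_comm (2 * (Real.pi : ℂ) * Complex.I) (k : ℂ), Complex.exp_sub,
    Complex.exp_int_mul_two_pi_mul_I, div_one]

theorem norm_exp_two_pi_I (p : ℂ) :
    ‖Complex.exp (2 * Real.pi * Complex.I * p)‖ = Real.exp (-(2 * Real.pi * p.im)) := by
  rw [Complex.norm_exp]
  congr 1
  simp

/-- With `q = exp(2πip)`, this is the maximum principle on a closed disc minus `0` and `q₁`, for a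
function that is `o(log)` at both points. Such singularities are absorbed by barriers `η log|q -
q₁|` and `-ηy` with `η → 0`. The point `q₁` may lie on the boundary circle; this case is needed when
both points lie on the same horocycle. -/
theorem cusp_max_principle {h : ℂ → ℝ} {y₀ B : ℝ} (hy₀ : 0 < y₀) {q₁ : ℂ}
    (hper : ∀ p : ℂ, 0 < p.im → h (p + 1) = h p)
    (hharm : ∀ p : ℂ, y₀ < p.im → Complex.exp (2 * Real.pi * Complex.I * p) ≠ q₁ → HarmonicAt h p)
    (hcont : ContinuousOn h {p | y₀ ≤ p.im ∧ Complex.exp (2 * Real.pi * Complex.I * p) ≠ q₁})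
    (hgrow : ∀ η > 0, ∃ Y : ℝ, ∀ p : ℂ, Y < p.im → h p ≤ η * p.im)
    (hsing : ∀ η > 0, ∃ r > 0, ∀ p : ℂ, y₀ ≤ p.im → Complex.exp (2 * Real.pi * Complex.I * p) ≠ q₁ →
      ‖Complex.exp (2 * Real.pi * Complex.I * p) - q₁‖ < r →
      h p ≤ -η * Real.log ‖Complex.exp (2 * Real.pi * Complex.I * p) - q₁‖)
    (hbd : ∀ p : ℂ, p.im = y₀ → Complex.exp (2 * Real.pi * Complex.I * p) ≠ q₁ → h p ≤ B)
    (p : ℂ) (hp : y₀ ≤ p.im) (hpq : Complex.exp (2 * Real.pi * Complex.I * p) ≠ q₁) : h p ≤ B := by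
  set E : ℂ → ℂ := fun p => Complex.exp (2 * Real.pi * Complex.I * p) with hE
  have hEan : ∀ p, AnalyticAt ℂ E p := fun p => by
    have : Differentiable ℂ E := by rw [hE]; fun_prop
    exact this.analyticAt p
  have hEc : Continuous E := by rw [hE]; fun_prop
  have hEint : ∀ (p : ℂ) (k : ℤ), E (p - k) = E p := exp_two_pi_I_sub_int
  have hperZ : ∀ (k : ℤ) (p : ℂ), 0 < p.im → h (p - k) = h p := by
    intro k
    induction k with
    | zero => intro p _; simp
    | succ i ih =>
      intro p hp
      have := hper (p - (i + 1 : ℤ)) (by simpa using hp)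
      rw [← this]
      have := ih p hp
      rw [← this]
      congr 1; push_cast; ring
    | pred i ih =>
      intro p hp
      rw [← ih p hp, ← hper (p - (-i : ℤ)) (by simpa using hp)]
      congr 1; push_cast; ring
  set C₁ : ℝ := Real.log (1 + ‖q₁‖) with hC₁
  have hbar : ∀ p : ℂ, y₀ ≤ p.im → E p ≠ q₁ → Real.log ‖E p - q₁‖ ≤ C₁ := by
    intro p hp hq
    refine Real.log_le_log (norm_pos_iff.mpr (sub_ne_zero.mpr hq)) ?_
    refine (norm_sub_le _ _).trans ?_
    gcongr
    rw [hE]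
    simp only [norm_exp_two_pi_I]
    rw [Real.exp_le_one_iff]
    have : 0 < p.im := by linarith
    have := Real.pi_pos
    rw [neg_nonpos]; positivity
  have main : ∀ η > 0, h p + η * Real.log ‖E p - q₁‖ - η * p.im ≤ B + η * (C₁ + 1) := by
    intro η hη
    by_contra hcon
    push Not at hcon
    -- The two barriers drive `H` down at `q₁` and at the cusp, and the exponential makes it
    -- strictly subharmonic. Assuming the bound fails at `p`, the value `m = H p` exceeds everything
    -- `H` attains on the boundary, at the cusp and near `q₁`.
    set H : ℂ → ℝ := fun p => h p + η * Real.log ‖E p - q₁‖ - η * p.im + η * Real.exp (-p.im) with hH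
    set m := H p with hm
    have hexp : ∀ p : ℂ, y₀ ≤ p.im → Real.exp (-p.im) ≤ 1 := fun p hp => by
      rw [Real.exp_le_one_iff]; linarith
    have hmB : B + η * (C₁ + 1) < m := by
      have : 0 < η * Real.exp (-p.im) := by positivity
      simp only [hm, hH]; linarith
    have hHper : ∀ (k : ℤ) (p : ℂ), 0 < p.im → H (p - k) = H p := by
      intro k p hp
      simp only [hH, hperZ k p hp, hEint]
      simp
    obtain ⟨Y₁, hY₁⟩ := hgrow (η / 2) (by positivity)
    obtain ⟨r₁, hr₁, hr₁'⟩ := hsing (η / 2) (by positivity)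
    -- Half of each barrier survives the growth of `h`. The second entries of `Y` and `r` are the
    -- thresholds beyond which the surviving half pushes `H` below `m`.
    set Y := max Y₁ (2 * (η * (C₁ + 1) - m) / η) with hY
    set r := min r₁ (Real.exp (2 * (m - η) / η)) with hr
    have hr0 : 0 < r := lt_min hr₁ (Real.exp_pos _)
    have hhigh : ∀ p : ℂ, y₀ ≤ p.im → E p ≠ q₁ → Y < p.im → H p < m := by
      intro p hp hq hpY
      have h1 := hY₁ p ((le_max_left _ _).trans_lt hpY)
      have h2 : 2 * (η * (C₁ + 1) - m) / η < p.im := (le_max_right _ _).trans_lt hpY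
      rw [div_lt_iff₀ hη] at h2
      have h3 := mul_le_mul_of_nonneg_left (hbar p hp hq) hη.le
      have h4 := mul_le_mul_of_nonneg_left (hexp p hp) hη.le
      simp only [hH]; nlinarith
    have hnear : ∀ p : ℂ, y₀ ≤ p.im → E p ≠ q₁ → ‖E p - q₁‖ < r → H p < m := by
      intro p hp hq hpr
      have h1 := hr₁' p hp hq (hpr.trans_le (min_le_left _ _))
      have h2 : ‖E p - q₁‖ < Real.exp (2 * (m - η) / η) := hpr.trans_le (min_le_right _ _)
      rw [← Real.log_lt_iff_lt_exp (norm_pos_iff.mpr (sub_ne_zero.mpr hq)), lt_div_iff₀ hη] at h2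
      have h4 := mul_le_mul_of_nonneg_left (hexp p hp) hη.le
      have h5 : 0 < η * p.im := by have : 0 < p.im := by linarith
                                   positivity
      simp only [hH]; nlinarith
    -- By periodicity one period suffices. Outside `K` and its integer translates `H` is below `m`,
    -- so a maximum over the compact set `K` is a maximum over the whole region.
    set K : Set ℂ := (Set.Icc 0 1 ×ℂ Set.Icc y₀ Y) ∩ {p | r ≤ ‖E p - q₁‖} with hK
    have hKc : IsCompact K :=
      (isCompact_Icc.reProdIm isCompact_Icc).inter_right
        (isClosed_le continuous_const (hEc.sub continuous_const).norm)
    have hKsub : K ⊆ {p | y₀ ≤ p.im ∧ E p ≠ q₁} := by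
      rintro p ⟨hp, hpr⟩
      rw [Complex.mem_reProdIm] at hp
      refine ⟨hp.2.1, fun h => ?_⟩
      have : r ≤ ‖E p - q₁‖ := hpr
      rw [h, sub_self, norm_zero] at this
      linarith
    have hHc : ContinuousOn H {p | y₀ ≤ p.im ∧ E p ≠ q₁} := by
      refine ((hcont.add ?_).sub ?_).add ?_
      · refine continuousOn_const.mul (ContinuousOn.log ?_ ?_)
        · exact (hEc.sub continuous_const).norm.continuousOn
        · intro x hx; exact (norm_pos_iff.mpr (sub_ne_zero.mpr hx.2)).ne'
      · exact (continuous_const.mul Complex.continuous_im).continuousOn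
      · exact (continuous_const.mul (Real.continuous_exp.comp Complex.continuous_im.neg)).continuousOn
    have hred : ∀ p : ℂ, y₀ ≤ p.im → E p ≠ q₁ → H p < m ∨ p - (⌊p.re⌋ : ℤ) ∈ K := by
      intro p hp hq
      by_cases h1 : Y < p.im
      · exact Or.inl (hhigh p hp hq h1)
      by_cases h2 : ‖E p - q₁‖ < r
      · exact Or.inl (hnear p hp hq h2)
      refine Or.inr ⟨?_, ?_⟩
      · rw [Complex.mem_reProdIm]
        simp only [Complex.sub_re, Complex.intCast_re, Complex.sub_im, Complex.intCast_im, sub_zero]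
        exact ⟨⟨sub_nonneg.mpr (Int.floor_le _), by linarith [Int.lt_floor_add_one p.re]⟩,
          ⟨hp, not_lt.mp h1⟩⟩
      · simp only [Set.mem_ofPred_eq, hEint]
        exact not_lt.mp h2
    have hKne : K.Nonempty := by
      rcases hred p hp hpq with h1 | h1
      · exact absurd h1 (lt_irrefl _)
      · exact ⟨_, h1⟩
    obtain ⟨p₀, hp₀K, hp₀⟩ := hKc.exists_isMaxOn hKne (hHc.mono hKsub)
    have hm₀ : m ≤ H p₀ := by
      rcases hred p hp hpq with h1 | h1
      · exact absurd h1 (lt_irrefl _)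
      · have : H (p - (⌊p.re⌋ : ℤ)) ≤ H p₀ := hp₀ h1
        rwa [hHper _ _ (by linarith)] at this
    have hglob : ∀ p : ℂ, y₀ ≤ p.im → E p ≠ q₁ → H p ≤ H p₀ := by
      intro p hp hq
      rcases hred p hp hq with h1 | h1
      · linarith
      · have : H (p - (⌊p.re⌋ : ℤ)) ≤ H p₀ := hp₀ h1
        rwa [hHper _ _ (by linarith)] at this
    obtain ⟨hp₀y, hp₀q⟩ := hKsub hp₀K
    have hint : y₀ < p₀.im := by
      refine lt_of_le_of_ne hp₀y fun heq => ?_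
      have h1 := hbd p₀ heq.symm hp₀q
      have h3 := mul_le_mul_of_nonneg_left (hbar p₀ hp₀y hp₀q) hη.le
      have h4 := mul_le_mul_of_nonneg_left (hexp p₀ hp₀y) hη.le
      have h5 : 0 < η * p₀.im := by rw [← heq]; positivity
      simp only [hH] at hm₀
      linarith
    have hev : ∀ᶠ p in 𝓝 p₀, y₀ < p.im ∧ E p ≠ q₁ :=
      (Complex.continuous_im.continuousAt.eventually (lt_mem_nhds hint)).and
        (hEc.continuousAt.eventually (isOpen_ne.mem_nhds hp₀q))
    have hmax : IsLocalMax H p₀ := hev.mono fun p hp => hglob p hp.1.le hp.2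
    have hlog : HarmonicAt (fun p => Real.log ‖E p - q₁‖) p₀ :=
      ((hEan p₀).sub analyticAt_const).harmonicAt_log_norm (sub_ne_zero.mpr hp₀q)
    have him : HarmonicAt (fun p : ℂ => p.im) p₀ := analyticAt_id.harmonicAt_im
    have hharm' : HarmonicAt (h + η • (fun p => Real.log ‖E p - q₁‖) - η • (fun p : ℂ => p.im)) p₀ :=
      ((hharm p₀ hint hp₀q).add hlog.const_smul).sub him.const_smul
    obtain ⟨he1, he2⟩ := laplacian_exp_neg_im p₀
    have hHeq : H = (h + η • (fun p => Real.log ‖E p - q₁‖) - η • (fun p : ℂ => p.im)) +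
        η • (fun p : ℂ => Real.exp (-p.im)) := by
      ext p; simp [hH]
    have hlap : Laplacian.laplacian H p₀ = η * Real.exp (-p₀.im) := by
      rw [hHeq, ContDiffAt.laplacian_add hharm'.1
          (show ContDiffAt ℝ 2 (η • fun p : ℂ => Real.exp (-p.im)) p₀ from
            he1.contDiffAt.const_smul η),
        hharm'.2.eq_of_nhds, laplacian_smul _ he1.contDiffAt, he2]
      simp
    have hcd : ContDiffAt ℝ 2 H p₀ := by
      rw [hHeq]; exact hharm'.1.add (he1.contDiffAt.const_smul η)
    have := laplacian_nonpos_of_isLocalMax hmax hcd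
    rw [hlap] at this
    have : 0 < η * Real.exp (-p₀.im) := by positivity
    linarith
  -- At the fixed point `p` the excess over `B` is `ηD`, which is made smaller than any `e > 0` by
  -- the choice of `η`.
  set D := C₁ + 1 + p.im - Real.log ‖E p - q₁‖ with hD
  refine le_of_forall_pos_le_add fun e he => ?_
  have := main (e / (|D| + 1)) (by positivity)
  have h2 : h p ≤ B + e / (|D| + 1) * D := by rw [hD]; linarith
  refine h2.trans ?_
  gcongr
  rw [div_mul_eq_mul_div, div_le_iff₀ (by positivity)]
  gcongr
  linarith [le_abs_self D]

/-! ### Logarithmic cutoffs and the coefficient of a logarithmic singularity -/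

theorem two_le_infty : (2 : WithTop ℕ∞) ≤ ((⊤ : ℕ∞) : WithTop ℕ∞) := by
  exact ENat.LEInfty.out

theorem laplacian_comp_re {b : ℝ → ℝ} (hb : ContDiff ℝ 2 b) (z : ℂ) :
    Laplacian.laplacian (fun p : ℂ => b p.re) z = deriv (deriv b) z.re := by
  have hd : ∀ p : ℂ, HasFDerivAt (fun p : ℂ => b p.re) (deriv b p.re • Complex.reCLM) p :=
    fun p => ((hb.differentiable (by simp)) p.re).hasDerivAt.comp_hasFDerivAt p
      Complex.reCLM.hasFDerivAt
  have hf : fderiv ℝ (fun p : ℂ => b p.re) = fun p => deriv b p.re • Complex.reCLM :=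
    funext fun p => (hd p).fderiv
  have hb' : Differentiable ℝ (deriv b) :=
    (hb.iterate_deriv' 1 1).differentiable (by simp)
  have hd' : HasFDerivAt (fun p : ℂ => deriv b p.re) (deriv (deriv b) z.re • Complex.reCLM) z :=
    (hb' z.re).hasDerivAt.comp_hasFDerivAt z Complex.reCLM.hasFDerivAt
  rw [laplacian_eq_iteratedFDeriv_complexPlane]
  simp only [iteratedFDeriv_two_apply, Matrix.cons_val_zero, Matrix.cons_val_one]
  rw [hf, (hd'.smul_const Complex.reCLM).fderiv]
  simp

open Classical in
/-- The radial function `b (log |p - w|)`, extended by `1` to `p = w`. -/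
noncomputable def logRadial (b : ℝ → ℝ) (w p : ℂ) : ℝ :=
  if p = w then 1 else b (Real.log ‖p - w‖)

theorem logRadial_of_ne {b : ℝ → ℝ} {w p : ℂ} (h : p ≠ w) :
    logRadial b w p = b (Real.log ‖p - w‖) := if_neg h

theorem logRadial_eventuallyEq {b : ℝ → ℝ} {w p : ℂ} (h : p ≠ w) :
    logRadial b w =ᶠ[𝓝 p] fun p => b (Real.log ‖p - w‖) := by
  filter_upwards [isOpen_ne.mem_nhds h] with q hq using logRadial_of_ne hq

theorem logRadial_eventuallyEq_one {b : ℝ → ℝ} {s₀ : ℝ} (h0 : ∀ s ≤ s₀, b s = 1) (w : ℂ) :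
    ∀ p ∈ Metric.ball w (Real.exp s₀), logRadial b w p = 1 := by
  intro p hp
  by_cases h : p = w
  · simp [logRadial, h]
  · rw [logRadial_of_ne h]
    apply h0
    rw [Real.log_le_iff_le_exp (norm_pos_iff.mpr (sub_ne_zero.mpr h))]
    rw [Metric.mem_ball, Complex.dist_eq] at hp
    exact hp.le

theorem logRadial_eq_zero {b : ℝ → ℝ} {s₁ : ℝ} (h1 : ∀ s ≥ s₁, b s = 0) {w p : ℂ}
    (hp : Real.exp s₁ ≤ ‖p - w‖) : logRadial b w p = 0 := by
  have : 0 < ‖p - w‖ := (Real.exp_pos _).trans_le hp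
  rw [logRadial_of_ne (sub_ne_zero.mp (norm_pos_iff.mp this))]
  apply h1
  rwa [ge_iff_le, Real.le_log_iff_exp_le this]

theorem contDiff_logRadial {b : ℝ → ℝ} {s₀ : ℝ} (hb : ContDiff ℝ ∞ b) (h0 : ∀ s ≤ s₀, b s = 1)
    (w : ℂ) : ContDiff ℝ ∞ (logRadial b w) := by
  rw [contDiff_iff_contDiffAt]
  intro p
  by_cases h : p = w
  · have : logRadial b w =ᶠ[𝓝 p] fun _ => 1 := by
      rw [h]
      filter_upwards [Metric.ball_mem_nhds w (Real.exp_pos s₀)] with q hq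
        using logRadial_eventuallyEq_one h0 w q hq
    exact contDiffAt_const.congr_of_eventuallyEq this
  · refine ContDiffAt.congr_of_eventuallyEq ?_ (logRadial_eventuallyEq h)
    refine hb.contDiffAt.comp p (ContDiffAt.log ?_ (norm_pos_iff.mpr (sub_ne_zero.mpr h)).ne')
    exact (contDiffAt_id.sub contDiffAt_const).norm ℝ (sub_ne_zero.mpr h)

/-- The map `ζ ↦ w + exp ζ` turns the function into `b (Re ζ)`, whose Laplacian is `b''`. Conformal
covariance contributes the factor `|p - w|²`. -/
theorem laplacian_logRadial {b : ℝ → ℝ} (hb : ContDiff ℝ ∞ b) {w p : ℂ} (h : p ≠ w) :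
    Laplacian.laplacian (logRadial b w) p =
      deriv (deriv b) (Real.log ‖p - w‖) / ‖p - w‖ ^ 2 := by
  have hsub : p - w ≠ 0 := sub_ne_zero.mpr h
  have hm : AnalyticAt ℂ (fun ζ => w + Complex.exp ζ) (Complex.log (p - w)) := by fun_prop
  have hmz : w + Complex.exp (Complex.log (p - w)) = p := by rw [Complex.exp_log hsub]; ring
  have hcd : ContDiffAt ℝ 2 (fun p => b (Real.log ‖p - w‖)) (w + Complex.exp (Complex.log (p - w))) := by
    rw [hmz]
    refine (hb.of_le two_le_infty).contDiffAt.comp p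
      (ContDiffAt.log ?_ (norm_pos_iff.mpr hsub).ne')
    exact (contDiffAt_id.sub contDiffAt_const).norm ℝ hsub
  have key := laplacian_comp_analytic hm hcd
  rw [hmz] at key
  rw [laplacian_congr_nhds (logRadial_eventuallyEq h) |>.eq_of_nhds]
  have e1 : (fun ζ => b (Real.log ‖w + Complex.exp ζ - w‖)) = fun ζ : ℂ => b ζ.re := by
    ext ζ
    rw [add_sub_cancel_left, Complex.norm_exp, Real.log_exp]
  have e2 : deriv (fun ζ => w + Complex.exp ζ) (Complex.log (p - w)) = p - w := by
    rw [((Complex.hasDerivAt_exp _).const_add w).deriv, Complex.exp_log hsub]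
  rw [e1, e2, laplacian_comp_re (hb.of_le two_le_infty), Complex.log_re] at key
  have : ‖p - w‖ ≠ 0 := (norm_pos_iff.mpr hsub).ne'
  rw [key]
  field_simp

theorem deriv_deriv_eq_zero_of_eventually_const {b : ℝ → ℝ} {s c : ℝ} (h : b =ᶠ[𝓝 s] fun _ => c) :
    deriv (deriv b) s = 0 := by
  have : deriv b =ᶠ[𝓝 s] fun _ => 0 := h.deriv.trans (by simp)
  rw [this.deriv_eq]; simp

theorem deriv_deriv_cutoff_eq_zero {b : ℝ → ℝ} {s₀ s₁ : ℝ} (hb : ContDiff ℝ ∞ b)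
    (h0 : ∀ s ≤ s₀, b s = 1) (h1 : ∀ s ≥ s₁, b s = 0) :
    ∀ s, s ∉ Set.Ioo s₀ s₁ → deriv (deriv b) s = 0 := by
  have hc : Continuous (deriv (deriv b)) :=
    (hb.iterate_deriv 2).continuous
  have hl : ∀ s < s₀, deriv (deriv b) s = 0 := fun s hs =>
    deriv_deriv_eq_zero_of_eventually_const (c := 1)
      (by filter_upwards [gt_mem_nhds hs] with t ht using h0 t (le_of_lt ht))
  have hr : ∀ s > s₁, deriv (deriv b) s = 0 := fun s hs =>
    deriv_deriv_eq_zero_of_eventually_const (c := 0)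
      (by filter_upwards [lt_mem_nhds hs] with t ht using h1 t (le_of_lt ht))
  intro s hs
  have hcl : IsClosed {s | deriv (deriv b) s = 0} := isClosed_singleton.preimage hc
  by_cases h : s ≤ s₀
  · have : Set.Iic s₀ ⊆ {s | deriv (deriv b) s = 0} := by
      rw [← closure_Iio]
      exact hcl.closure_subset_iff.mpr hl
    exact this h
  · have : Set.Ici s₁ ⊆ {s | deriv (deriv b) s = 0} := by
      rw [← closure_Ioi]
      exact hcl.closure_subset_iff.mpr hr
    refine this ?_
    by_contra hcon
    exact hs ⟨not_le.mp h, not_le.mp hcon⟩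

theorem laplacian_logRadial_center {b : ℝ → ℝ} {s₀ : ℝ} (h0 : ∀ s ≤ s₀, b s = 1) (w : ℂ) :
    ∀ p ∈ Metric.ball w (Real.exp s₀), Laplacian.laplacian (logRadial b w) p = 0 := by
  intro p hp
  have : logRadial b w =ᶠ[𝓝 p] fun _ => 1 := by
    filter_upwards [Metric.isOpen_ball.mem_nhds hp] with q hq
      using logRadial_eventuallyEq_one h0 w q hq
  rw [(laplacian_congr_nhds this).eq_of_nhds]
  simp

theorem tsupport_logRadial_subset {b : ℝ → ℝ} {s₁ : ℝ} (h1 : ∀ s ≥ s₁, b s = 0) (w : ℂ) :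
    tsupport (logRadial b w) ⊆ Metric.closedBall w (Real.exp s₁) := by
  refine closure_minimal ?_ Metric.isClosed_closedBall
  intro p hp
  rw [Metric.mem_closedBall, Complex.dist_eq]
  by_contra hcon
  exact hp (logRadial_eq_zero h1 (not_le.mp hcon).le)

theorem continuous_laplacian {χ : ℂ → ℝ} (hχ : ContDiff ℝ 2 χ) :
    Continuous (Laplacian.laplacian χ) := by
  rw [laplacian_eq_iteratedFDeriv_complexPlane]
  have := hχ.continuous_iteratedFDeriv (m := 2) le_rfl
  exact (this.eval_const _).add (this.eval_const _)

theorem tsupport_laplacian_subset (χ : ℂ → ℝ) :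
    tsupport (Laplacian.laplacian χ) ⊆ tsupport χ := by
  refine closure_minimal ?_ (isClosed_tsupport χ)
  intro p hp
  by_contra hcon
  have : χ =ᶠ[𝓝 p] fun _ => 0 := notMem_tsupport_iff_eventuallyEq.mp hcon
  apply hp
  rw [(laplacian_congr_nhds this).eq_of_nhds]
  simp

/-- If `g` agrees up to a bounded function with `c log |p - w|` and `∫ g Δχ` does not depend on the
cutoff `χ`, then this integral is `2 π c`. -/
theorem abs_integral_mul_laplacian_logRadial_sub_le {g : ℂ → ℝ} {w : ℂ} {R c D M s₀ s₁ : ℝ}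
    (hg : ContinuousOn g (Metric.ball w R \ {w}))
    (hD : ∀ p ∈ Metric.ball w R \ {w}, |g p - c * Real.log ‖p - w‖| ≤ D) {b : ℝ → ℝ}
    (hb : ContDiff ℝ ∞ b) (hs : s₀ < s₁) (hsR : Real.exp s₁ < R)
    (h0 : ∀ s ≤ s₀, b s = 1) (h1 : ∀ s ≥ s₁, b s = 0) (hM : ∀ s, |deriv (deriv b) s| ≤ M) :
    |(∫ p, g p * Laplacian.laplacian (logRadial b w) p) - 2 * Real.pi * c| ≤
      2 * Real.pi * (D * (M * (s₁ - s₀))) := by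
  set Λ := Laplacian.laplacian (logRadial b w) with hΛ
  have hcd := contDiff_logRadial hb h0 w
  have hΛc : Continuous Λ := continuous_laplacian (hcd.of_le two_le_infty)
  have hΛs : tsupport Λ ⊆ Metric.closedBall w (Real.exp s₁) :=
    (tsupport_laplacian_subset _).trans (tsupport_logRadial_subset h1 w)
  have hΛcs : HasCompactSupport Λ :=
    (isCompact_closedBall _ _).of_isClosed_subset (isClosed_tsupport _) hΛs
  have hzero := laplacian_logRadial_center h0 w
  have hprod : ∀ f : ℂ → ℝ, ContinuousOn f (Metric.ball w R \ {w}) →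
      Continuous (fun p => f p * Λ p) := by
    intro f hf
    rw [continuous_iff_continuousAt]
    intro x
    by_cases hx : x ∈ tsupport Λ
    · by_cases hxw : x = w
      · have : (fun p => f p * Λ p) =ᶠ[𝓝 x] fun _ => 0 := by
          rw [hxw]
          filter_upwards [Metric.ball_mem_nhds w (Real.exp_pos s₀)] with q hq
          rw [hΛ, hzero q hq, mul_zero]
        exact this.continuousAt
      · have hmem : x ∈ Metric.ball w R \ {w} :=
          ⟨(Metric.mem_closedBall.mp (hΛs hx)).trans_lt hsR, hxw⟩
        exact (hf.continuousAt ((Metric.isOpen_ball.sdiff isClosed_singleton).mem_nhds hmem)).mul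
          hΛc.continuousAt
    · have : (fun p => f p * Λ p) =ᶠ[𝓝 x] fun _ => 0 := by
        filter_upwards [notMem_tsupport_iff_eventuallyEq.mp hx] with p hp
        simp [hp]
      exact this.continuousAt
  have hlog : ContinuousOn (fun p : ℂ => c * Real.log ‖p - w‖) (Metric.ball w R \ {w}) := by
    refine continuousOn_const.mul (ContinuousOn.log (by fun_prop) ?_)
    intro x hx
    exact (norm_pos_iff.mpr (sub_ne_zero.mpr hx.2)).ne'
  have hF1 := hprod _ hlog
  have hF2 : Continuous (fun p => (g p - c * Real.log ‖p - w‖) * Λ p) := hprod _ (hg.sub hlog)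
  have hsplit : ∫ p, g p * Λ p = (∫ p, (c * Real.log ‖p - w‖) * Λ p) +
      ∫ p, (g p - c * Real.log ‖p - w‖) * Λ p := by
    rw [← integral_add (hF1.integrable_of_hasCompactSupport hΛcs.mul_left)
      (hF2.integrable_of_hasCompactSupport hΛcs.mul_left)]
    congr 1; ext p; ring
  -- The endpoints lie strictly outside the transition zone, so that `b'` vanishes there.
  set a' := Real.exp (s₀ - 1) with ha'
  set b' := Real.exp (s₁ + 1) with hb'
  have hab : a' ≤ b' := Real.exp_le_exp.mpr (by linarith)
  have ha0 : 0 < a' := Real.exp_pos _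
  have hd0 := deriv_deriv_cutoff_eq_zero hb h0 h1
  have havg : ∀ f : ℝ → ℝ, ∀ r > 0, ∀ F : ℂ → ℝ, (∀ p, ‖p - w‖ = r → F p = f r) →
      Real.circleAverage F w r = f r := by
    intro f r hr F hF
    have : Set.EqOn F (fun _ => f r) (Metric.sphere w |r|) := by
      intro p hp
      rw [mem_sphere_iff_norm, abs_of_pos hr] at hp
      exact hF p hp
    rw [Real.circleAverage_congr_sphere this, Real.circleAverage_const]
  have hΛr : ∀ r > 0, ∀ p, ‖p - w‖ = r → Λ p = deriv (deriv b) (Real.log r) / r ^ 2 := by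
    intro r hr p hp
    rw [hΛ, laplacian_logRadial hb (sub_ne_zero.mp (norm_pos_iff.mp (hp ▸ hr))), hp]
  have hb2 : ContDiff ℝ 2 b := hb.of_le two_le_infty
  have hbd : ∀ s, HasDerivAt b (deriv b s) s := fun s =>
    ((hb2.differentiable (by simp)) s).hasDerivAt
  have hbd' : ∀ s, HasDerivAt (deriv b) (deriv (deriv b) s) s := fun s =>
    ((hb2.iterate_deriv' 1 1).differentiable (by simp) s).hasDerivAt
  have hb2c : Continuous (deriv (deriv b)) := hb2.iterate_deriv' 0 2 |>.continuous
  -- the main term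
  have hmain : ∫ p, (c * Real.log ‖p - w‖) * Λ p = 2 * Real.pi * c := by
    rw [integral_eq_integral_circleAverage hF1 hΛcs.mul_left w]
    have e1 : ∫ r in Set.Ioi (0 : ℝ), 2 * Real.pi * r *
        Real.circleAverage (fun p => (c * Real.log ‖p - w‖) * Λ p) w r =
        ∫ r in Set.Ioi (0 : ℝ), 2 * Real.pi * c * (Real.log r * deriv (deriv b) (Real.log r) / r) := by
      refine setIntegral_congr_fun measurableSet_Ioi fun r hr => ?_
      have hr0 : (0 : ℝ) < r := hr
      rw [havg (fun r => c * Real.log r * (deriv (deriv b) (Real.log r) / r ^ 2)) r hr0]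
      · field_simp
      · intro p hp
        rw [hp, hΛr r hr0 p hp]
    have e2 : ∫ r in Set.Ioi (0 : ℝ), 2 * Real.pi * c * (Real.log r * deriv (deriv b) (Real.log r) / r) =
        ∫ r in Set.Ioc a' b', 2 * Real.pi * c * (Real.log r * deriv (deriv b) (Real.log r) / r) := by
      refine setIntegral_eq_of_subset_of_forall_sdiff_eq_zero measurableSet_Ioi ?_ ?_
      · intro r hr; exact ha0.trans hr.1
      · rintro r ⟨hr, hn⟩
        have hr0 : (0 : ℝ) < r := hr
        rw [hd0 (Real.log r) ?_]
        · simp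
        · rintro ⟨h3, h4⟩
          refine hn ⟨?_, ?_⟩
          · rw [ha', ← Real.lt_log_iff_exp_lt hr0]; linarith
          · rw [hb', ← Real.log_le_iff_le_exp hr0]; linarith
    rw [e1, e2, ← intervalIntegral.integral_of_le hab, intervalIntegral.integral_const_mul]
    -- With `s = log r` the integrand is `s b''(s) ds`, with primitive `s b' - b`. Its increment is
    -- `b(s₀ - 1) - b(s₁ + 1) = 1`.
    have hftc : ∫ r in a'..b', Real.log r * deriv (deriv b) (Real.log r) / r =
        (Real.log b' * deriv b (Real.log b') - b (Real.log b')) -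
        (Real.log a' * deriv b (Real.log a') - b (Real.log a')) := by
      refine intervalIntegral.integral_eq_sub_of_hasDerivAt
        (f := fun r => Real.log r * deriv b (Real.log r) - b (Real.log r)) ?_ ?_
      · intro r hr
        rw [Set.uIcc_of_le hab] at hr
        have hr0 : r ≠ 0 := (ha0.trans_le hr.1).ne'
        have hl := Real.hasDerivAt_log hr0
        have := (hl.mul ((hbd' (Real.log r)).comp r hl)).sub ((hbd (Real.log r)).comp r hl)
        convert! this using 1
        simp only [Function.comp_apply]
        field_simp
        ring
      · refine ContinuousOn.intervalIntegrable ?_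
        rw [Set.uIcc_of_le hab]
        have hne : ∀ r ∈ Set.Icc a' b', r ≠ 0 := fun r hr => (ha0.trans_le hr.1).ne'
        have hl : ContinuousOn Real.log (Set.Icc a' b') :=
          Real.continuousOn_log.mono fun r hr => hne r hr
        exact (hl.mul (hb2c.comp_continuousOn hl)).div continuousOn_id hne
    rw [hftc, ha', hb', Real.log_exp, Real.log_exp, h1 _ (by linarith), h0 _ (by linarith)]
    have d1 : deriv b (s₁ + 1) = 0 := by
      have : b =ᶠ[𝓝 (s₁ + 1)] fun _ => 0 := by
        filter_upwards [lt_mem_nhds (show s₁ < s₁ + 1 by linarith)] with t ht using h1 t (le_of_lt ht)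
      rw [this.deriv_eq]; simp
    have d2 : deriv b (s₀ - 1) = 0 := by
      have : b =ᶠ[𝓝 (s₀ - 1)] fun _ => 1 := by
        filter_upwards [gt_mem_nhds (show s₀ - 1 < s₀ by linarith)] with t ht using h0 t (le_of_lt ht)
      rw [this.deriv_eq]; simp
    rw [d1, d2]; ring
  -- the bounded part
  have hrest : |∫ p, (g p - c * Real.log ‖p - w‖) * Λ p| ≤
      2 * Real.pi * (D * (M * (s₁ - s₀))) := by
    have i1 : |∫ p, (g p - c * Real.log ‖p - w‖) * Λ p| ≤ ∫ p, D * |Λ p| := by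
      rw [← Real.norm_eq_abs]
      refine norm_integral_le_of_norm_le ?_ ?_
      · exact (continuous_const.mul hΛc.abs).integrable_of_hasCompactSupport
          (hΛcs.abs.mul_left)
      · refine Filter.Eventually.of_forall fun p => ?_
        rw [Real.norm_eq_abs, abs_mul]
        by_cases hp : p ∈ tsupport Λ
        · by_cases hpw : p = w
          · have : Λ p = 0 := by
              rw [hΛ, hzero p (hpw ▸ Metric.mem_ball_self (Real.exp_pos _))]
            simp [this]
          · exact mul_le_mul_of_nonneg_right
              (hD p ⟨(Metric.mem_closedBall.mp (hΛs hp)).trans_lt hsR, hpw⟩) (abs_nonneg _)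
        · simp [image_eq_zero_of_notMem_tsupport hp]
    have hD0 : 0 ≤ D := by
      have hR : 0 < R := (Real.exp_pos s₁).trans hsR
      have : (w + (R / 2 : ℝ)) ∈ Metric.ball w R \ {w} := by
        refine ⟨?_, ?_⟩
        · rw [Metric.mem_ball, Complex.dist_eq, add_sub_cancel_left, Complex.norm_real,
            Real.norm_eq_abs, abs_of_pos (by positivity)]
          linarith
        · simp only [Set.mem_singleton_iff, add_eq_left, Complex.ofReal_eq_zero]
          positivity
      exact (abs_nonneg _).trans (hD _ this)
    refine i1.trans ?_
    rw [integral_const_mul, integral_eq_integral_circleAverage hΛc.abs hΛcs.abs w]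
    have e1 : ∫ r in Set.Ioi (0 : ℝ), 2 * Real.pi * r * Real.circleAverage (fun p => |Λ p|) w r =
        ∫ r in Set.Ioi (0 : ℝ), 2 * Real.pi * (|deriv (deriv b) (Real.log r)| / r) := by
      refine setIntegral_congr_fun measurableSet_Ioi fun r hr => ?_
      have hr0 : (0 : ℝ) < r := hr
      rw [havg (fun r => |deriv (deriv b) (Real.log r)| / r ^ 2) r hr0]
      · field_simp
      · intro p hp
        rw [hΛr r hr0 p hp, abs_div, abs_of_pos (show (0:ℝ) < r ^ 2 by positivity)]
    have e2 : ∫ r in Set.Ioi (0 : ℝ), 2 * Real.pi * (|deriv (deriv b) (Real.log r)| / r) =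
        ∫ r in Set.Ioc (Real.exp s₀) (Real.exp s₁), 2 * Real.pi * (|deriv (deriv b) (Real.log r)| / r) := by
      refine setIntegral_eq_of_subset_of_forall_sdiff_eq_zero measurableSet_Ioi ?_ ?_
      · intro r hr; exact (Real.exp_pos _).trans hr.1
      · rintro r ⟨hr, hn⟩
        have hr0 : (0 : ℝ) < r := hr
        rw [hd0 (Real.log r) ?_]
        · simp
        · rintro ⟨h3, h4⟩
          exact hn ⟨(Real.lt_log_iff_exp_lt hr0).mp h3, ((Real.log_lt_iff_lt_exp hr0).mp h4).le⟩
    have hle : Real.exp s₀ ≤ Real.exp s₁ := Real.exp_le_exp.mpr hs.le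
    rw [e1, e2, ← intervalIntegral.integral_of_le hle, intervalIntegral.integral_const_mul]
    have hne : ∀ r ∈ Set.Icc (Real.exp s₀) (Real.exp s₁), r ≠ 0 := fun r hr =>
      ((Real.exp_pos _).trans_le hr.1).ne'
    have i2 : ∫ r in Real.exp s₀..Real.exp s₁, |deriv (deriv b) (Real.log r)| / r ≤
        ∫ r in Real.exp s₀..Real.exp s₁, M * (1 / r) := by
      refine intervalIntegral.integral_mono_on hle ?_ ?_ ?_
      · refine ContinuousOn.intervalIntegrable ?_
        rw [Set.uIcc_of_le hle]
        have hl : ContinuousOn Real.log (Set.Icc (Real.exp s₀) (Real.exp s₁)) :=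
          Real.continuousOn_log.mono fun r hr => hne r hr
        exact ((hb2c.comp_continuousOn hl).abs).div continuousOn_id hne
      · refine ContinuousOn.intervalIntegrable ?_
        rw [Set.uIcc_of_le hle]
        exact continuousOn_const.mul (continuousOn_const.div continuousOn_id hne)
      · intro r hr
        have : 0 < r := (Real.exp_pos _).trans_le hr.1
        rw [mul_one_div]
        gcongr
        exact hM _
    rw [intervalIntegral.integral_const_mul, integral_one_div_of_pos (Real.exp_pos _) (Real.exp_pos _),
      Real.log_div (Real.exp_ne_zero _) (Real.exp_ne_zero _), Real.log_exp, Real.log_exp] at i2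
    calc D * (2 * Real.pi * ∫ r in Real.exp s₀..Real.exp s₁, |deriv (deriv b) (Real.log r)| / r)
        ≤ D * (2 * Real.pi * (M * (s₁ - s₀))) := by
          gcongr
      _ = _ := by ring
  rw [hsplit, hmain, add_sub_cancel_left]
  exact hrest

/-- For cutoffs spread over a logarithmic scale of length `T`, the second derivative in `log r` is
`O(T⁻²)` on an interval of length `T`. The bounded part of `g` then contributes `O(T⁻¹)`, and only
the logarithm remains as `T → ∞`. -/
theorem eq_of_integral_mul_laplacian_eq {g : ℂ → ℝ} {w : ℂ} {R c D κ : ℝ} (hR : 0 < R)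
    (hg : ContinuousOn g (Metric.ball w R \ {w}))
    (hD : ∀ p ∈ Metric.ball w R \ {w}, |g p - c * Real.log ‖p - w‖| ≤ D)
    (hκ : ∀ χ : ℂ → ℝ, ContDiff ℝ ∞ χ → HasCompactSupport χ → tsupport χ ⊆ Metric.ball w R →
      (∀ᶠ p in 𝓝 w, χ p = 1) → ∫ p, g p * Laplacian.laplacian χ p = κ) :
    κ = 2 * Real.pi * c := by
  set β : ℝ → ℝ := fun s => Real.smoothTransition (-1 - s) with hβ
  have hβc : ContDiff ℝ ∞ β := Real.smoothTransition.contDiff.comp (contDiff_const.sub contDiff_id)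
  have hβ0 : ∀ s ≤ -2, β s = 1 := fun s hs => Real.smoothTransition.one_of_one_le (by linarith)
  have hβ1 : ∀ s ≥ -1, β s = 0 := fun s hs => Real.smoothTransition.zero_of_nonpos (by linarith)
  obtain ⟨M, hM⟩ : ∃ M, ∀ s, |deriv (deriv β) s| ≤ M := by
    have hc : Continuous (deriv (deriv β)) := (hβc.iterate_deriv 2).continuous
    obtain ⟨M, hM⟩ := isCompact_Icc.exists_bound_of_continuousOn (s := Set.Icc (-2 : ℝ) (-1))
      hc.continuousOn
    refine ⟨max M 0, fun s => ?_⟩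
    by_cases hs : s ∈ Set.Ioo (-2 : ℝ) (-1)
    · exact (hM s ⟨hs.1.le, hs.2.le⟩).trans (le_max_left _ _)
    · rw [deriv_deriv_cutoff_eq_zero hβc hβ0 hβ1 s hs]; simp
  have hT : ∀ T > 0, Real.exp (-T) < R →
      |κ - 2 * Real.pi * c| ≤ 2 * Real.pi * (D * M) * T⁻¹ := by
    intro T hT hTR
    set b : ℝ → ℝ := fun s => β (T⁻¹ * s) with hb
    have hbc : ContDiff ℝ ∞ b := hβc.comp (contDiff_const.mul contDiff_id)
    have hb0 : ∀ s ≤ -2 * T, b s = 1 := fun s hs => hβ0 _ (by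
      rw [inv_mul_le_iff₀ hT]; linarith)
    have hb1 : ∀ s ≥ -T, b s = 0 := fun s hs => hβ1 _ (by
      rw [ge_iff_le, le_inv_mul_iff₀ hT]; linarith)
    have hbM : ∀ s, |deriv (deriv b) s| ≤ M * (T⁻¹ ^ 2) := by
      intro s
      have e1 : deriv b = fun s => T⁻¹ * deriv β (T⁻¹ * s) := by
        ext s; rw [hb]; exact deriv_comp_mul_left T⁻¹ β s
      rw [e1, deriv_const_mul_field, deriv_comp_mul_left T⁻¹ (deriv β) s, smul_eq_mul, ← mul_assoc,
        ← sq, abs_mul, abs_of_nonneg (by positivity), mul_comm]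
      gcongr
      exact hM _
    have key := abs_integral_mul_laplacian_logRadial_sub_le hg hD hbc (by linarith) hTR hb0 hb1 hbM
    have hsub := tsupport_logRadial_subset hb1 w
    rw [hκ _ (contDiff_logRadial hbc hb0 w)
      ((isCompact_closedBall _ _).of_isClosed_subset (isClosed_tsupport _) hsub)
      (hsub.trans (Metric.closedBall_subset_ball hTR)) ?_] at key
    · convert key using 1
      field_simp
      ring
    · filter_upwards [Metric.ball_mem_nhds w (Real.exp_pos (-2 * T))] with q hq
        using logRadial_eventuallyEq_one hb0 w q hq
  have hlim : Filter.Tendsto (fun T : ℝ => 2 * Real.pi * (D * M) * T⁻¹) Filter.atTop (𝓝 0) := by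
    simpa using tendsto_inv_atTop_zero.const_mul (2 * Real.pi * (D * M))
  have hexp : ∀ᶠ T : ℝ in Filter.atTop, Real.exp (-T) < R :=
    Real.tendsto_exp_neg_atTop_nhds_zero.eventually (gt_mem_nhds hR)
  have : |κ - 2 * Real.pi * c| ≤ 0 := by
    refine ge_of_tendsto hlim ?_
    filter_upwards [hexp, Filter.eventually_gt_atTop 0] with T h1 h2 using hT T h2 h1
  linarith [abs_nonpos_iff.mp this]

/-- The two logarithms differ by the logarithm of a difference quotient, which tends to the finite
number `log |m'|`. This transports logarithmic singularities between coordinates. -/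
theorem exists_abs_log_norm_sub_le {m : ℂ → ℂ} {p₁ m' : ℂ} (hm : HasDerivAt m m' p₁) (h : m' ≠ 0) :
    ∃ D, ∀ᶠ p in 𝓝[≠] p₁, m p ≠ m p₁ ∧
      |Real.log ‖m p - m p₁‖ - Real.log ‖p - p₁‖| ≤ D := by
  have h1 := hasDerivAt_iff_tendsto_slope.mp hm
  have h2 : Filter.Tendsto (fun p => Real.log ‖slope m p₁ p‖) (𝓝[≠] p₁) (𝓝 (Real.log ‖m'‖)) :=
    (h1.norm).log (norm_ne_zero_iff.mpr h)
  refine ⟨|Real.log ‖m'‖| + 1, ?_⟩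
  have h3 := h2.abs.eventually (gt_mem_nhds (lt_add_one _))
  have h4 := h1.eventually_ne h
  filter_upwards [h3, h4, self_mem_nhdsWithin] with p hp hp' hne
  have hsub : p - p₁ ≠ 0 := sub_ne_zero.mpr hne
  have hs : m p - m p₁ = (p - p₁) * slope m p₁ p := by
    rw [slope_def_field]; field_simp
  refine ⟨?_, ?_⟩
  · rw [← sub_ne_zero, hs]; exact mul_ne_zero hsub hp'
  · rw [hs, norm_mul, Real.log_mul (norm_ne_zero_iff.mpr hsub) (norm_ne_zero_iff.mpr hp'),
      add_sub_cancel_left]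
    exact hp.le

end

/-! ### Stirling's formula with explicit error bounds -/

/-- The error term in Stirling's formula for the Gamma function. -/
noncomputable def stirlingError (v : ℝ) : ℝ :=
  Real.log (Real.Gamma v) - (v - 1 / 2) * Real.log v + v - 1 / 2 * Real.log (2 * Real.pi)

theorem stirlingError_sub {v : ℝ} (hv : 0 < v) :
    stirlingError v - stirlingError (v + 1) = (v + 1 / 2) * Real.log (1 + v⁻¹) - 1 := by
  have h1 : 1 + v⁻¹ = (v + 1) / v := by field_simp
  rw [stirlingError, stirlingError, Real.Gamma_add_one hv.ne',
    Real.log_mul hv.ne' (Real.Gamma_pos_of_pos hv).ne', h1, Real.log_div (by positivity) hv.ne']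
  ring

/-- With `p = 1/(2v+1)`, the middle quantity is `∑ p^(2k)/(2k+1)` over `k ≥ 1`. Its first term
`p²/3` dominates the left side. Replacing every coefficient by `1/3` gives a geometric series whose
sum is exactly the right side. -/
theorem log_one_add_inv_bounds {v : ℝ} (hv : 0 < v) :
    1 / (12 * (v + 1 / 2)) - 1 / (12 * (v + 1 + 1 / 2)) ≤ (v + 1 / 2) * Real.log (1 + v⁻¹) - 1 ∧
    (v + 1 / 2) * Real.log (1 + v⁻¹) - 1 ≤ 1 / (12 * v) - 1 / (12 * (v + 1)) := by
  have hs := (Real.hasSum_log_one_add_inv hv).mul_left (v + 1 / 2)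
  set p : ℝ := 1 / (2 * v + 1) with hp
  have hp0 : 0 < p := by positivity
  have hp1 : p < 1 := by rw [hp, div_lt_one (by positivity)]; linarith
  have hpv : (v + 1 / 2) * (2 * p) = 1 := by rw [hp]; field_simp
  have hs' : HasSum (fun k : ℕ => 1 / (2 * (k : ℝ) + 1) * (p ^ 2) ^ k)
      ((v + 1 / 2) * Real.log (1 + v⁻¹)) := by
    refine hs.congr_fun ?_
    intro k
    rw [pow_succ p (2 * k), pow_mul p 2 k]
    linear_combination (-(1 / (2 * (k : ℝ) + 1) * (p ^ 2) ^ k)) * hpv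
  constructor
  · have h2 := sum_le_hasSum (Finset.range 2) (fun k _ => by positivity) hs'
    rw [Finset.sum_range_succ, Finset.sum_range_one] at h2
    norm_num at h2
    have h3 : 1 / (12 * (v + 1 / 2)) - 1 / (12 * (v + 1 + 1 / 2)) ≤ 1 / 3 * p ^ 2 := by
      rw [hp, div_sub_div _ _ (by positivity) (by positivity), div_pow, div_mul_div_comm,
        div_le_div_iff₀ (by positivity) (by positivity)]
      nlinarith
    linarith
  · have hg := (hasSum_geometric_of_lt_one (r := p ^ 2) (by positivity) (by nlinarith)).mul_left (1 / 3)
    have h0 : HasSum (fun k : ℕ => if k = 0 then (2 / 3 : ℝ) else 0) (2 / 3) :=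
      hasSum_ite_eq 0 _
    have h2 := hasSum_le (fun k => ?_) hs' (h0.add hg)
    · have h3 : (2 / 3 : ℝ) + 1 / 3 * (1 - p ^ 2)⁻¹ = 1 + (1 / (12 * v) - 1 / (12 * (v + 1))) := by
        have : 1 - p ^ 2 = 4 * v * (v + 1) / (2 * v + 1) ^ 2 := by rw [hp]; field_simp; ring
        rw [this]; field_simp; ring
      linarith
    · rcases k with _ | k
      · norm_num
      · simp only [Nat.add_eq_zero_iff, one_ne_zero, and_false, if_false, zero_add]
        gcongr
        push_cast
        have : (0 : ℝ) ≤ k := by positivity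
        linarith

/-- The Bohr–Mollerup limit for `log Γ(v)` expresses `log Γ(v + n)` asymptotically through `log n!`,
and Stirling's formula for factorials fixes the constant. -/
theorem tendsto_stirlingError {v : ℝ} (hv : 0 < v) :
    Filter.Tendsto (fun n : ℕ => stirlingError (v + n)) Filter.atTop (𝓝 0) := by
  rw [← Filter.tendsto_add_atTop_iff_nat 1]
  have hΓ : ∀ n : ℕ, Real.log (Real.Gamma (v + n)) =
      Real.log (Real.Gamma v) + ∑ m ∈ Finset.range n, Real.log (v + m) := by
    intro n
    induction n with
    | zero => simp
    | succ n ih =>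
      have hvn : 0 < v + n := by positivity
      rw [Finset.sum_range_succ, ← add_assoc, ← ih, Nat.cast_succ, ← add_assoc,
        Real.Gamma_add_one hvn.ne', Real.log_mul hvn.ne' (Real.Gamma_pos_of_pos hvn).ne', add_comm]
  have h1 := Real.BohrMollerup.tendsto_log_gamma hv
  have h2 : Filter.Tendsto (fun n : ℕ => Real.log (Stirling.stirlingSeq n)) Filter.atTop
      (𝓝 (Real.log (√Real.pi))) :=
    Stirling.tendsto_stirlingSeq_sqrt_pi.log (by positivity)
  have h3 : Filter.Tendsto (fun n : ℕ => (n : ℝ) * Real.log (1 + (v + 1) / n)) Filter.atTop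
      (𝓝 (v + 1)) :=
    (Real.tendsto_mul_log_one_add_div_atTop (v + 1)).comp tendsto_natCast_atTop_atTop
  have h4 : Filter.Tendsto (fun n : ℕ => Real.log (1 + (v + 1) / n)) Filter.atTop (𝓝 0) := by
    have : Filter.Tendsto (fun n : ℕ => 1 + (v + 1) / (n : ℝ)) Filter.atTop (𝓝 (1 + 0)) :=
      tendsto_const_nhds.add (tendsto_const_div_atTop_nhds_zero_nat _)
    have := this.log (by norm_num)
    simpa using this
  have h5 := (((h1.const_sub (Real.log (Real.Gamma v))).sub (h3.add (h4.const_mul (v + 1 / 2)))).add h2).add_const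
    (v + 1 + 1 / 2 * Real.log 2 - 1 / 2 * Real.log (2 * Real.pi))
  have hval : Real.log (Real.Gamma v) - Real.log (Real.Gamma v) - (v + 1 + (v + 1 / 2) * 0) +
      Real.log √Real.pi + (v + 1 + 1 / 2 * Real.log 2 - 1 / 2 * Real.log (2 * Real.pi)) = 0 := by
    rw [Real.log_sqrt Real.pi_pos.le, Real.log_mul (by norm_num) Real.pi_ne_zero]; ring
  rw [hval] at h5
  refine h5.congr' ?_
  filter_upwards [Filter.eventually_gt_atTop 0] with n hn
  have hn0 : (0 : ℝ) < n := by exact_mod_cast hn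
  have e1 : 1 + (v + 1) / n = (v + n + 1) / n := by field_simp; ring
  rw [stirlingError, hΓ, Real.BohrMollerup.logGammaSeq, Stirling.log_stirlingSeq_formula, e1,
    Real.log_div (by positivity) hn0.ne', Real.log_mul (by norm_num) hn0.ne',
    Real.log_div hn0.ne' (Real.exp_ne_zero 1), Real.log_exp]
  push_cast
  rw [show v + ((n : ℝ) + 1) = v + n + 1 by ring]
  ring

/-- Both bounds for a single step telescope along `v, v + 1, v + 2, …`, and the error tends to `0`
at the end. -/
theorem stirlingError_bounds {v : ℝ} (hv : 0 < v) :
    1 / (12 * (v + 1 / 2)) ≤ stirlingError v ∧ stirlingError v ≤ 1 / (12 * v) := by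
  have hlim := tendsto_stirlingError hv
  have hpos : ∀ n : ℕ, 0 < v + n := fun n => by positivity
  have hinv : ∀ a : ℝ, Filter.Tendsto (fun n : ℕ => 1 / (12 * (v + n + a))) Filter.atTop (𝓝 0) := by
    intro a
    have : Filter.Tendsto (fun n : ℕ => 12 * (v + n + a)) Filter.atTop Filter.atTop := by
      refine Filter.Tendsto.const_mul_atTop (by norm_num) ?_
      exact Filter.tendsto_atTop_add_const_right _ _
        (Filter.tendsto_atTop_add_const_left _ _ tendsto_natCast_atTop_atTop)
    simp only [one_div]
    exact this.inv_tendsto_atTop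
  constructor
  · have h1 : Antitone (fun n : ℕ => stirlingError (v + n) - 1 / (12 * (v + n + 1 / 2))) := by
      refine antitone_nat_of_succ_le fun n => ?_
      have := (log_one_add_inv_bounds (hpos n)).1
      have h2 := stirlingError_sub (hpos n)
      push_cast
      rw [← add_assoc]
      linarith
    have h2 := h1.le_of_tendsto (by simpa using hlim.sub (hinv (1 / 2))) 0
    simpa using h2
  · have h1 : Monotone (fun n : ℕ => stirlingError (v + n) - 1 / (12 * (v + n + 0))) := by
      refine monotone_nat_of_le_succ fun n => ?_
      have := (log_one_add_inv_bounds (hpos n)).2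
      have h2 := stirlingError_sub (hpos n)
      push_cast
      rw [← add_assoc]
      simp only [add_zero]
      linarith
    have h2 := h1.ge_of_tendsto (by simpa using hlim.sub (hinv 0)) 0
    simp only [Nat.cast_zero, add_zero, sub_nonpos] at h2
    exact h2

/-- The left side is convex in `τ`, so it is at most the larger of its values at `0` and `1`. At `0`
there is equality; at `1` the bound is the upper estimate for `log (1 + 1/X)`. -/
theorem log_ratio_upper {X τ : ℝ} (hX : 0 < X) (h0 : 0 ≤ τ) (h1 : τ ≤ 1) :
    (X + τ - 1 / 2) * Real.log ((X + τ) / X) - τ + 1 / (12 * (X + τ)) ≤ 1 / (12 * X) := by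
  set F : ℝ → ℝ := fun τ => (X + τ - 1 / 2) * Real.log ((X + τ) / X) - τ + 1 / (12 * (X + τ)) with hF
  have hd1 : ∀ τ ∈ Set.Icc (0 : ℝ) 1, HasDerivAt F
      (Real.log ((X + τ) / X) - 1 / 2 / (X + τ) - 1 / (12 * (X + τ) ^ 2)) τ := by
    intro τ hτ
    have hp : 0 < X + τ := by linarith [hτ.1]
    have e1 : HasDerivAt (fun τ => X + τ) 1 τ := (hasDerivAt_id τ).const_add X
    have e2 : HasDerivAt (fun τ => Real.log ((X + τ) / X)) (1 / X / ((X + τ) / X)) τ :=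
      (e1.div_const X).log (by positivity)
    have e3 := (e1.const_mul 12).inv (by positivity)
    have e4 := (((e1.sub_const (1 / 2)).mul e2).sub (hasDerivAt_id τ)).add e3
    convert! e4 using 1
    · ext t; simp [hF]
    · field_simp
      ring
  have hconv : ConvexOn ℝ (Set.Icc 0 1) F := by
    refine MonotoneOn.convexOn_of_deriv (convex_Icc 0 1)
      (fun t ht => (hd1 t ht).continuousAt.continuousWithinAt)
      (fun t ht => (hd1 t (interior_subset ht)).differentiableAt.differentiableWithinAt) ?_
    intro s hs t ht hst
    rw [(hd1 s (interior_subset hs)).deriv, (hd1 t (interior_subset ht)).deriv]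
    have hps : 0 < X + s := by linarith [(interior_subset hs).1]
    have hl : Real.log ((X + s) / X) ≤ Real.log ((X + t) / X) :=
      Real.log_le_log (by positivity) (by gcongr)
    have h2 : 1 / 2 / (X + t) ≤ 1 / 2 / (X + s) := by gcongr
    have h3 : 1 / (12 * (X + t) ^ 2) ≤ 1 / (12 * (X + s) ^ 2) := by gcongr
    linarith
  have hle := hconv.le_max_of_mem_Icc (x := 0) (y := 1) (z := τ) ⟨le_rfl, zero_le_one⟩
    ⟨zero_le_one, le_rfl⟩ ⟨h0, h1⟩
  have hF0 : F 0 = 1 / (12 * X) := by simp [hF, hX.ne']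
  have hF1 : F 1 ≤ 1 / (12 * X) := by
    have := (log_one_add_inv_bounds hX).2
    have e : (X + 1) / X = 1 + X⁻¹ := by field_simp
    simp only [hF, e]
    rw [show X + 1 - 1 / 2 = X + 1 / 2 by ring]
    linarith
  rw [hF0, max_eq_left hF1] at hle
  exact hle

/-- The coefficient `X + τ - 1/2` changes sign. Where it is negative the upper bound `log (1 + t) ≤
t` is used, elsewhere the lower bound `log (1 + t) ≥ 2t/(t + 2)`, both with `t = τ/X`. -/
theorem log_ratio_lower {X τ : ℝ} (hX : 0 < X) (h0 : 0 ≤ τ) :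
    -(1 / (12 * X)) ≤
      (X + τ - 1 / 2) * Real.log ((X + τ) / X) - τ + 1 / (12 * (X + τ + 1 / 2)) := by
  have hc : 0 < 1 / (12 * (X + τ + 1 / 2)) := by positivity
  rcases le_total (X + τ) (1 / 2) with h | h
  · have hl : Real.log ((X + τ) / X) ≤ τ / X := by
      have := Real.log_le_sub_one_of_pos (show 0 < (X + τ) / X by positivity)
      have e : (X + τ) / X - 1 = τ / X := by field_simp; ring
      linarith
    have h2 : (1 / 2 - (X + τ)) * Real.log ((X + τ) / X) ≤ (1 / 2 - (X + τ)) * (τ / X) := by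
      gcongr
    have h3 : (1 / 2 - (X + τ)) * (τ / X) + τ ≤ 1 / (12 * X) := by
      rw [show (1 / 2 - (X + τ)) * (τ / X) + τ = (τ * (1 / 2 - τ)) / X by field_simp; ring,
        div_le_div_iff₀ hX (by positivity)]
      nlinarith [sq_nonneg (τ - 1 / 4)]
    nlinarith
  · have hl : 2 * τ / (2 * X + τ) ≤ Real.log ((X + τ) / X) := by
      have := Real.le_log_one_add_of_nonneg (x := τ / X) (by positivity)
      have e1 : 1 + τ / X = (X + τ) / X := by field_simp
      have e2 : 2 * (τ / X) / (τ / X + 2) = 2 * τ / (2 * X + τ) := by field_simp; ring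
      rwa [e1, e2] at this
    have h2 : (X + τ - 1 / 2) * (2 * τ / (2 * X + τ)) ≤
        (X + τ - 1 / 2) * Real.log ((X + τ) / X) := by
      gcongr
    have h3 : τ - (X + τ - 1 / 2) * (2 * τ / (2 * X + τ)) = τ * (1 - τ) / (2 * X + τ) := by
      have : 2 * X + τ ≠ 0 := by positivity
      field_simp; ring
    have h4 : τ * (1 - τ) / (2 * X + τ) ≤ 1 / (12 * X) + 1 / (12 * (X + τ + 1 / 2)) := by
      rw [div_add_div _ _ (by positivity) (by positivity), div_le_div_iff₀ (by positivity) (by positivity)]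
      have key : 12 * X * (X + τ + 1 / 2) * (τ * (1 - τ)) ≤ (2 * X + τ + 1 / 2) * (2 * X + τ) := by
        have hq : τ * (1 - τ) ≤ 1 / 4 := by nlinarith [sq_nonneg (τ - 1 / 2)]
        have hq2 : τ * (1 - τ) ≤ τ := by nlinarith
        rcases le_total X (1 / 2) with hX2 | hX2
        · rcases le_total τ (1 / 6) with hτ | hτ
          · have : 12 * X * (X + τ + 1 / 2) * (τ * (1 - τ)) ≤ 12 * X * (X + τ + 1 / 2) * (1/6) := by
              gcongr; linarith
            nlinarith
          · have : 12 * X * (X + τ + 1 / 2) * (τ * (1 - τ)) ≤ 12 * X * (X + τ + 1 / 2) * (1/4) := by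
              gcongr
            nlinarith [sq_nonneg (X - 1 / 4)]
        · have : 12 * X * (X + τ + 1 / 2) * (τ * (1 - τ)) ≤ 12 * X * (X + τ + 1 / 2) * (1/4) := by
            gcongr
          nlinarith
      nlinarith
    linarith

/-! ### Truncated sums over a translate of the integers -/

/-- The number of `j : ℕ` with `x + j ≤ X`. -/
noncomputable def countBelow (x X : ℝ) : ℕ := ⌊X - x + 1⌋₊

theorem lt_countBelow_iff {x X : ℝ} (j : ℕ) (h : 0 ≤ X - x + 1) :
    j < countBelow x X ↔ x + j ≤ X := by
  rw [countBelow, ← Nat.succ_le_iff, Nat.le_floor_iff h]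
  push_cast
  constructor <;> intro h <;> linarith

theorem countBelow_bounds {x X : ℝ} (h : 0 ≤ X - x + 1) :
    X < x + countBelow x X ∧ x + countBelow x X ≤ X + 1 := by
  have h1 := Nat.floor_le h
  have h2 := Nat.lt_floor_add_one (X - x + 1)
  rw [countBelow]
  constructor <;> linarith

theorem sum_log_add_eq {x : ℝ} (hx : 0 < x) (N : ℕ) :
    ∑ j ∈ Finset.range N, Real.log (x + j) =
      Real.log (Real.Gamma (x + N)) - Real.log (Real.Gamma x) := by
  induction N with
  | zero => simp
  | succ n ih =>
    have hvn : 0 < x + n := by positivity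
    rw [Finset.sum_range_succ, ih, Nat.cast_succ, ← add_assoc, Real.Gamma_add_one hvn.ne',
      Real.log_mul hvn.ne' (Real.Gamma_pos_of_pos hvn).ne']
    ring

/-- The sum of logarithms is a quotient of Gamma values at `x` and at the first point `X + τ` of the
progression beyond `X`, with `0 ≤ τ ≤ 1`. By Stirling's formula the difference to be bounded is
minus `(X + τ - 1/2) log((X + τ)/X) - τ` plus the Stirling error. -/
theorem abs_sum_log_div_one_sided_le {x X : ℝ} (hx : 0 < x) (hx1 : x < 1) (hX : 0 < X) :
    |(∑ j ∈ Finset.range (countBelow x X), Real.log (X / (x + j))) - Real.log (Real.Gamma x)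
      + 1 / 2 * Real.log (2 * Real.pi) - X - (1 / 2 - x) * Real.log X| ≤ 1 / (12 * X) := by
  set N := countBelow x X with hN
  obtain ⟨hb1, hb2⟩ := countBelow_bounds (x := x) (X := X) (by linarith)
  rw [← hN] at hb1 hb2
  have e : ∑ j ∈ Finset.range N, Real.log (X / (x + j)) =
      N * Real.log X - ∑ j ∈ Finset.range N, Real.log (x + j) := by
    have h : ∀ j ∈ Finset.range N, Real.log (X / (x + j)) = Real.log X - Real.log (x + j) :=
      fun j _ => Real.log_div hX.ne' (by positivity)
    rw [Finset.sum_congr rfl h, Finset.sum_sub_distrib]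
    simp
  set τ := x + N - X with hτ
  have hv : x + N = X + τ := by rw [hτ]; ring
  have hv0 : 0 < X + τ := by rw [← hv]; positivity
  have hτ0 : 0 ≤ τ := by linarith
  have hτ1 : τ ≤ 1 := by linarith
  have hu := log_ratio_upper hX hτ0 hτ1
  have hl := log_ratio_lower hX hτ0
  obtain ⟨s1, s2⟩ := stirlingError_bounds hv0
  rw [e, sum_log_add_eq hx, hv]
  have hθ : Real.log (Real.Gamma (X + τ)) = stirlingError (X + τ) + (X + τ - 1 / 2) * Real.log (X + τ)
      - (X + τ) + 1 / 2 * Real.log (2 * Real.pi) := by rw [stirlingError]; ring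
  have hNr : (N : ℝ) = X + τ - x := by linarith
  have hlog : Real.log ((X + τ) / X) = Real.log (X + τ) - Real.log X := Real.log_div hv0.ne' hX.ne'
  rw [hlog] at hu hl
  rw [hθ, hNr, abs_le]
  constructor <;> linarith

/-- The integers `b ≥ 0` give the distances `x + j`, and `b = -1 - j` gives `1 - x + j`. -/
theorem sum_abs_add_int_eq {x X : ℝ} (hx : 0 < x) (hx1 : x < 1) (hX : 0 ≤ X) {B : Finset ℤ}
    (hB : ∀ b : ℤ, b ∈ B ↔ |x + b| ≤ X) (f : ℝ → ℝ) :
    ∑ b ∈ B, f |x + b| = (∑ j ∈ Finset.range (countBelow x X), f (x + j)) +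
      ∑ j ∈ Finset.range (countBelow (1 - x) X), f (1 - x + j) := by
  have i1 : Function.Injective (fun j : ℕ => (j : ℤ)) := fun a b h => by simpa using h
  have i2 : Function.Injective (fun j : ℕ => -1 - (j : ℤ)) := fun a b h => by simpa using h
  have a1 : ∀ j : ℕ, |x + ((j : ℤ) : ℝ)| = x + j := fun j => by
    push_cast; rw [abs_of_pos (by positivity)]
  have a2 : ∀ j : ℕ, |x + ((-1 - (j : ℤ) : ℤ) : ℝ)| = 1 - x + j := fun j => by
    have : (0 : ℝ) ≤ j := by positivity
    push_cast; rw [abs_of_neg (by linarith)]; ring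
  have hBe : B = (Finset.range (countBelow x X)).image (fun j : ℕ => (j : ℤ)) ∪
      (Finset.range (countBelow (1 - x) X)).image (fun j : ℕ => -1 - (j : ℤ)) := by
    ext b
    simp only [hB, Finset.mem_union, Finset.mem_image, Finset.mem_range]
    constructor
    · intro h
      rcases le_or_gt 0 b with hb | hb
      · refine Or.inl ⟨b.toNat, ?_, by omega⟩
        rw [lt_countBelow_iff _ (by linarith), ← a1]
        rwa [show ((b.toNat : ℕ) : ℤ) = b by omega]
      · refine Or.inr ⟨(-1 - b).toNat, ?_, by omega⟩
        rw [lt_countBelow_iff _ (by linarith), ← a2]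
        rwa [show (-1 - ((-1 - b).toNat : ℤ)) = b by omega]
    · rintro (⟨j, hj, rfl⟩ | ⟨j, hj, rfl⟩)
      · rw [a1]; exact (lt_countBelow_iff _ (by linarith)).mp hj
      · rw [a2]; exact (lt_countBelow_iff _ (by linarith)).mp hj
  rw [hBe, Finset.sum_union, Finset.sum_image (fun a _ b _ h => i1 h),
    Finset.sum_image (fun a _ b _ h => i2 h)]
  · simp only [a1, a2]
  · rw [Finset.disjoint_left]
    intro b h1 h2
    simp only [Finset.mem_image] at h1 h2
    obtain ⟨j, _, rfl⟩ := h1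
    obtain ⟨k, _, hk⟩ := h2
    omega

/-- Adding the one-sided estimates for `x` and `1 - x` cancels the `log X` terms, and the reflection
formula turns `Γ(x) Γ(1 - x)` into the sine. -/
theorem abs_sum_log_div_add_log_sin_le {x X : ℝ} (hx : 0 < x) (hx1 : x < 1) (hX : 0 < X)
    {B : Finset ℤ} (hB : ∀ b : ℤ, b ∈ B ↔ |x + b| ≤ X) :
    |(∑ b ∈ B, Real.log (X / |x + b|)) + Real.log (2 * Real.sin (Real.pi * x)) - 2 * X| ≤
      1 / (6 * X) := by
  rw [sum_abs_add_int_eq hx hx1 hX.le hB (fun t => Real.log (X / t))]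
  have h1 := abs_le.mp (abs_sum_log_div_one_sided_le hx hx1 hX)
  have h2 := abs_le.mp (abs_sum_log_div_one_sided_le (x := 1 - x) (by linarith) (by linarith) hX)
  have hsin : 0 < Real.sin (Real.pi * x) :=
    Real.sin_pos_of_pos_of_lt_pi (by positivity) (by nlinarith [Real.pi_pos])
  have hΓ1 := Real.Gamma_pos_of_pos hx
  have hΓ2 := Real.Gamma_pos_of_pos (show 0 < 1 - x by linarith)
  have h3 : Real.log (2 * Real.sin (Real.pi * x)) =
      Real.log (2 * Real.pi) - Real.log (Real.Gamma x) - Real.log (Real.Gamma (1 - x)) := by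
    have h := Real.Gamma_mul_Gamma_one_sub x
    rw [sub_sub, ← Real.log_mul hΓ1.ne' hΓ2.ne', h, ← Real.log_div (by positivity) (by positivity)]
    congr 1
    field_simp
  have h4 : 1 / (6 * X) = 1 / (12 * X) + 1 / (12 * X) := by field_simp; norm_num
  rw [h3, h4, abs_le]
  constructor <;> linarith [h1.1, h1.2, h2.1, h2.2]

theorem sum_sq_add_eq (x : ℝ) (N : ℕ) : ∑ j ∈ Finset.range N, (x + j) ^ 2 =
    (((x + N) ^ 3 - 3 / 2 * (x + N) ^ 2 + (x + N) / 2) - (x ^ 3 - 3 / 2 * x ^ 2 + x / 2)) / 3 := by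
  induction N with
  | zero => simp
  | succ n ih => rw [Finset.sum_range_succ, ih]; push_cast; ring

/-- The expression is the one-sided difference between the sum and the integral of the parabola, as
a polynomial in `r` and in the overshoot `τ` of the first omitted point. The condition `1 - τ ≤ 2r`
is what makes the upper bound hold for small `r`. -/
theorem parabola_one_sided {r τ : ℝ} (h0 : 0 ≤ τ) (h1 : τ ≤ 1) (h : 1 - τ ≤ 2 * r) :
    |-(r / 2) * (1 / 6 - τ * (1 - τ)) - τ * (1 - τ) * (1 / 2 - τ) / 6| ≤ r / 12 := by
  have hp : 0 ≤ τ * (1 - τ) := mul_nonneg h0 (by linarith)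
  rw [abs_le]
  constructor
  · have : 0 ≤ τ * (1 - τ) * (3 * r - 1 / 2 + τ) := mul_nonneg hp (by linarith)
    nlinarith
  · have key : τ * (1 - τ) * (3 * r - 1 / 2 + τ) ≤ r := by
      have h3 : 0 ≤ 1 - 3 * (τ * (1 - τ)) := by nlinarith [sq_nonneg (τ - 1 / 2)]
      have h4 : (1 - τ) / 2 * (1 - 3 * (τ * (1 - τ))) ≤ r * (1 - 3 * (τ * (1 - τ))) := by
        gcongr; linarith
      have h5 : τ * (1 - τ) * (τ - 1 / 2) ≤ (1 - τ) / 2 * (1 - 3 * (τ * (1 - τ))) := by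
        have : 0 ≤ (1 - τ) * (1 - τ) ^ 2 := mul_nonneg (by linarith) (sq_nonneg _)
        nlinarith
      nlinarith
    nlinarith

/-- The main term `2r³/3` is the integral of `(r² - t²)/2` over `[-r, r]`. Each side of the origin
contributes an error of at most `r/12`. -/
theorem abs_sum_parabola_sub_le {x r : ℝ} (hx : 0 < x) (hx1 : x < 1) (hr : 0 ≤ r)
    {B : Finset ℤ} (hB : ∀ b : ℤ, b ∈ B ↔ |x + b| ≤ r) :
    |(∑ b ∈ B, (r ^ 2 - (x + b) ^ 2) / 2) - 2 * r ^ 3 / 3| ≤ r / 6 := by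
  have e : ∑ b ∈ B, (r ^ 2 - (x + b) ^ 2) / 2 = ∑ b ∈ B, (r ^ 2 - |x + b| ^ 2) / 2 := by
    simp only [sq_abs]
  rw [e, sum_abs_add_int_eq hx hx1 hr hB (fun t => (r ^ 2 - t ^ 2) / 2)]
  have hone : ∀ (x : ℝ) (N : ℕ), ∑ j ∈ Finset.range N, (r ^ 2 - (x + j) ^ 2) / 2 =
      N * r ^ 2 / 2 - (((x + N) ^ 3 - 3 / 2 * (x + N) ^ 2 + (x + N) / 2) -
        (x ^ 3 - 3 / 2 * x ^ 2 + x / 2)) / 6 := by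
    intro x N
    rw [← Finset.sum_div, Finset.sum_sub_distrib, sum_sq_add_eq]
    simp
    ring
  rw [hone, hone]
  obtain ⟨a1, a2⟩ := countBelow_bounds (x := x) (X := r) (by linarith)
  obtain ⟨b1, b2⟩ := countBelow_bounds (x := 1 - x) (X := r) (by linarith)
  set N := countBelow x r
  set N' := countBelow (1 - x) r
  -- If no point lies within distance `r`, then `r ≤ 1/2` and the main term alone is at most `r/6`.
  -- Otherwise a point on either side ensures the condition `1 - τ ≤ 2r` on both sides.
  by_cases hz : N = 0 ∧ N' = 0
  · rw [hz.1] at a1 ⊢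
    rw [hz.2] at b1 ⊢
    simp only [Nat.cast_zero, add_zero] at a1 b1 ⊢
    rw [abs_le]
    have hr2 : r ≤ 1 / 2 := by linarith
    have : r * r ^ 2 ≤ r * (1 / 4) := by gcongr; nlinarith
    have h3 : 0 ≤ r ^ 3 := by positivity
    constructor <;> nlinarith
  have hN : (0 : ℝ) ≤ N := by positivity
  have hN' : (0 : ℝ) ≤ N' := by positivity
  have hcase : (1 : ℝ) ≤ N ∨ (1 : ℝ) ≤ N' := by
    rcases Nat.eq_zero_or_pos N with h | h
    · right
      have : 1 ≤ N' := Nat.one_le_iff_ne_zero.mpr fun h' => hz ⟨h, h'⟩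
      exact_mod_cast this
    · left; exact_mod_cast h
  have hN1 : N = 0 ∨ (1 : ℝ) ≤ N := by
    rcases Nat.eq_zero_or_pos N with h | h
    · exact Or.inl h
    · right; exact_mod_cast h
  have hN1' : N' = 0 ∨ (1 : ℝ) ≤ N' := by
    rcases Nat.eq_zero_or_pos N' with h | h
    · exact Or.inl h
    · right; exact_mod_cast h
  set τ := x + N - r with hτ
  set τ' := 1 - x + N' - r with hτ'
  have k1 := abs_le.mp (parabola_one_sided (r := r) (τ := τ) (by linarith) (by linarith) (by
    rcases hN1 with h | h
    · rw [h] at hτ; simp at hτ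
      rcases hcase with h' | h'
      · rw [h] at h'; norm_num at h'
      · linarith
    · linarith))
  have k2 := abs_le.mp (parabola_one_sided (r := r) (τ := τ') (by linarith) (by linarith) (by
    rcases hN1' with h | h
    · rw [h] at hτ'; simp at hτ'
      rcases hcase with h' | h'
      · linarith
      · rw [h] at h'; norm_num at h'
    · linarith))
  have n1 : (N : ℝ) = r + τ - x := by linarith
  have n2 : (N' : ℝ) = r + τ' - (1 - x) := by linarith
  have heq : N * r ^ 2 / 2 - (((x + N) ^ 3 - 3 / 2 * (x + N) ^ 2 + (x + N) / 2) -
        (x ^ 3 - 3 / 2 * x ^ 2 + x / 2)) / 6 +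
      (N' * r ^ 2 / 2 - (((1 - x + N') ^ 3 - 3 / 2 * (1 - x + N') ^ 2 + (1 - x + N') / 2) -
        ((1 - x) ^ 3 - 3 / 2 * (1 - x) ^ 2 + (1 - x) / 2)) / 6) - 2 * r ^ 3 / 3 =
      (-(r / 2) * (1 / 6 - τ * (1 - τ)) - τ * (1 - τ) * (1 / 2 - τ) / 6) +
      (-(r / 2) * (1 / 6 - τ' * (1 - τ')) - τ' * (1 - τ') * (1 / 2 - τ') / 6) := by
    rw [n1, n2]; ring
  rw [heq, abs_le]
  constructor <;> linarith [k1.1, k1.2, k2.1, k2.2]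

/-! ### The logarithmic lattice sum as a superposition of parabolas -/

theorem hasDerivAt_inv_sq_add {y : ℝ} (hy : 0 < y) (r : ℝ) :
    HasDerivAt (fun r : ℝ => 1 / (r ^ 2 + 4 * y ^ 2)) (-(2 * r / (r ^ 2 + 4 * y ^ 2) ^ 2)) r := by
  have h : HasDerivAt (fun r : ℝ => r ^ 2 + 4 * y ^ 2) (2 * r) r := by
    simpa using (hasDerivAt_pow 2 r).add_const (4 * y ^ 2)
  have := h.inv (by positivity)
  convert! this using 1
  · ext; simp
  · field_simp

theorem hasDerivAt_arctan_div {y : ℝ} (hy : 0 < y) (r : ℝ) :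
    HasDerivAt (fun r : ℝ => Real.arctan (r / (2 * y))) (2 * y / (r ^ 2 + 4 * y ^ 2)) r := by
  have := ((hasDerivAt_id r).div_const (2 * y)).arctan
  convert! this using 1
  simp only [id]
  field_simp
  ring

theorem continuous_weight {y : ℝ} (hy : 0 < y) :
    Continuous (fun r : ℝ => 2 * r / (r ^ 2 + 4 * y ^ 2) ^ 2) := by
  refine Continuous.div (by fun_prop) (by fun_prop) fun r => ?_
  positivity

/-- The weight is minus the derivative of `1/(r² + 4y²)`, so an integration by parts produces the
logarithm. All weights are nonnegative, which lets error bounds for parabola sums pass to the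
logarithmic sum without loss. -/
theorem integral_weight_mul_max {y X t : ℝ} (hy : 0 < y) (ht : 0 ≤ t) (htX : t ≤ X) :
    1 / (X ^ 2 + 4 * y ^ 2) * ((X ^ 2 - t ^ 2) / 2) +
      ∫ r in (0:ℝ)..X, 2 * r / (r ^ 2 + 4 * y ^ 2) ^ 2 * (max (r ^ 2 - t ^ 2) 0 / 2) =
    1 / 2 * Real.log ((X ^ 2 + 4 * y ^ 2) / (t ^ 2 + 4 * y ^ 2)) := by
  have hc : Continuous (fun r : ℝ => 2 * r / (r ^ 2 + 4 * y ^ 2) ^ 2 * (max (r ^ 2 - t ^ 2) 0 / 2)) :=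
    (continuous_weight hy).mul (by fun_prop)
  rw [← intervalIntegral.integral_add_adjacent_intervals (hc.intervalIntegrable 0 t)
    (hc.intervalIntegrable t X)]
  have h1 : ∫ r in (0:ℝ)..t, 2 * r / (r ^ 2 + 4 * y ^ 2) ^ 2 * (max (r ^ 2 - t ^ 2) 0 / 2) = 0 := by
    rw [intervalIntegral.integral_congr (g := fun _ => 0), intervalIntegral.integral_zero]
    intro r hr
    rw [Set.uIcc_of_le ht] at hr
    have : r ^ 2 - t ^ 2 ≤ 0 := by nlinarith [hr.1, hr.2]
    simp [max_eq_right this]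
  have h2 : ∫ r in t..X, 2 * r / (r ^ 2 + 4 * y ^ 2) ^ 2 * (max (r ^ 2 - t ^ 2) 0 / 2) =
      (1 / 2 * Real.log (X ^ 2 + 4 * y ^ 2) - 1 / (X ^ 2 + 4 * y ^ 2) * ((X ^ 2 - t ^ 2) / 2)) -
      (1 / 2 * Real.log (t ^ 2 + 4 * y ^ 2) - 1 / (t ^ 2 + 4 * y ^ 2) * ((t ^ 2 - t ^ 2) / 2)) := by
    refine intervalIntegral.integral_eq_sub_of_hasDerivAt (f := fun r =>
      1 / 2 * Real.log (r ^ 2 + 4 * y ^ 2) - 1 / (r ^ 2 + 4 * y ^ 2) * ((r ^ 2 - t ^ 2) / 2)) ?_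
      (hc.intervalIntegrable _ _)
    intro r hr
    rw [Set.uIcc_of_le htX] at hr
    have hm : max (r ^ 2 - t ^ 2) 0 = r ^ 2 - t ^ 2 := max_eq_left (by nlinarith [hr.1, hr.2])
    have e0 : HasDerivAt (fun r : ℝ => r ^ 2 + 4 * y ^ 2) (2 * r) r := by
      simpa using (hasDerivAt_pow 2 r).add_const (4 * y ^ 2)
    have e1 := (e0.log (by positivity)).const_mul (1 / 2)
    have e2 : HasDerivAt (fun r : ℝ => (r ^ 2 - t ^ 2) / 2) (2 * r / 2) r := by
      simpa using ((hasDerivAt_pow 2 r).sub_const (t ^ 2)).div_const 2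
    have := e1.sub ((hasDerivAt_inv_sq_add hy r).mul e2)
    convert! this using 1
    rw [hm]
    field_simp
    ring
  rw [h1, h2, Real.log_div (by positivity) (by positivity)]
  ring

theorem integral_weight_mul_self {y : ℝ} (hy : 0 < y) (X : ℝ) :
    ∫ r in (0:ℝ)..X, 2 * r / (r ^ 2 + 4 * y ^ 2) ^ 2 * r =
      1 / (2 * y) * Real.arctan (X / (2 * y)) - X / (X ^ 2 + 4 * y ^ 2) := by
  have hc : Continuous (fun r : ℝ => 2 * r / (r ^ 2 + 4 * y ^ 2) ^ 2 * r) :=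
    (continuous_weight hy).mul continuous_id
  rw [intervalIntegral.integral_eq_sub_of_hasDerivAt (f := fun r =>
    1 / (2 * y) * Real.arctan (r / (2 * y)) - r * (1 / (r ^ 2 + 4 * y ^ 2))) ?_
    (hc.intervalIntegrable _ _)]
  · simp; ring
  · intro r _
    have := ((hasDerivAt_arctan_div hy r).const_mul (1 / (2 * y))).sub
      ((hasDerivAt_id r).mul (hasDerivAt_inv_sq_add hy r))
    convert! this using 1
    simp only [id]
    field_simp
    ring

theorem integral_weight_mul_cube {y : ℝ} (hy : 0 < y) (X : ℝ) :
    ∫ r in (0:ℝ)..X, 2 * r / (r ^ 2 + 4 * y ^ 2) ^ 2 * (2 * r ^ 3 / 3) =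
      2 * X - 4 * y * Real.arctan (X / (2 * y)) - 1 / (X ^ 2 + 4 * y ^ 2) * (2 * X ^ 3 / 3) := by
  have hc : Continuous (fun r : ℝ => 2 * r / (r ^ 2 + 4 * y ^ 2) ^ 2 * (2 * r ^ 3 / 3)) :=
    (continuous_weight hy).mul (by fun_prop)
  rw [intervalIntegral.integral_eq_sub_of_hasDerivAt (f := fun r =>
    2 * r - 4 * y * Real.arctan (r / (2 * y)) - 1 / (r ^ 2 + 4 * y ^ 2) * (2 * r ^ 3 / 3)) ?_
    (hc.intervalIntegrable _ _)]
  · simp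
  · intro r _
    have e2 : HasDerivAt (fun r : ℝ => 2 * r ^ 3 / 3) (2 * r ^ 2) r := by
      have := ((hasDerivAt_pow 3 r).const_mul 2).div_const 3
      convert! this using 1
      push_cast; ring
    have := (((hasDerivAt_id r).const_mul 2).sub
      ((hasDerivAt_arctan_div hy r).const_mul (4 * y))).sub ((hasDerivAt_inv_sq_add hy r).mul e2)
    convert! this using 1
    field_simp
    ring

theorem exists_finset_abs_add_int_le (x X : ℝ) : ∃ B : Finset ℤ, ∀ b : ℤ, b ∈ B ↔ |x + b| ≤ X := by
  refine ⟨Finset.Icc ⌈-X - x⌉ ⌊X - x⌋, fun b => ?_⟩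
  rw [Finset.mem_Icc, Int.ceil_le, Int.le_floor, abs_le]
  constructor <;> rintro ⟨h1, h2⟩ <;> constructor <;> linarith

/-- The parabola estimate is integrated against the positive weights. The cubic main term gives `2X
- 4y arctan(X/2y)`; the error `r/6` gives `(1/12y) arctan(X/2y)`, the boundary terms cancelling. -/
theorem abs_sum_log_ratio_sub_le {x X y : ℝ} (hx : 0 < x) (hx1 : x < 1) (hX : 0 < X) (hy : 0 < y)
    {B : Finset ℤ} (hB : ∀ b : ℤ, b ∈ B ↔ |x + b| ≤ X) :
    |(∑ b ∈ B, 1 / 2 * Real.log ((X ^ 2 + 4 * y ^ 2) / ((x + b) ^ 2 + 4 * y ^ 2))) -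
      (2 * X - 4 * y * Real.arctan (X / (2 * y)))| ≤ 1 / (12 * y) * Real.arctan (X / (2 * y)) := by
  set P : ℝ → ℝ := fun r => ∑ b ∈ B, max (r ^ 2 - (x + b) ^ 2) 0 / 2 with hP
  have hPc : Continuous P := by rw [hP]; fun_prop
  have hPb : ∀ r ∈ Set.Icc 0 X, |P r - 2 * r ^ 3 / 3| ≤ r / 6 := by
    intro r hr
    obtain ⟨B', hB'⟩ := exists_finset_abs_add_int_le x r
    have hsub : B' ⊆ B := fun b hb => (hB b).mpr (((hB' b).mp hb).trans hr.2)
    have : P r = ∑ b ∈ B', (r ^ 2 - (x + b) ^ 2) / 2 := by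
      rw [hP]
      beta_reduce
      rw [← Finset.sum_subset hsub]
      · refine Finset.sum_congr rfl fun b hb => ?_
        rw [max_eq_left]
        rw [sub_nonneg]
        exact sq_le_sq' (by linarith [(abs_le.mp ((hB' b).mp hb)).1]) (abs_le.mp ((hB' b).mp hb)).2
      · intro b _ hb
        rw [hB', not_le] at hb
        rw [max_eq_right, zero_div]
        rw [sub_nonpos, ← sq_abs (x + b)]
        exact pow_le_pow_left₀ hr.1 hb.le 2
    rw [this]
    exact abs_sum_parabola_sub_le hx hx1 hr.1 hB'
  have hw : ∀ r ∈ Set.Icc 0 X, 0 ≤ 2 * r / (r ^ 2 + 4 * y ^ 2) ^ 2 := fun r hr => by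
    have := hr.1
    positivity
  have hsum : ∑ b ∈ B, 1 / 2 * Real.log ((X ^ 2 + 4 * y ^ 2) / ((x + b) ^ 2 + 4 * y ^ 2)) =
      1 / (X ^ 2 + 4 * y ^ 2) * P X + ∫ r in (0:ℝ)..X, 2 * r / (r ^ 2 + 4 * y ^ 2) ^ 2 * P r := by
    have h1 : ∀ b ∈ B, 1 / 2 * Real.log ((X ^ 2 + 4 * y ^ 2) / ((x + b) ^ 2 + 4 * y ^ 2)) =
        1 / (X ^ 2 + 4 * y ^ 2) * (max (X ^ 2 - (x + b) ^ 2) 0 / 2) +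
        ∫ r in (0:ℝ)..X, 2 * r / (r ^ 2 + 4 * y ^ 2) ^ 2 * (max (r ^ 2 - (x + b) ^ 2) 0 / 2) := by
      intro b hb
      have hle := (hB b).mp hb
      have := integral_weight_mul_max hy (abs_nonneg (x + b)) hle
      simp only [sq_abs] at this
      rw [← this, max_eq_left]
      rw [sub_nonneg, ← sq_abs (x + b)]
      exact pow_le_pow_left₀ (abs_nonneg _) hle 2
    rw [Finset.sum_congr rfl h1, Finset.sum_add_distrib, ← Finset.mul_sum,
      ← intervalIntegral.integral_finsetSum]
    · simp only [hP, Finset.mul_sum]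
    · intro b _
      exact ((continuous_weight hy).mul (by fun_prop)).intervalIntegrable _ _
  have hJ : 2 * X - 4 * y * Real.arctan (X / (2 * y)) = 1 / (X ^ 2 + 4 * y ^ 2) * (2 * X ^ 3 / 3) +
      ∫ r in (0:ℝ)..X, 2 * r / (r ^ 2 + 4 * y ^ 2) ^ 2 * (2 * r ^ 3 / 3) := by
    rw [integral_weight_mul_cube hy]; ring
  have hc1 : Continuous (fun r : ℝ => 2 * r / (r ^ 2 + 4 * y ^ 2) ^ 2 * P r) :=
    (continuous_weight hy).mul hPc
  have hc2 : Continuous (fun r : ℝ => 2 * r / (r ^ 2 + 4 * y ^ 2) ^ 2 * (2 * r ^ 3 / 3)) :=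
    (continuous_weight hy).mul (by fun_prop)
  have hdiff : (∑ b ∈ B, 1 / 2 * Real.log ((X ^ 2 + 4 * y ^ 2) / ((x + b) ^ 2 + 4 * y ^ 2))) -
      (2 * X - 4 * y * Real.arctan (X / (2 * y))) =
      1 / (X ^ 2 + 4 * y ^ 2) * (P X - 2 * X ^ 3 / 3) +
      ∫ r in (0:ℝ)..X, 2 * r / (r ^ 2 + 4 * y ^ 2) ^ 2 * (P r - 2 * r ^ 3 / 3) := by
    have : ∫ r in (0:ℝ)..X, 2 * r / (r ^ 2 + 4 * y ^ 2) ^ 2 * (P r - 2 * r ^ 3 / 3) =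
        (∫ r in (0:ℝ)..X, 2 * r / (r ^ 2 + 4 * y ^ 2) ^ 2 * P r) -
        ∫ r in (0:ℝ)..X, 2 * r / (r ^ 2 + 4 * y ^ 2) ^ 2 * (2 * r ^ 3 / 3) := by
      rw [← intervalIntegral.integral_sub (hc1.intervalIntegrable _ _) (hc2.intervalIntegrable _ _)]
      congr 1; ext r; ring
    rw [hsum, hJ, this]; ring
  have hint : |∫ r in (0:ℝ)..X, 2 * r / (r ^ 2 + 4 * y ^ 2) ^ 2 * (P r - 2 * r ^ 3 / 3)| ≤
      ∫ r in (0:ℝ)..X, 1 / 6 * (2 * r / (r ^ 2 + 4 * y ^ 2) ^ 2 * r) := by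
    rw [← Real.norm_eq_abs]
    refine intervalIntegral.norm_integral_le_of_norm_le hX.le ?_ ?_
    · refine Filter.Eventually.of_forall fun r hr => ?_
      have hr' : r ∈ Set.Icc 0 X := ⟨hr.1.le, hr.2⟩
      rw [Real.norm_eq_abs, abs_mul, abs_of_nonneg (hw r hr')]
      have := mul_le_mul_of_nonneg_left (hPb r hr') (hw r hr')
      linarith
    · exact (continuous_const.mul ((continuous_weight hy).mul continuous_id)).intervalIntegrable _ _
  rw [intervalIntegral.integral_const_mul, integral_weight_mul_self hy] at hint
  have hh : 0 < 1 / (X ^ 2 + 4 * y ^ 2) := by positivity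
  have hb1 : |1 / (X ^ 2 + 4 * y ^ 2) * (P X - 2 * X ^ 3 / 3)| ≤ 1 / (X ^ 2 + 4 * y ^ 2) * (X / 6) := by
    rw [abs_mul, abs_of_pos hh]
    exact mul_le_mul_of_nonneg_left (hPb X ⟨hX.le, le_rfl⟩) hh.le
  rw [hdiff]
  refine (abs_add_le _ _).trans ((add_le_add hb1 hint).trans (le_of_eq ?_))
  field_simp
  ring

/-- The sum over the translates of a point at height `y` which lie within (Euclidean) distance `X`
of another point at the same height. -/
theorem abs_translate_sum_add_log_sin_le {x X y : ℝ} (hx : 0 < x) (hx1 : x < 1) (hX : 0 < X)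
    (hy : 0 < y) {B : Finset ℤ} (hB : ∀ b : ℤ, b ∈ B ↔ |x + b| ≤ X) :
    |(∑ b ∈ B, 1 / (4 * Real.pi) * (Real.log (1 + 4 * y ^ 2 / (x + b) ^ 2) -
        Real.log (1 + 4 * y ^ 2 / X ^ 2))) + 1 / (2 * Real.pi) * Real.log (2 * Real.sin (Real.pi * x))
      - 2 * y / Real.pi * Real.arctan (X / (2 * y))| ≤
      1 / (24 * Real.pi * y) * (2 * y / X + Real.arctan (X / (2 * y))) := by
  have h1 := abs_sum_log_div_add_log_sin_le hx hx1 hX hB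
  have h2 := abs_sum_log_ratio_sub_le hx hx1 hX hy hB
  have hne : ∀ b : ℤ, x + b ≠ 0 := by
    intro b hb
    have h3 : ((-b : ℤ) : ℝ) = x := by push_cast; linarith
    have h4 : (0 : ℝ) < ((-b : ℤ) : ℝ) := by rw [h3]; exact hx
    have h5 : ((-b : ℤ) : ℝ) < 1 := by rw [h3]; exact hx1
    have h6 : 0 < -b := by exact_mod_cast h4
    have h7 : -b < 1 := by exact_mod_cast h5
    omega
  -- Each term is half a logarithm of squares in the numerator minus one in the denominator. The
  -- first part is the sum governed by the Gamma function, the second the regular sum with `4y²`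
  -- inside.
  have hterm : ∀ b ∈ B, 1 / (4 * Real.pi) * (Real.log (1 + 4 * y ^ 2 / (x + b) ^ 2) -
        Real.log (1 + 4 * y ^ 2 / X ^ 2)) = 1 / (2 * Real.pi) * (Real.log (X / |x + b|) -
        1 / 2 * Real.log ((X ^ 2 + 4 * y ^ 2) / ((x + b) ^ 2 + 4 * y ^ 2))) := by
    intro b _
    have hb := hne b
    have hb2 : (x + b) ^ 2 ≠ 0 := pow_ne_zero 2 hb
    have hb3 : (x + b) ^ 2 + 4 * y ^ 2 ≠ 0 := by positivity
    have e1 : 1 + 4 * y ^ 2 / (x + b) ^ 2 = ((x + b) ^ 2 + 4 * y ^ 2) / (x + b) ^ 2 := by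
      field_simp
    have e2 : 1 + 4 * y ^ 2 / X ^ 2 = (X ^ 2 + 4 * y ^ 2) / X ^ 2 := by field_simp
    rw [e1, e2, Real.log_div hb3 hb2, Real.log_div (by positivity) (by positivity),
      Real.log_div hX.ne' (abs_ne_zero.mpr hb), Real.log_div (by positivity) hb3, Real.log_abs,
      Real.log_pow, Real.log_pow]
    field_simp
    push_cast
    ring
  rw [Finset.sum_congr rfl hterm, ← Finset.mul_sum, Finset.sum_sub_distrib]
  set S1 := ∑ b ∈ B, Real.log (X / |x + b|)
  set S2 := ∑ b ∈ B, 1 / 2 * Real.log ((X ^ 2 + 4 * y ^ 2) / ((x + b) ^ 2 + 4 * y ^ 2))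
  set a := Real.arctan (X / (2 * y))
  set l := Real.log (2 * Real.sin (Real.pi * x))
  have hpi := Real.pi_pos
  have e : 1 / (2 * Real.pi) * (S1 - S2) + 1 / (2 * Real.pi) * l - 2 * y / Real.pi * a =
      1 / (2 * Real.pi) * ((S1 + l - 2 * X) - (S2 - (2 * X - 4 * y * a))) := by
    field_simp; ring
  rw [e, abs_mul, abs_of_pos (by positivity)]
  calc 1 / (2 * Real.pi) * |(S1 + l - 2 * X) - (S2 - (2 * X - 4 * y * a))|
      ≤ 1 / (2 * Real.pi) * (1 / (6 * X) + 1 / (12 * y) * a) := by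
        gcongr
        exact (abs_sub _ _).trans (add_le_add h1 h2)
    _ = _ := by field_simp; ring

/-! ### The transformations of the upper half-plane induced by the group -/

open FuchsianGreen

theorem exists_smul_eq {Γ : Subgroup SL(2, ℝ)} (t : transformationGroup Γ) :
    ∃ γ ∈ Γ, ∀ z : ℍ, t • z = γ • z := by
  obtain ⟨_, γ, rfl⟩ := t
  exact ⟨γ.1, γ.2, fun _ => rfl⟩

theorem exists_transformation {Γ : Subgroup SL(2, ℝ)} {γ : SL(2, ℝ)} (hγ : γ ∈ Γ) :
    ∃ t : transformationGroup Γ, ∀ z : ℍ, t • z = γ • z :=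
  ⟨⟨_, ⟨γ, hγ⟩, rfl⟩, fun _ => rfl⟩

theorem transformation_ext {Γ : Subgroup SL(2, ℝ)} {s t : transformationGroup Γ}
    (h : ∀ z : ℍ, s • z = t • z) : s = t :=
  Subtype.ext (Equiv.ext h)

instance (Γ : Subgroup SL(2, ℝ)) : ContinuousConstSMul (transformationGroup Γ) ℍ where
  continuous_const_smul t := by
    obtain ⟨γ, -, h⟩ := exists_smul_eq t
    rw [funext h]
    exact continuous_const_smul γ

instance (Γ : Subgroup SL(2, ℝ)) : SMulInvariantMeasure (transformationGroup Γ) ℍ volume where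
  measure_preimage_smul t s hs := by
    obtain ⟨γ, -, h⟩ := exists_smul_eq t
    rw [funext h]
    exact measure_preimage_smul (μ := (volume : Measure ℍ))
      (Matrix.SpecialLinearGroup.mapGL ℝ γ : GL (Fin 2) ℝ) s

theorem countable_transformationGroup {Γ : Subgroup SL(2, ℝ)} (hΓ : DiscreteTopology Γ) :
    Countable (transformationGroup Γ) := by
  have : SecondCountableTopology SL(2, ℝ) := by
    have : SecondCountableTopology (Matrix (Fin 2) (Fin 2) ℝ) :=
      inferInstanceAs (SecondCountableTopology (Fin 2 → Fin 2 → ℝ))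
    exact (Topology.IsInducing.subtypeVal (t := {A : Matrix (Fin 2) (Fin 2) ℝ |
      A.det = 1})).secondCountableTopology
  have : Countable Γ := by
    have : SecondCountableTopology Γ := inferInstance
    exact TopologicalSpace.separableSpace_iff_countable.mp inferInstance
  exact (MonoidHom.rangeRestrict_surjective (MulAction.toPermHom Γ ℍ)).countable

theorem finite_transformation_inter {Γ : Subgroup SL(2, ℝ)} (hΓ : DiscreteTopology Γ) {K L : Set ℍ}
    (hK : IsCompact K) (hL : IsCompact L) :
    {t : transformationGroup Γ | ∃ z ∈ K, t • z ∈ L}.Finite := by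
  have h := (ProperlyDiscontinuousSMul.finite_disjoint_inter_image (Γ := Γ) hK hL)
  refine (h.image (MonoidHom.rangeRestrict (MulAction.toPermHom Γ ℍ))).subset ?_
  rintro ⟨_, γ, rfl⟩ ⟨z, hz, hz'⟩
  exact ⟨γ, ⟨γ • z, ⟨z, hz, rfl⟩, hz'⟩, rfl⟩

theorem exists_finset_smul_notMem {Γ : Subgroup SL(2, ℝ)} (hΓ : DiscreteTopology Γ) {L : Set ℍ}
    (hL : IsCompact L) (z₀ : ℍ) :
    ∃ S : Finset (transformationGroup Γ), ∀ᶠ z in 𝓝 z₀, ∀ t ∉ S, t • z ∉ L := by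
  obtain ⟨K, hK, hz⟩ := exists_compact_mem_nhds z₀
  refine ⟨(finite_transformation_inter hΓ hK hL).toFinset, ?_⟩
  filter_upwards [hz] with z hzK t ht h
  exact ht (by simpa using ⟨z, hzK, h⟩)

/-! ### Fractional linear maps -/

theorem im_sl_smul (g : SL(2, ℝ)) (z : ℍ) :
    (g • z).im = z.im / ‖(g 1 0 : ℂ) * z + g 1 1‖ ^ 2 := by
  have h : (g • z).im = _ := UpperHalfPlane.im_smul_eq_div_normSq
    (Matrix.SpecialLinearGroup.mapGL ℝ g : GL (Fin 2) ℝ) z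
  rw [Complex.normSq_eq_norm_sq] at h
  simpa [denom] using h

/-- The derivative is `1/(cp + d)²` because the determinant is `1`, and `Im p / |cp + d|²` is the
new height. -/
theorem analyticAt_sl_smul (g : SL(2, ℝ)) {p : ℂ} (hp : 0 < p.im) :
    AnalyticAt ℂ (fun q : ℂ => ((g • ofComplex q : ℍ) : ℂ)) p ∧
    ‖deriv (fun q : ℂ => ((g • ofComplex q : ℍ) : ℂ)) p‖ = (g • ofComplex p).im / p.im := by
  have hev : (fun q : ℂ => ((g • ofComplex q : ℍ) : ℂ)) =ᶠ[𝓝 p]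
      fun q => ((g 0 0 : ℂ) * q + g 0 1) / ((g 1 0 : ℂ) * q + g 1 1) := by
    filter_upwards [(isOpen_lt continuous_const Complex.continuous_im).mem_nhds hp] with q hq
    rw [coe_specialLinearGroup_apply, ofComplex_apply_of_im_pos hq]
    simp
  have hd : ((g 1 0 : ℂ) * p + g 1 1) ≠ 0 := denom_ne_zero g ⟨p, hp⟩
  have hdet : (g 0 0 : ℂ) * g 1 1 - g 0 1 * g 1 0 = 1 := by
    have := g.det_coe
    rw [Matrix.det_fin_two] at this
    exact_mod_cast this
  constructor
  · refine AnalyticAt.congr ?_ hev.symm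
    fun_prop (disch := exact hd)
  · rw [hev.deriv_eq]
    have h1 : HasDerivAt (fun q : ℂ => ((g 0 0 : ℂ) * q + g 0 1)) (g 0 0 : ℂ) p := by
      simpa using ((hasDerivAt_id p).const_mul (g 0 0 : ℂ)).add_const (g 0 1 : ℂ)
    have h2 : HasDerivAt (fun q : ℂ => ((g 1 0 : ℂ) * q + g 1 1)) (g 1 0 : ℂ) p := by
      simpa using ((hasDerivAt_id p).const_mul (g 1 0 : ℂ)).add_const (g 1 1 : ℂ)
    rw [(h1.fun_div h2 hd).deriv]
    have : ((g 0 0 : ℂ) * ((g 1 0 : ℂ) * p + g 1 1) - (g 0 0 * p + g 0 1) * g 1 0) = 1 := by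
      linear_combination hdet
    rw [this, norm_div, norm_one, norm_pow, im_sl_smul, ofComplex_apply_of_im_pos hp]
    have hp' : p.im ≠ 0 := hp.ne'
    change _ = p.im / _ / _
    field_simp

/-! ### Test functions and their periodisations -/

/-- Smooth functions on `ℂ` with compact support in the upper half-plane. -/
structure IsTestFunction (χ : ℂ → ℝ) : Prop where
  smooth : ContDiff ℝ ∞ χ
  compact : HasCompactSupport χ
  support : tsupport χ ⊆ {p : ℂ | 0 < p.im}

theorem isOpen_im_pos : IsOpen {p : ℂ | 0 < p.im} :=
  isOpen_lt continuous_const Complex.continuous_im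

theorem IsTestFunction.isCompact_preimage {χ : ℂ → ℝ} (hχ : IsTestFunction χ) :
    IsCompact ((fun z : ℍ => (z : ℂ)) ⁻¹' tsupport χ) := by
  refine isOpenEmbedding_coe.isInducing.isCompact_preimage_iff ?_ |>.mpr hχ.compact
  intro p hp
  exact ⟨⟨p, hχ.support hp⟩, rfl⟩

theorem contDiff_laplacian {χ : ℂ → ℝ} (h : ContDiff ℝ ∞ χ) :
    ContDiff ℝ ∞ (Laplacian.laplacian χ) := by
  rw [InnerProductSpace.laplacian_eq_iteratedFDeriv_complexPlane]
  have h2 : ContDiff ℝ ∞ (iteratedFDeriv ℝ 2 χ) := h.iteratedFDeriv_right (by norm_cast)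
  have key : ∀ v : Fin 2 → ℂ, ContDiff ℝ ∞ fun x => iteratedFDeriv ℝ 2 χ x v := fun v =>
    (ContinuousMultilinearMap.apply ℝ (fun _ : Fin 2 => ℂ) ℝ v).contDiff.comp h2
  exact (key _).add (key _)

theorem laplacian_finset_sum {ι : Type*} (S : Finset ι) {f : ι → ℂ → ℝ} {z : ℂ}
    (hf : ∀ i ∈ S, ContDiffAt ℝ 2 (f i) z) :
    Laplacian.laplacian (fun q => ∑ i ∈ S, f i q) z = ∑ i ∈ S, Laplacian.laplacian (f i) z := by
  classical
  induction S using Finset.induction_on with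
  | empty => simp
  | insert a S ha ih =>
    simp only [Finset.sum_insert ha]
    rw [← ih fun i hi => hf i (Finset.mem_insert_of_mem hi)]
    exact ContDiffAt.laplacian_add (hf a (Finset.mem_insert_self a S))
      (ContDiffAt.sum fun i hi => hf i (Finset.mem_insert_of_mem hi))

/-- Multiplication by a smooth function. -/
theorem IsTestFunction.mul_left {χ g : ℂ → ℝ} (hχ : IsTestFunction χ)
    (hg : ContDiffOn ℝ ∞ g {p : ℂ | 0 < p.im}) : IsTestFunction (fun p => g p * χ p) := by
  have hsub : tsupport (fun p => g p * χ p) ⊆ tsupport χ := tsupport_mul_subset_right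
  refine ⟨?_, hχ.compact.mul_left, hsub.trans hχ.support⟩
  rw [contDiff_iff_contDiffAt]
  intro p
  by_cases hp : p ∈ tsupport χ
  · exact (hg.contDiffAt (isOpen_im_pos.mem_nhds (hχ.support hp))).mul hχ.smooth.contDiffAt
  · have h0 : (fun p => g p * χ p) =ᶠ[𝓝 p] fun _ => 0 := by
      filter_upwards [(isClosed_tsupport χ).isOpen_compl.mem_nhds hp] with q hq
      rw [image_eq_zero_of_notMem_tsupport hq, mul_zero]
    exact contDiffAt_const.congr_of_eventuallyEq h0

theorem contDiff_im_sq : ContDiff ℝ ∞ (fun p : ℂ => p.im ^ 2) :=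
  (Complex.imCLM.contDiff).pow 2

theorem IsTestFunction.laplacian {χ : ℂ → ℝ} (hχ : IsTestFunction χ) :
    IsTestFunction (Laplacian.laplacian χ) where
  smooth := contDiff_laplacian hχ.smooth
  compact := hχ.compact.mono' ((subset_tsupport _).trans (tsupport_laplacian_subset _))
  support := (tsupport_laplacian_subset _).trans hχ.support

/-- The sum of the translates of `χ` under the transformations induced by `Γ`. -/
noncomputable def periodise (Γ : Subgroup SL(2, ℝ)) (χ : ℂ → ℝ) (z : ℍ) : ℝ :=
  ∑ᶠ t : transformationGroup Γ, χ ((t • z : ℍ) : ℂ)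

section

variable {Γ : Subgroup SL(2, ℝ)} {χ : ℂ → ℝ}

/-- Proper discontinuity makes the sum finite locally. The same finite set serves every `φ`
supported in the support of `χ`, in particular `χ` and its Laplacian together. -/
theorem eventually_periodise_eq (hΓ : DiscreteTopology Γ) (hχ : IsTestFunction χ) (z₀ : ℍ) :
    ∃ S : Finset (transformationGroup Γ), ∀ᶠ z in 𝓝 z₀,
      ∀ φ : ℂ → ℝ, tsupport φ ⊆ tsupport χ → (∀ t ∉ S, φ ((t • z : ℍ) : ℂ) = 0) ∧
        periodise Γ φ z = ∑ t ∈ S, φ ((t • z : ℍ) : ℂ) := by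
  obtain ⟨S, hS⟩ := exists_finset_smul_notMem hΓ hχ.isCompact_preimage z₀
  refine ⟨S, hS.mono fun z hz φ hφ => ?_⟩
  have h0 : ∀ t ∉ S, φ ((t • z : ℍ) : ℂ) = 0 := fun t ht =>
    image_eq_zero_of_notMem_tsupport fun h => hz t ht (hφ h)
  refine ⟨h0, finsum_eq_sum_of_support_subset _ fun t ht => ?_⟩
  by_contra hn
  exact ht (h0 t hn)

theorem hasFiniteSupport_periodise (hΓ : DiscreteTopology Γ) (hχ : IsTestFunction χ) (z : ℍ) :
    (Function.support fun t : transformationGroup Γ => χ ((t • z : ℍ) : ℂ)).Finite := by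
  obtain ⟨S, hS⟩ := eventually_periodise_eq hΓ hχ z
  refine S.finite_toSet.subset fun t ht => ?_
  by_contra hn
  exact ht ((hS.self_of_nhds χ le_rfl).1 t hn)

theorem periodise_transformation (χ : ℂ → ℝ) (s : transformationGroup Γ) (z : ℍ) :
    periodise Γ χ (s • z) = periodise Γ χ z := by
  unfold periodise
  rw [← finsum_comp_equiv (Equiv.mulRight s) (f := fun t => χ ((t • z : ℍ) : ℂ))]
  simp only [Equiv.coe_mulRight, mul_smul]

theorem isInvariant_periodise (Γ : Subgroup SL(2, ℝ)) (χ : ℂ → ℝ) :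
    IsInvariant Γ (periodise Γ χ) := by
  intro γ hγ z
  obtain ⟨t, ht⟩ := exists_transformation hγ
  rw [← ht, periodise_transformation]

theorem contDiffAt_comp_transformation {φ : ℂ → ℝ} (hφ : ContDiff ℝ ∞ φ)
    (t : transformationGroup Γ) {p : ℂ} (hp : 0 < p.im) :
    ContDiffAt ℝ ∞ (fun q : ℂ => φ ((t • ofComplex q : ℍ) : ℂ)) p := by
  obtain ⟨γ, -, h⟩ := exists_smul_eq t
  simp only [h]
  exact hφ.contDiffAt.comp p ((analyticAt_sl_smul γ hp).1.contDiffAt.restrict_scalars ℝ)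

theorem tendsto_ofComplex {p : ℂ} (hp : 0 < p.im) :
    Filter.Tendsto ofComplex (𝓝 p) (𝓝 (ofComplex p)) :=
  (contMDiffAt_ofComplex (n := 0) hp).continuousAt

theorem eventuallyEq_periodise (hΓ : DiscreteTopology Γ) (hχ : IsTestFunction χ) {p : ℂ}
    (hp : 0 < p.im) : ∃ S : Finset (transformationGroup Γ),
      (fun q : ℂ => periodise Γ χ (ofComplex q)) =ᶠ[𝓝 p]
        (fun q => ∑ t ∈ S, χ ((t • ofComplex q : ℍ) : ℂ)) ∧
      ∀ φ : ℂ → ℝ, tsupport φ ⊆ tsupport χ →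
        periodise Γ φ (ofComplex p) = ∑ t ∈ S, φ ((t • ofComplex p : ℍ) : ℂ) := by
  obtain ⟨S, hS⟩ := eventually_periodise_eq hΓ hχ (ofComplex p)
  exact ⟨S, ((tendsto_ofComplex hp).eventually hS).mono fun q hq => (hq χ le_rfl).2,
    fun φ hφ => (hS.self_of_nhds φ hφ).2⟩

theorem isSmooth_periodise (hΓ : DiscreteTopology Γ) (hχ : IsTestFunction χ) :
    IsSmooth (periodise Γ χ) := by
  intro p hp
  obtain ⟨S, hS, -⟩ := eventuallyEq_periodise hΓ hχ hp
  refine ContDiffAt.contDiffWithinAt (ContDiffAt.congr_of_eventuallyEq ?_ hS)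
  exact ContDiffAt.sum fun t _ => contDiffAt_comp_transformation hχ.smooth t hp

theorem FuchsianGreen.IsSmooth.continuous {f : ℍ → ℝ} (hf : IsSmooth f) : Continuous f := by
  have h := hf.continuousOn.comp_continuous (continuous_coe) (fun z => z.im_pos)
  refine h.congr fun z => ?_
  simp

theorem isSmoothBounded_periodise (hΓ : DiscreteTopology Γ) (hχ : IsTestFunction χ) :
    IsSmoothBounded Γ (periodise Γ χ) where
  smooth := isSmooth_periodise hΓ hχ
  bounded := by
    obtain ⟨C, hC⟩ := hχ.isCompact_preimage.exists_bound_of_continuousOn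
      (FuchsianGreen.IsSmooth.continuous (isSmooth_periodise hΓ hχ)).continuousOn
    refine ⟨max C 0, fun z => ?_⟩
    -- An orbit either misses the support, or can be moved by invariance into a compact set, where
    -- the continuous function is bounded.
    by_cases h : ∃ t : transformationGroup Γ, χ ((t • z : ℍ) : ℂ) ≠ 0
    · obtain ⟨t, ht⟩ := h
      rw [← periodise_transformation χ t]
      exact (hC (t • z) (subset_tsupport χ ht)).trans (le_max_left C 0)
    · push Not at h
      simp [periodise, h]
  invariant := isInvariant_periodise Γ χ

/-- The hyperbolic Laplacian commutes with each transformation: the factor `|g'|²` from conformal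
covariance is `(Im gz / Im z)²`, which exchanges the weights `Im z²` and `Im (gz)²`. -/
theorem hypLaplacian_periodise (hΓ : DiscreteTopology Γ) (hχ : IsTestFunction χ) (z : ℍ) :
    hypLaplacian (periodise Γ χ) z =
      periodise Γ (fun p => p.im ^ 2 * Laplacian.laplacian χ p) z := by
  obtain ⟨S, hS, hS'⟩ := eventuallyEq_periodise hΓ hχ z.im_pos
  have h2 := hS' (fun p => p.im ^ 2 * Laplacian.laplacian χ p)
    (tsupport_mul_subset_right.trans (tsupport_laplacian_subset _))
  rw [ofComplex_apply] at h2
  have hc : ∀ t ∈ S, ContDiffAt ℝ 2 (fun q : ℂ => χ ((t • ofComplex q : ℍ) : ℂ)) z :=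
    fun t _ => (contDiffAt_comp_transformation hχ.smooth t z.im_pos).of_le two_le_infty
  rw [hypLaplacian, h2, (InnerProductSpace.laplacian_congr_nhds hS).self_of_nhds,
    laplacian_finset_sum S hc, Finset.mul_sum]
  refine Finset.sum_congr rfl fun t _ => ?_
  obtain ⟨γ, -, h⟩ := exists_smul_eq t
  simp only [h]
  rw [laplacian_comp_analytic (f := χ) (m := fun q : ℂ => ((γ • ofComplex q : ℍ) : ℂ))
    (analyticAt_sl_smul γ z.im_pos).1 (hχ.smooth.contDiffAt.of_le two_le_infty),
    (analyticAt_sl_smul γ z.im_pos).2, ofComplex_apply]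
  have := z.im_ne_zero
  rw [UpperHalfPlane.coe_im, UpperHalfPlane.coe_im]
  field_simp

/-! ### Integration over the upper half-plane and over the quotient -/

theorem lintegral_upperHalfPlane (F : ℍ → ℝ≥0∞) :
    ∫⁻ z, F z = ∫⁻ p in {p : ℂ | 0 < p.im}, F (ofComplex p) * ENNReal.ofReal (1 / p.im ^ 2) := by
  have hmp : MeasurePreserving UpperHalfPlane.coe (volume.comap UpperHalfPlane.coe)
      (volume.restrict (.range UpperHalfPlane.coe)) :=
    ⟨measurable_coe, by rw [measurableEmbedding_coe.map_comap]⟩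
  have hr : Set.range UpperHalfPlane.coe = {p : ℂ | 0 < p.im} := by
    ext p
    exact ⟨fun ⟨z, hz⟩ => hz ▸ z.im_pos, fun h => ⟨⟨p, h⟩, rfl⟩⟩
  rw [volume_def, lintegral_withDensity_eq_lintegral_mul_non_measurable, ← hr,
    ← hmp.lintegral_comp_emb measurableEmbedding_coe]
  · refine lintegral_congr fun z => ?_
    simp only [Pi.mul_apply, ofComplex_apply, mul_comm (F z)]
    congr 1
    rw [← ENNReal.ofReal_coe_nnreal]
    simp [NNReal.coe_mk]
  · refine Measurable.coe_nnreal_ennreal ?_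
    refine Measurable.pow_const (Measurable.const_div ?_ _) _
    exact (continuous_im.subtype_mk _).measurable
  · exact Filter.Eventually.of_forall fun z => ENNReal.coe_lt_top

theorem integral_upperHalfPlane (F : ℍ → ℝ) :
    ∫ z, F z = ∫ p in {p : ℂ | 0 < p.im}, F (ofComplex p) / p.im ^ 2 := by
  have hmp : MeasurePreserving UpperHalfPlane.coe (volume.comap UpperHalfPlane.coe)
      (volume.restrict (.range UpperHalfPlane.coe)) :=
    ⟨measurable_coe, by rw [measurableEmbedding_coe.map_comap]⟩
  have hr : Set.range UpperHalfPlane.coe = {p : ℂ | 0 < p.im} := by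
    ext p
    exact ⟨fun ⟨z, hz⟩ => hz ▸ z.im_pos, fun h => ⟨⟨p, h⟩, rfl⟩⟩
  rw [volume_def, integral_withDensity_eq_integral_smul, ← hr,
    ← hmp.integral_comp measurableEmbedding_coe]
  · refine integral_congr_ae (Filter.Eventually.of_forall fun z => ?_)
    simp [NNReal.smul_def, div_eq_inv_mul]
  · refine Measurable.pow_const (Measurable.const_div ?_ _) _
    exact (continuous_im.subtype_mk _).measurable

end

section

variable {Γ : Subgroup SL(2, ℝ)}

theorem centreCard_pos (Γ : Subgroup SL(2, ℝ)) : 0 < centreCard Γ :=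
  (Set.ncard_pos ((Set.toFinite _).inter_of_right _)).mpr ⟨1, Γ.one_mem, by simp⟩

theorem isFundamentalDomain_fundamentalSet (hΓ : IsCofinite Γ) :
    IsFundamentalDomain (transformationGroup Γ) (fundamentalSet Γ) (volume : Measure ℍ) := by
  rw [fundamentalSet, dif_pos hΓ.hasFundamentalDomain]
  exact hΓ.hasFundamentalDomain.ExistsIsFundamentalDomain.choose_spec

theorem isFiniteMeasure_quotVolume (hΓ : IsCofinite Γ) : IsFiniteMeasure (quotVolume Γ) :=
  ⟨hΓ.finite_volume⟩

theorem lintegral_quotVolume (F : ℍ → ℝ≥0∞) :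
    (centreCard Γ : ℝ≥0∞) * ∫⁻ z, F z ∂(quotVolume Γ) = ∫⁻ z in fundamentalSet Γ, F z := by
  rw [quotVolume, lintegral_smul_measure, smul_eq_mul, ← mul_assoc, ENNReal.mul_inv_cancel,
    one_mul]
  · exact_mod_cast (centreCard_pos Γ).ne'
  · exact ENNReal.natCast_ne_top _

theorem integral_quotVolume (F : ℍ → ℝ) :
    (centreCard Γ : ℝ) * ∫ z, F z ∂(quotVolume Γ) = ∫ z in fundamentalSet Γ, F z := by
  have : (centreCard Γ : ℝ) ≠ 0 := by exact_mod_cast (centreCard_pos Γ).ne'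
  rw [quotVolume, integral_smul_measure, smul_eq_mul, ENNReal.toReal_inv, ENNReal.toReal_natCast,
    mul_inv_cancel_left₀ this]

theorem lintegral_unfold (hΓ : IsCofinite Γ) {F : ℍ → ℝ≥0∞} (hF : Measurable F) :
    ∫⁻ z, F z = centreCard Γ *
      ∫⁻ z, (∑' t : transformationGroup Γ, F (t • z)) ∂(quotVolume Γ) := by
  have := countable_transformationGroup hΓ.discrete
  rw [lintegral_quotVolume, (isFundamentalDomain_fundamentalSet hΓ).lintegral_eq_tsum'',
    lintegral_tsum]
  exact fun t => (hF.comp (measurable_const_smul t)).aemeasurable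

theorem integral_unfold (hΓ : IsCofinite Γ) {F : ℍ → ℝ} (hF : Integrable F) (hm : Measurable F) :
    ∫ z, F z = centreCard Γ *
      ∫ z, (∑' t : transformationGroup Γ, F (t • z)) ∂(quotVolume Γ) := by
  have := countable_transformationGroup hΓ.discrete
  have hD := isFundamentalDomain_fundamentalSet hΓ
  rw [integral_quotVolume, hD.integral_eq_tsum'' F hF, integral_tsum]
  · exact fun t => (hm.comp (measurable_const_smul t)).aestronglyMeasurable
  · rw [← hD.lintegral_eq_tsum'' (fun z => ‖F z‖ₑ)]
    exact hF.2.ne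

/-- Unfolding. The sum runs over transformations rather than elements of `Γ`, so the normalisation
of the quotient measure appears as the factor `n`. Only the product `χ K` has to be integrable on
the half-plane. -/
theorem integral_periodise_mul (hΓ : IsCofinite Γ) {χ : ℂ → ℝ} (hχ : IsTestFunction χ)
    {K : ℍ → ℝ} (hK : IsInvariant Γ K) (hi : Integrable fun z : ℍ => χ z * K z)
    (hm : Measurable fun z : ℍ => χ z * K z) :
    (centreCard Γ : ℝ) * ∫ z, periodise Γ χ z * K z ∂(quotVolume Γ) = ∫ z : ℍ, χ z * K z := by
  rw [integral_unfold hΓ hi hm]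
  congr 1
  refine integral_congr_ae (Filter.Eventually.of_forall fun z => ?_)
  have hKt : ∀ t : transformationGroup Γ, K (t • z) = K z := fun t => by
    obtain ⟨γ, hγ, h⟩ := exists_smul_eq t
    rw [h, hK γ hγ]
  simp only [hKt]
  rw [tsum_mul_right, periodise, tsum_eq_finsum (hasFiniteSupport_periodise hΓ.discrete hχ z)]

/-- If the translates of `S` by the transformations induced by `Γ` are disjoint, integrals of
invariant functions over `S` are bounded by integrals over the quotient. -/
theorem setLIntegral_le_quotVolume (hΓ : IsCofinite Γ) {S S' : Set ℍ} (hS : MeasurableSet S)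
    (hinj : ∀ z ∈ S, ∀ t : transformationGroup Γ, t • z ∈ S → t = 1)
    (hS' : ∀ z, ∀ t : transformationGroup Γ, t • z ∈ S → z ∈ S')
    {F : ℍ → ℝ≥0∞} (hF : Measurable F)
    (hinv : ∀ z, ∀ t : transformationGroup Γ, F (t • z) = F z) :
    ∫⁻ z in S, F z ≤ centreCard Γ * ∫⁻ z in S', F z ∂(quotVolume Γ) := by
  rw [← lintegral_indicator hS, lintegral_unfold hΓ (hF.indicator hS)]
  refine mul_le_mul' le_rfl
    (le_trans (lintegral_mono (g := S'.indicator F) fun z => ?_) (lintegral_indicator_le _ _))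
  by_cases h : ∃ s : transformationGroup Γ, s • z ∈ S
  · obtain ⟨s, hs⟩ := h
    rw [tsum_eq_single s, Set.indicator_of_mem hs, hinv,
      Set.indicator_of_mem (hS' z s hs)]
    intro t hts
    refine Set.indicator_of_notMem (fun ht => hts ?_) _
    have := hinj _ hs (t * s⁻¹) (by simpa [mul_smul] using ht)
    exact mul_inv_eq_one.mp this
  · push Not at h
    simp [Set.indicator_of_notMem (h _)]

/-! ### The kernel of the Green operator -/

theorem eq_zero_of_integral_contDiff_mul_eq_zero {U : Set ℂ} (hU : IsOpen U) {f : ℂ → ℝ}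
    (hf : ContinuousOn f U)
    (h : ∀ χ : ℂ → ℝ, ContDiff ℝ ∞ χ → HasCompactSupport χ → tsupport χ ⊆ U →
      ∫ p, χ p * f p = 0) {p : ℂ} (hp : p ∈ U) : f p = 0 := by
  have h1 := hU.ae_eq_zero_of_integral_contDiff_smul_eq_zero (μ := (volume : Measure ℂ))
    (hf.locallyIntegrableOn hU.measurableSet) (by simpa using h)
  have h2 : f =ᵐ[volume.restrict U] fun _ => 0 :=
    (ae_restrict_iff' hU.measurableSet).mpr h1
  exact Measure.eqOn_open_of_ae_eq h2 hU hf continuousOn_const hp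

theorem continuous_mul_of_tsupport {X : Type*} [TopologicalSpace X] {χ K : X → ℝ}
    (hχ : Continuous χ) (hK : ∀ x ∈ tsupport χ, ContinuousAt K x) :
    Continuous fun x => χ x * K x := by
  rw [continuous_iff_continuousAt]
  intro x
  by_cases hx : x ∈ tsupport χ
  · exact hχ.continuousAt.mul (hK x hx)
  · have h0 : (fun x => χ x * K x) =ᶠ[𝓝 x] fun _ => 0 := by
      filter_upwards [(isClosed_tsupport χ).isOpen_compl.mem_nhds hx] with y hy
      rw [image_eq_zero_of_notMem_tsupport hy, zero_mul]
    exact continuousAt_const.congr h0.symm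

theorem tsupport_comp_coe_subset (χ : ℂ → ℝ) :
    tsupport (fun z : ℍ => χ z) ⊆ (fun z : ℍ => (z : ℂ)) ⁻¹' tsupport χ :=
  closure_minimal (fun _ hz => subset_tsupport χ hz)
    ((isClosed_tsupport χ).preimage continuous_coe)

theorem IsTestFunction.continuous_mul {χ : ℂ → ℝ} (hχ : IsTestFunction χ) {K : ℍ → ℝ}
    (hK : ∀ z : ℍ, (z : ℂ) ∈ tsupport χ → ContinuousAt K z) :
    Continuous (fun z : ℍ => χ z * K z) ∧ Integrable (fun z : ℍ => χ z * K z) := by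
  have hc : Continuous (fun z : ℍ => χ z * K z) :=
    continuous_mul_of_tsupport (hχ.smooth.continuous.comp continuous_coe)
      fun z hz => hK z (tsupport_comp_coe_subset χ hz)
  refine ⟨hc, hc.integrable_of_hasCompactSupport ?_⟩
  exact HasCompactSupport.mul_right
    (hχ.isCompact_preimage.of_isClosed_subset (isClosed_tsupport _) (tsupport_comp_coe_subset χ))

theorem IsTestFunction.integral_mul_eq {χ : ℂ → ℝ} (hχ : IsTestFunction χ) (K : ℍ → ℝ) :
    ∫ z : ℍ, χ z * K z = ∫ p : ℂ, χ p * (K (ofComplex p) / p.im ^ 2) := by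
  rw [integral_upperHalfPlane, ← setIntegral_eq_integral_of_forall_compl_eq_zero (s := {p : ℂ | 0 < p.im})
    (f := fun p : ℂ => χ p * (K (ofComplex p) / p.im ^ 2))]
  · refine setIntegral_congr_fun isOpen_im_pos.measurableSet fun p hp => ?_
    rw [ofComplex_apply_of_im_pos hp, mul_div_assoc]
  · intro p hp
    rw [image_eq_zero_of_notMem_tsupport fun h => hp (hχ.support h), zero_mul]

theorem FuchsianGreen.IsSmoothBounded.memLp {Γ : Subgroup SL(2, ℝ)} (hΓ : IsCofinite Γ) {f : ℍ → ℝ}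
    (hf : IsSmoothBounded Γ f) (p : ℝ≥0∞) : MemLp f p (quotVolume Γ) := by
  have := isFiniteMeasure_quotVolume hΓ
  obtain ⟨C, hC⟩ := hf.bounded
  exact MemLp.of_bound (IsSmooth.continuous hf.smooth).aestronglyMeasurable C
    (Filter.Eventually.of_forall hC)

end

section

variable {Γ : Subgroup SL(2, ℝ)} {gr : ℍ → ℍ → ℝ}

theorem FuchsianGreen.IsGreenFunction.memLp_integral (hΓ : IsCofinite Γ)
    (hgr : IsGreenFunction Γ gr) {f : ℍ → ℝ} (hf : IsSmoothBounded Γ f) :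
    MemLp (fun z => ∫ w, gr z w * f w ∂(quotVolume Γ)) 2 (quotVolume Γ) := by
  obtain ⟨G, -, hk⟩ := hgr.kernel
  have h := (hk f hf).2 (MemLp.toLp f (hf.memLp hΓ 2)) (MemLp.coeFn_toLp _)
  exact (memLp_congr_ae h).mp (Lp.memLp _)

/-- By self-adjointness `⟨f, G ΔP⟩ = ⟨G f, ΔP⟩`, and the defining equation of `G f` tested against
`P` gives `⟨f - mean f, P⟩`. In weak form: `G ΔP = P - mean P`. -/
theorem FuchsianGreen.IsGreenFunction.integral_mul_integral (hΓ : IsCofinite Γ)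
    (hgr : IsGreenFunction Γ gr) {f P : ℍ → ℝ} (hf : IsSmoothBounded Γ f)
    (hP : IsSmoothBounded Γ P) (hΔ : IsSmoothBounded Γ (hypLaplacian P)) :
    ∫ z, f z * ∫ w, gr z w * hypLaplacian P w ∂(quotVolume Γ) ∂(quotVolume Γ) =
      ∫ z, f z * P z ∂(quotVolume Γ) -
        1 / vol Γ * (∫ z, f z ∂(quotVolume Γ)) * ∫ z, P z ∂(quotVolume Γ) := by
  have := isFiniteMeasure_quotVolume hΓ
  obtain ⟨G, hG, hk⟩ := hgr.kernel
  set F : L2 Γ := MemLp.toLp f (hf.memLp hΓ 2) with hF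
  set Φ : L2 Γ := MemLp.toLp _ (hΔ.memLp hΓ 2) with hΦ
  have hFf : F =ᵐ[quotVolume Γ] f := MemLp.coeFn_toLp _
  have hΦf : Φ =ᵐ[quotVolume Γ] hypLaplacian P := MemLp.coeFn_toLp _
  have h0 : MemLp (fun z => f z - 1 / vol Γ * ∫ w, f w ∂(quotVolume Γ)) 2 (quotVolume Γ) :=
    (hf.memLp hΓ 2).sub (memLp_const _)
  have h1 := hG.laplacian f hf F (MemLp.toLp _ h0) hFf (MemLp.coeFn_toLp _) P hP hΔ.bounded
  have h2 : inner ℝ (G F) Φ = inner ℝ F (G Φ) := by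
    rw [← ContinuousLinearMap.adjoint_inner_left, ← ContinuousLinearMap.star_eq_adjoint,
      hG.selfAdjoint.star_eq]
  rw [L2.inner_def, L2.inner_def] at h2
  have h3 : ∫ z, inner ℝ (G F z) (Φ z) ∂(quotVolume Γ) =
      ∫ z, G F z * hypLaplacian P z ∂(quotVolume Γ) := by
    refine integral_congr_ae ?_
    filter_upwards [hΦf] with z hz
    rw [hz, RCLike.inner_apply, mul_comm]
    rfl
  have h4 : ∫ z, inner ℝ (F z) (G Φ z) ∂(quotVolume Γ) =
      ∫ z, f z * ∫ w, gr z w * hypLaplacian P w ∂(quotVolume Γ) ∂(quotVolume Γ) := by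
    refine integral_congr_ae ?_
    filter_upwards [hFf, (hk _ hΔ).2 Φ hΦf] with z hz hz'
    rw [hz, hz', RCLike.inner_apply, mul_comm]
    rfl
  rw [← h4, ← h2, h3, h1]
  have h5 : ∫ z, (MemLp.toLp _ h0 : L2 Γ) z * P z ∂(quotVolume Γ) =
      ∫ z, (f z * P z - 1 / vol Γ * (∫ w, f w ∂(quotVolume Γ)) * P z) ∂(quotVolume Γ) := by
    refine integral_congr_ae ?_
    filter_upwards [MemLp.coeFn_toLp h0] with z hz
    rw [hz]
    ring
  rw [h5, integral_sub, integral_const_mul]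
  · exact (hf.memLp hΓ 2).integrable_mul (hP.memLp hΓ 2)
  · exact ((hP.memLp hΓ 1).integrable le_rfl).const_mul _

/-! ### The Green function away from its singularities -/

theorem isOpen_forall_smul_ne {Γ : Subgroup SL(2, ℝ)} (hΓ : DiscreteTopology Γ) :
    IsOpen {x : ℍ × ℍ | ∀ t : transformationGroup Γ, t • x.2 ≠ x.1} := by
  rw [isOpen_iff_mem_nhds]
  rintro ⟨z₀, w₀⟩ h
  obtain ⟨K, hK, hz⟩ := exists_compact_mem_nhds z₀
  obtain ⟨K', hK', hw⟩ := exists_compact_mem_nhds w₀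
  have hfin := finite_transformation_inter hΓ hK' hK
  have h1 : ∀ᶠ x : ℍ × ℍ in 𝓝 (z₀, w₀), ∀ t ∈ hfin.toFinset, t • x.2 ≠ x.1 := by
    rw [Filter.eventually_all_finset]
    intro t _
    exact (isClosed_eq ((continuous_const_smul t).comp continuous_snd)
      continuous_fst).isOpen_compl.mem_nhds (h t)
  filter_upwards [h1, prod_mem_nhds hz hw] with x hx hxK t ht
  exact hx t (by simpa using ⟨x.2, hxK.2, ht ▸ hxK.1⟩) ht

theorem isOpen_forall_smul_notMem {Γ : Subgroup SL(2, ℝ)} (hΓ : DiscreteTopology Γ) {L : Set ℍ}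
    (hL : IsCompact L) : IsOpen {z : ℍ | ∀ t : transformationGroup Γ, t • z ∉ L} := by
  rw [isOpen_iff_mem_nhds]
  intro z₀ h
  obtain ⟨S, hS⟩ := exists_finset_smul_notMem hΓ hL z₀
  have h1 : ∀ᶠ z in 𝓝 z₀, ∀ t ∈ S, t • z ∉ L := by
    rw [Filter.eventually_all_finset]
    intro t _
    exact (continuous_const_smul t).continuousAt.eventually
      (hL.isClosed.isOpen_compl.mem_nhds (h t))
  filter_upwards [hS, h1] with z hz hz' t
  by_cases ht : t ∈ S
  · exact hz' t ht
  · exact hz t ht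

theorem forall_smul_ne_symm {Γ : Subgroup SL(2, ℝ)} {z w : ℍ}
    (h : ∀ t : transformationGroup Γ, t • z ≠ w) (t : transformationGroup Γ) : t • w ≠ z := by
  intro ht
  exact h t⁻¹ (by rw [← ht, inv_smul_smul])

end

section

variable {Γ : Subgroup SL(2, ℝ)} {gr : ℍ → ℍ → ℝ}

theorem FuchsianGreen.IsGreenFunction.contDiffAt (hΓ : IsCofinite Γ) (hgr : IsGreenFunction Γ gr)
    {p q : ℂ} (hp : 0 < p.im) (hq : 0 < q.im)
    (h : ∀ t : transformationGroup Γ, t • ofComplex q ≠ ofComplex p) :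
    ContDiffAt ℝ ∞ (fun x : ℂ × ℂ => gr (ofComplex x.1) (ofComplex x.2)) (p, q) := by
  refine (hgr.smooth).contDiffAt ?_
  have ho := isOpen_forall_smul_ne hΓ.discrete
  have hc : ContinuousAt (fun x : ℂ × ℂ => (ofComplex x.1, ofComplex x.2)) (p, q) :=
    ((tendsto_ofComplex hp).comp (continuous_fst.tendsto (p, q))).prodMk_nhds
      ((tendsto_ofComplex hq).comp (continuous_snd.tendsto (p, q)))
  filter_upwards [hc.eventually (ho.mem_nhds (x := (ofComplex p, ofComplex q)) h),
    continuous_fst.continuousAt.eventually (isOpen_im_pos.mem_nhds hp),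
    continuous_snd.continuousAt.eventually (isOpen_im_pos.mem_nhds hq)] with x hx h1 h2
  refine ⟨h1, h2, fun γ hγ heq => ?_⟩
  obtain ⟨t, ht⟩ := exists_transformation hγ
  exact hx t (by rw [ht, heq])

theorem FuchsianGreen.IsGreenFunction.continuousAt (hΓ : IsCofinite Γ)
    (hgr : IsGreenFunction Γ gr) {z w : ℍ} (h : ∀ t : transformationGroup Γ, t • w ≠ z) :
    ContinuousAt (fun x : ℍ × ℍ => gr x.1 x.2) (z, w) := by
  have h1 := (hgr.contDiffAt hΓ z.im_pos w.im_pos (by simpa using h)).continuousAt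
  have h2 : ContinuousAt (fun x : ℍ × ℍ => ((x.1 : ℂ), (x.2 : ℂ))) (z, w) := by fun_prop
  refine (ContinuousAt.comp (x := (z, w)) (g := fun x : ℂ × ℂ => gr (ofComplex x.1) (ofComplex x.2))
    h1 h2).congr ?_
  filter_upwards with x
  simp

theorem FuchsianGreen.IsGreenFunction.continuousAt_right (hΓ : IsCofinite Γ)
    (hgr : IsGreenFunction Γ gr) {z w : ℍ} (h : ∀ t : transformationGroup Γ, t • w ≠ z) :
    ContinuousAt (gr z) w :=
  ContinuousAt.comp (f := fun w => (z, w)) (g := fun x : ℍ × ℍ => gr x.1 x.2)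
    (hgr.continuousAt hΓ h) (by fun_prop)

/-- The integral of the Green function against the periodisation of a test function. -/
theorem FuchsianGreen.IsGreenFunction.integral_mul_periodise (hΓ : IsCofinite Γ)
    (hgr : IsGreenFunction Γ gr) {χ : ℂ → ℝ} (hχ : IsTestFunction χ) {z : ℍ}
    (hz : ∀ t : transformationGroup Γ, ((t • z : ℍ) : ℂ) ∉ tsupport χ) :
    (centreCard Γ : ℝ) * ∫ w, gr z w * periodise Γ χ w ∂(quotVolume Γ) =
      ∫ p : ℂ, χ p * (gr z (ofComplex p) / p.im ^ 2) := by
  have hc := hχ.continuous_mul (K := gr z) fun w hw => hgr.continuousAt_right hΓ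
    (forall_smul_ne_symm fun t ht => hz t (by rw [ht]; exact hw))
  rw [← hχ.integral_mul_eq, ← integral_periodise_mul hΓ hχ (fun γ hγ w => hgr.invariant_right γ hγ z w)
    hc.2 hc.1.measurable]
  simp_rw [mul_comm]

theorem integral_periodise (hΓ : IsCofinite Γ) {χ : ℂ → ℝ} (hχ : IsTestFunction χ) :
    (centreCard Γ : ℝ) * ∫ w, periodise Γ χ w ∂(quotVolume Γ) = ∫ p : ℂ, χ p / p.im ^ 2 := by
  have hc := hχ.continuous_mul (K := fun _ => 1) fun w _ => continuousAt_const
  have h := integral_periodise_mul hΓ hχ (K := fun _ => 1) (fun _ _ _ => rfl) hc.2 hc.1.measurable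
  rw [hχ.integral_mul_eq (fun _ => 1)] at h
  simpa [div_eq_mul_inv] using h

/-- For `P` the periodisation of `χ`, the identity `G ΔP = P - mean P` holds weakly. Where the orbit
of `z` avoids the support of `Δχ`, both sides are continuous in `z`, so it holds pointwise;
unfolding turns it into an integral over the plane. -/
theorem FuchsianGreen.IsGreenFunction.integral_mul_laplacian (hΓ : IsCofinite Γ)
    (hgr : IsGreenFunction Γ gr) {χ : ℂ → ℝ} (hχ : IsTestFunction χ) {z : ℍ}
    (hz : ∀ t : transformationGroup Γ, ((t • z : ℍ) : ℂ) ∉ tsupport (Laplacian.laplacian χ)) :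
    ∫ p : ℂ, gr z (ofComplex p) * Laplacian.laplacian χ p =
      centreCard Γ * periodise Γ χ z - 1 / vol Γ * ∫ p : ℂ, χ p / p.im ^ 2 := by
  have hn : (centreCard Γ : ℝ) ≠ 0 := by exact_mod_cast (centreCard_pos Γ).ne'
  have hl := hχ.laplacian
  have hφ := hl.mul_left contDiff_im_sq.contDiffOn
  have hsub : tsupport (fun p : ℂ => p.im ^ 2 * Laplacian.laplacian χ p) ⊆
    tsupport (Laplacian.laplacian χ) := tsupport_mul_subset_right
  have hΔ : hypLaplacian (periodise Γ χ) =
      periodise Γ (fun p => p.im ^ 2 * Laplacian.laplacian χ p) :=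
    funext (hypLaplacian_periodise hΓ.discrete hχ)
  set U : Set ℍ := {z | ∀ t : transformationGroup Γ,
    t • z ∉ (fun z : ℍ => (z : ℂ)) ⁻¹' tsupport (Laplacian.laplacian χ)}
  have hU : IsOpen U := isOpen_forall_smul_notMem hΓ.discrete hl.isCompact_preimage
  set k : ℍ → ℝ := fun z => ∫ w, gr z w * hypLaplacian (periodise Γ χ) w ∂(quotVolume Γ) with hk
  have hkU : ∀ z ∈ U, centreCard Γ * k z =
      ∫ p : ℂ, gr z (ofComplex p) * Laplacian.laplacian χ p := by
    intro z hz
    simp only [hk]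
    rw [hΔ, hgr.integral_mul_periodise hΓ hφ fun t ht => hz t (hsub ht)]
    congr 1 with p
    by_cases hp : p ∈ tsupport (Laplacian.laplacian χ)
    · have hp0 : 0 < p.im := hl.support hp
      field_simp
    · simp [image_eq_zero_of_notMem_tsupport hp]
  have hkc : ContinuousOn k U := by
    have : ContinuousOn (fun z => ∫ p : ℂ, gr z (ofComplex p) * Laplacian.laplacian χ p) U := by
      refine continuousOn_integral_of_compact_support (k := tsupport (Laplacian.laplacian χ))
        hl.compact ?_ ?_
      · rintro ⟨z, p⟩ ⟨hz, -⟩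
        refine ContinuousAt.continuousWithinAt ?_
        by_cases hp : p ∈ tsupport (Laplacian.laplacian χ)
        · have h1 : ContinuousAt (fun x : ℍ × ℂ => (x.1, ofComplex x.2)) (z, p) :=
            continuous_fst.continuousAt.prodMk_nhds
              ((tendsto_ofComplex (hl.support hp)).comp continuous_snd.continuousAt)
          have h2 : ContinuousAt (fun x : ℍ × ℂ => gr x.1 (ofComplex x.2)) (z, p) := by
            refine ContinuousAt.comp (g := fun x : ℍ × ℍ => gr x.1 x.2) ?_ h1
            refine hgr.continuousAt hΓ (forall_smul_ne_symm fun t ht => hz t ?_)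
            rw [ht, Set.mem_preimage, ofComplex_apply_of_im_pos (hl.support hp)]
            exact hp
          exact h2.mul (hl.smooth.continuous.continuousAt.comp continuous_snd.continuousAt)
        · refine ContinuousAt.congr (f := fun _ => 0) continuousAt_const ?_
          filter_upwards [continuous_snd.continuousAt.eventually
            ((isClosed_tsupport _).isOpen_compl.mem_nhds hp)] with x hx
          simp [Function.uncurry, image_eq_zero_of_notMem_tsupport hx]
      · intro z p _ hp
        rw [image_eq_zero_of_notMem_tsupport hp, mul_zero]
    refine (this.const_smul (centreCard Γ : ℝ)⁻¹).congr fun z hz => ?_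
    simp only [Pi.smul_apply, smul_eq_mul]
    rw [← hkU z hz, inv_mul_cancel_left₀ hn]
  set m : ℝ := 1 / vol Γ * ∫ z, periodise Γ χ z ∂(quotVolume Γ) with hm
  have hP := isSmoothBounded_periodise hΓ.discrete hχ
  have hPΔ : IsSmoothBounded Γ (hypLaplacian (periodise Γ χ)) :=
    hΔ ▸ isSmoothBounded_periodise hΓ.discrete hφ
  set K : ℍ → ℝ := fun z => k z - periodise Γ χ z + m with hKdef
  have hKc : ContinuousOn K U :=
    (hkc.sub (IsSmooth.continuous hP.smooth).continuousOn).add continuousOn_const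
  have hKinv : IsInvariant Γ K := by
    intro γ hγ z
    simp only [hKdef, hk, hP.invariant γ hγ z, hgr.invariant_left γ hγ]
  -- `K` is the defect in `G ΔP = P - mean P`. It is orthogonal to periodised test functions, and
  -- unfolding yields orthogonality to the test functions themselves.
  have key : ∀ ρ : ℂ → ℝ, IsTestFunction ρ → (∀ z : ℍ, (z : ℂ) ∈ tsupport ρ → z ∈ U) →
      ∫ p : ℂ, ρ p * (K (ofComplex p) / p.im ^ 2) = 0 := by
    intro ρ hρ hρU
    have hf := isSmoothBounded_periodise hΓ.discrete hρ
    have hc := hρ.continuous_mul (K := K) fun z hz => hKc.continuousAt (hU.mem_nhds (hρU z hz))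
    have := isFiniteMeasure_quotVolume hΓ
    have i1 : Integrable (fun z => periodise Γ ρ z * k z) (quotVolume Γ) :=
      (hf.memLp hΓ 2).integrable_mul (hgr.memLp_integral hΓ hPΔ)
    have i2 : Integrable (fun z => periodise Γ ρ z * periodise Γ χ z) (quotVolume Γ) :=
      (hf.memLp hΓ 2).integrable_mul (hP.memLp hΓ 2)
    have i3 : Integrable (periodise Γ ρ) (quotVolume Γ) := (hf.memLp hΓ 1).integrable le_rfl
    have h1 := hgr.integral_mul_integral hΓ hf hP hPΔ
    rw [← hρ.integral_mul_eq, ← integral_periodise_mul hΓ hρ hKinv hc.2 hc.1.measurable]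
    have : ∀ z, periodise Γ ρ z * K z = periodise Γ ρ z * k z - periodise Γ ρ z * periodise Γ χ z
        + periodise Γ ρ z * m := fun z => by simp only [hKdef]; ring
    have i12 : Integrable (fun z => periodise Γ ρ z * k z - periodise Γ ρ z * periodise Γ χ z)
      (quotVolume Γ) := i1.sub i2
    simp_rw [this]
    rw [integral_add i12 (i3.mul_const m), integral_sub i1 i2, integral_mul_const, h1, hm]
    ring
  have hzU : z ∈ U := hz
  have hopen : IsOpen {p : ℂ | 0 < p.im ∧ ofComplex p ∈ U} := by
    rw [isOpen_iff_mem_nhds]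
    rintro p ⟨hp, hpU⟩
    filter_upwards [isOpen_im_pos.mem_nhds hp,
      (tendsto_ofComplex hp).eventually (hU.mem_nhds hpU)] with q h1 h2 using ⟨h1, h2⟩
  have h0 := eq_zero_of_integral_contDiff_mul_eq_zero hopen
    (f := fun p => K (ofComplex p) / p.im ^ 2) ?_ ?_ (p := z) ⟨z.im_pos, by simpa using hzU⟩
  · have := z.im_ne_zero
    simp only [ofComplex_apply, coe_im, div_eq_zero_iff, ne_eq, OfNat.ofNat_ne_zero,
      not_false_eq_true, pow_eq_zero_iff, this, or_false, hKdef] at h0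
    rw [← hkU z hzU, ← integral_periodise hΓ hχ]
    rw [hm] at h0
    linear_combination (centreCard Γ : ℝ) * h0
  · rintro p ⟨hp, hpU⟩
    refine ContinuousAt.continuousWithinAt (ContinuousAt.div ?_ ?_ (pow_pos hp 2).ne')
    · exact (hKc.continuousAt (hU.mem_nhds hpU)).tendsto.comp (tendsto_ofComplex hp)
    · exact (Complex.continuous_im.pow 2).continuousAt
  · intro ρ h1 h2 h3
    exact key ρ ⟨h1, h2, fun p hp => (h3 hp).1⟩ fun w hw => by simpa using (h3 hw).2

/-! ### Harmonicity and the strength of the singularities -/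

theorem contDiffAt_log_im {p : ℂ} (hp : 0 < p.im) :
    ContDiffAt ℝ ∞ (fun q : ℂ => Real.log q.im) p :=
  (Complex.imCLM.contDiff.contDiffAt).log hp.ne'

theorem laplacian_log_im {p : ℂ} (hp : 0 < p.im) :
    Laplacian.laplacian (fun q : ℂ => Real.log q.im) p = -(1 / p.im ^ 2) := by
  have hd : ∀ q : ℂ, 0 < q.im →
      HasFDerivAt (fun q : ℂ => Real.log q.im) (q.im⁻¹ • Complex.imCLM) q :=
    fun q hq => (Real.hasDerivAt_log hq.ne').comp_hasFDerivAt q Complex.imCLM.hasFDerivAt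
  have hf : fderiv ℝ (fun q : ℂ => Real.log q.im) =ᶠ[𝓝 p] fun q => q.im⁻¹ • Complex.imCLM := by
    filter_upwards [isOpen_im_pos.mem_nhds hp] with q hq using (hd q hq).fderiv
  have h2 : HasFDerivAt (fun q : ℂ => q.im⁻¹) (-(p.im ^ 2)⁻¹ • Complex.imCLM) p :=
    (hasDerivAt_inv hp.ne').comp_hasFDerivAt p Complex.imCLM.hasFDerivAt
  rw [InnerProductSpace.laplacian_eq_iteratedFDeriv_complexPlane]
  simp only [iteratedFDeriv_two_apply]
  rw [hf.fderiv_eq, (h2.smul_const Complex.imCLM).fderiv]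
  simp

theorem ContDiffOn.continuousOn_laplacian {g : ℂ → ℝ} {U : Set ℂ} (hU : IsOpen U)
    (hg : ContDiffOn ℝ ∞ g U) : ContinuousOn (Laplacian.laplacian g) U := by
  rw [InnerProductSpace.laplacian_eq_iteratedFDeriv_complexPlane]
  intro p hp
  have h2 : ContinuousAt (iteratedFDeriv ℝ 2 g) p :=
    ((hg.contDiffAt (hU.mem_nhds hp)).iteratedFDeriv_right (m := 0) (i := 2)
      (by norm_cast)).continuousAt
  have key : ∀ v : Fin 2 → ℂ, ContinuousAt (fun x => iteratedFDeriv ℝ 2 g x v) p := fun v =>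
    (ContinuousMultilinearMap.apply ℝ (fun _ : Fin 2 => ℂ) ℝ v).continuous.continuousAt.comp h2
  exact ((key _).add (key _)).continuousWithinAt

theorem harmonicAt_comp_analytic {f : ℂ → ℝ} {m : ℂ → ℂ} {z : ℂ} (hm : AnalyticAt ℂ m z)
    (hf : InnerProductSpace.HarmonicAt f (m z)) :
    InnerProductSpace.HarmonicAt (fun p => f (m p)) z := by
  refine ⟨hf.1.comp z (hm.contDiffAt.restrict_scalars ℝ), ?_⟩
  filter_upwards [hm.eventually_analyticAt, hm.continuousAt.eventually hf.eventually] with p hp hfp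
  rw [laplacian_comp_analytic hp hfp.1, hfp.2.self_of_nhds]
  simp

end

section

variable {Γ : Subgroup SL(2, ℝ)} {gr : ℍ → ℍ → ℝ}

theorem FuchsianGreen.IsGreenFunction.contDiffAt_right (hΓ : IsCofinite Γ)
    (hgr : IsGreenFunction Γ gr) {z : ℍ} {p : ℂ} (hp : 0 < p.im)
    (h : ∀ t : transformationGroup Γ, t • z ≠ ofComplex p) :
    ContDiffAt ℝ ∞ (fun p : ℂ => gr z (ofComplex p) - 1 / vol Γ * Real.log p.im) p := by
  refine ContDiffAt.sub ?_ (contDiffAt_const.mul (contDiffAt_log_im hp))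
  have h1 := hgr.contDiffAt hΓ z.im_pos hp (by simpa using forall_smul_ne_symm h)
  have h2 := ContDiffAt.comp (n := ∞) (f := fun p : ℂ => ((z : ℂ), p))
    (g := fun x : ℂ × ℂ => gr (ofComplex x.1) (ofComplex x.2)) p h1
    (contDiffAt_const.prodMk contDiffAt_id)
  refine h2.congr_of_eventuallyEq (Filter.Eventually.of_forall fun q => ?_)
  simp

theorem isOpen_compl_orbit (hΓ : DiscreteTopology Γ) (z : ℍ) :
    IsOpen {p : ℂ | 0 < p.im ∧ ∀ t : transformationGroup Γ, t • z ≠ ofComplex p} := by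
  rw [isOpen_iff_mem_nhds]
  rintro p ⟨hp, h⟩
  have h1 := (isOpen_forall_smul_ne hΓ).mem_nhds (x := (ofComplex p, z)) h
  have h2 : ContinuousAt (fun q : ℂ => (ofComplex q, z)) p :=
    Filter.Tendsto.prodMk_nhds (tendsto_ofComplex hp) tendsto_const_nhds
  filter_upwards [isOpen_im_pos.mem_nhds hp, h2.eventually h1] with q hq hq' using ⟨hq, hq'⟩

theorem integral_log_im_mul_laplacian {χ : ℂ → ℝ} (hχ : IsTestFunction χ) :
    ∫ p : ℂ, Real.log p.im * Laplacian.laplacian χ p = -∫ p : ℂ, χ p / p.im ^ 2 := by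
  rw [integral_mul_laplacian_eq isOpen_im_pos (g := fun p : ℂ => Real.log p.im)
    (fun p hp => ((contDiffAt_log_im hp).of_le two_le_infty).contDiffWithinAt)
    (hχ.smooth.of_le two_le_infty) hχ.compact hχ.support, ← integral_neg]
  refine integral_congr_ae (Filter.Eventually.of_forall fun p => ?_)
  by_cases hp : p ∈ tsupport χ
  · simp only [laplacian_log_im (hχ.support hp)]
    ring
  · simp [image_eq_zero_of_notMem_tsupport hp]

/-- Since `Δ log y = -1/y²` in the Euclidean sense, subtracting `(1/vol) log y` removes the constant
background term and leaves only the point masses. -/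
theorem FuchsianGreen.IsGreenFunction.integral_sub_log_mul_laplacian (hΓ : IsCofinite Γ)
    (hgr : IsGreenFunction Γ gr) {χ : ℂ → ℝ} (hχ : IsTestFunction χ) {z : ℍ}
    (hz : ∀ t : transformationGroup Γ, ((t • z : ℍ) : ℂ) ∉ tsupport (Laplacian.laplacian χ)) :
    ∫ p : ℂ, (gr z (ofComplex p) - 1 / vol Γ * Real.log p.im) * Laplacian.laplacian χ p =
      centreCard Γ * periodise Γ χ z := by
  have hl := hχ.laplacian
  have hi : ∀ f : ℂ → ℝ, (∀ p ∈ tsupport (Laplacian.laplacian χ), ContinuousAt f p) →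
      Integrable fun p => f p * Laplacian.laplacian χ p := fun f hf => by
    simp_rw [mul_comm (f _)]
    exact (continuous_mul_of_tsupport hl.smooth.continuous hf).integrable_of_hasCompactSupport
      hl.compact.mul_right
  have i1 : Integrable fun p => gr z (ofComplex p) * Laplacian.laplacian χ p := by
    refine hi _ fun p hp => ?_
    refine ContinuousAt.comp (f := ofComplex) (g := gr z) (hgr.continuousAt_right hΓ
      (forall_smul_ne_symm fun t ht => hz t ?_)) (tendsto_ofComplex (hl.support hp))
    rw [ht, ofComplex_apply_of_im_pos (hl.support hp)]
    exact hp
  have i2 : Integrable fun p : ℂ => 1 / vol Γ * (Real.log p.im * Laplacian.laplacian χ p) :=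
    (hi _ fun p hp => (contDiffAt_log_im (hl.support hp)).continuousAt).const_mul _
  simp_rw [sub_mul, mul_assoc]
  rw [integral_sub i1 i2, hgr.integral_mul_laplacian hΓ hχ hz, integral_const_mul,
    integral_log_im_mul_laplacian hχ]
  ring

theorem periodise_eq_zero {χ : ℂ → ℝ} {z : ℍ}
    (h : ∀ t : transformationGroup Γ, ((t • z : ℍ) : ℂ) ∉ tsupport χ) : periodise Γ χ z = 0 := by
  rw [periodise, finsum_congr fun t => image_eq_zero_of_notMem_tsupport (h t), finsum_zero]

/-- The Green function is harmonic in each variable up to a multiple of `log y`. -/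
theorem FuchsianGreen.IsGreenFunction.harmonicAt_sub_log (hΓ : IsCofinite Γ)
    (hgr : IsGreenFunction Γ gr) {z : ℍ} {p : ℂ} (hp : 0 < p.im)
    (h : ∀ t : transformationGroup Γ, t • z ≠ ofComplex p) :
    InnerProductSpace.HarmonicAt
      (fun p : ℂ => gr z (ofComplex p) - 1 / vol Γ * Real.log p.im) p := by
  refine ⟨(hgr.contDiffAt_right hΓ hp h).of_le two_le_infty, ?_⟩
  have hU := isOpen_compl_orbit hΓ.discrete z
  have hc : ContDiffOn ℝ ∞ (fun p : ℂ => gr z (ofComplex p) - 1 / vol Γ * Real.log p.im)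
      {p : ℂ | 0 < p.im ∧ ∀ t : transformationGroup Γ, t • z ≠ ofComplex p} :=
    fun q hq => (hgr.contDiffAt_right hΓ hq.1 hq.2).contDiffWithinAt
  filter_upwards [hU.mem_nhds ⟨hp, h⟩] with q hq
  -- The function is already smooth off the orbit, so vanishing of its Laplacian against test
  -- functions gives pointwise vanishing.
  refine eq_zero_of_integral_contDiff_mul_eq_zero hU (hc.continuousOn_laplacian hU) ?_ hq
  intro χ h1 h2 h3
  have hχ : IsTestFunction χ := ⟨h1, h2, fun p hp => (h3 hp).1⟩
  have hz : ∀ t : transformationGroup Γ, ((t • z : ℍ) : ℂ) ∉ tsupport χ := fun t ht =>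
    (h3 ht).2 t (by simp)
  simp_rw [mul_comm (χ _)]
  rw [← integral_mul_laplacian_eq hU (hc.of_le two_le_infty) (h1.of_le two_le_infty) h2 h3,
    hgr.integral_sub_log_mul_laplacian hΓ hχ fun t ht => hz t (tsupport_laplacian_subset χ ht),
    periodise_eq_zero hz, mul_zero]

/-- Holomorphic substitution preserves harmonicity, and `log Im(σp) = log Im p - 2 log|cp + d|`,
whose last term is harmonic. Thus the height in the cusp coordinate may replace the original one. -/
theorem FuchsianGreen.IsGreenFunction.harmonicAt_smul (hΓ : IsCofinite Γ)
    (hgr : IsGreenFunction Γ gr) (σ : SL(2, ℝ)) {w : ℍ} {p : ℂ} (hp : 0 < p.im)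
    (h : ∀ t : transformationGroup Γ, t • w ≠ σ • ofComplex p) :
    InnerProductSpace.HarmonicAt
      (fun p : ℂ => gr w (σ • ofComplex p) - 1 / vol Γ * Real.log p.im) p := by
  have hm := (analyticAt_sl_smul σ hp).1
  have h1 := harmonicAt_comp_analytic hm (hgr.harmonicAt_sub_log hΓ (z := w)
    (p := ((σ • ofComplex p : ℍ) : ℂ)) (σ • ofComplex p).im_pos (by simpa using h))
  have hd : ((σ 1 0 : ℂ) * p + σ 1 1) ≠ 0 := denom_ne_zero σ ⟨p, hp⟩
  have h2 : InnerProductSpace.HarmonicAt (fun q : ℂ => Real.log ‖(σ 1 0 : ℂ) * q + σ 1 1‖) p :=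
    AnalyticAt.harmonicAt_log_norm (by fun_prop) hd
  have h3 := h1.add (h2.const_smul (c := -(2 / vol Γ)))
  refine (InnerProductSpace.harmonicAt_congr_nhds ?_).mp h3
  have hne : ∀ᶠ q : ℂ in 𝓝 p, ((σ 1 0 : ℂ) * q + σ 1 1) ≠ 0 :=
    ContinuousAt.eventually_ne (by fun_prop) hd
  filter_upwards [isOpen_im_pos.mem_nhds hp, hne] with q hq hq'
  simp only [Pi.add_apply, Pi.smul_apply, smul_eq_mul, ofComplex_apply, coe_im]
  rw [im_sl_smul, ofComplex_apply_of_im_pos hq]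
  change _ - _ * Real.log (q.im / ‖(σ 1 0 : ℂ) * q + σ 1 1‖ ^ 2) + _ = _
  rw [Real.log_div (ne_of_gt hq) (pow_ne_zero 2 (norm_ne_zero_iff.mpr hq')), Real.log_pow]
  push_cast
  ring

theorem exists_ball_orbit (hΓ : DiscreteTopology Γ) (z : ℍ) :
    ∃ R > 0, Metric.ball (z : ℂ) R ⊆ {p : ℂ | 0 < p.im} ∧
      ∀ t : transformationGroup Γ, t • z ≠ z → ((t • z : ℍ) : ℂ) ∉ Metric.ball (z : ℂ) R := by
  obtain ⟨L, hL, hz⟩ := exists_compact_mem_nhds z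
  have hfin := finite_transformation_inter hΓ (isCompact_singleton (x := z)) hL
  have h1 : ∀ᶠ p in 𝓝 (z : ℂ), ∀ t ∈ hfin.toFinset, t • z ≠ z → ((t • z : ℍ) : ℂ) ≠ p := by
    rw [Filter.eventually_all_finset]
    intro t _
    by_cases h : t • z = z
    · simp [h]
    · have : ((t • z : ℍ) : ℂ) ≠ z := fun h' => h (UpperHalfPlane.ext h')
      filter_upwards [isOpen_ne.mem_nhds this.symm] with p hp _ using hp.symm
  have h2 : ∀ᶠ p in 𝓝 (z : ℂ), ofComplex p ∈ L := by
    have := tendsto_ofComplex z.im_pos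
    rw [ofComplex_apply] at this
    exact this.eventually hz
  have h3 : ∀ᶠ p in 𝓝 (z : ℂ), 0 < p.im := isOpen_im_pos.mem_nhds z.im_pos
  obtain ⟨R, hR, hball⟩ := Metric.eventually_nhds_iff_ball.mp (h1.and (h2.and h3))
  refine ⟨R, hR, fun p hp => (hball p hp).2.2, fun t ht hmem => ?_⟩
  obtain ⟨h1, h2, -⟩ := hball _ hmem
  rw [ofComplex_apply] at h2
  exact h1 t (by simpa using h2) ht rfl

/-- At a point with trivial stabiliser the logarithmic singularity of the Green function has
coefficient `#(Γ ∩ {±1}) / 2π`. -/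
theorem FuchsianGreen.IsGreenFunction.exists_abs_sub_log_le (hΓ : IsCofinite Γ)
    (hgr : IsGreenFunction Γ gr) {z : ℍ} (hz : ∀ t : transformationGroup Γ, t • z = z → t = 1) :
    ∃ D, ∀ᶠ p in 𝓝[≠] (z : ℂ),
      |gr z (ofComplex p) - centreCard Γ * (1 / (2 * Real.pi)) * Real.log ‖p - z‖| ≤ D := by
  obtain ⟨c, hc⟩ := hgr.log_singularity z
  obtain ⟨C, hC⟩ := hc.bound
  have ht : Filter.Tendsto ofComplex (𝓝[≠] (z : ℂ)) (𝓝[≠] z) := by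
    have := tendsto_ofComplex z.im_pos
    rw [ofComplex_apply] at this
    refine tendsto_nhdsWithin_iff.mpr ⟨this.mono_left nhdsWithin_le_nhds, ?_⟩
    filter_upwards [self_mem_nhdsWithin,
      mem_nhdsWithin_of_mem_nhds (isOpen_im_pos.mem_nhds z.im_pos)] with p hp hp' heq
    refine hp ?_
    rw [Set.mem_singleton_iff, ← heq, ofComplex_apply_of_im_pos hp']
  have hgz : ∀ᶠ p in 𝓝[≠] (z : ℂ), |gr z (ofComplex p) - c * Real.log ‖p - z‖| ≤ C := by
    filter_upwards [ht.eventually hC,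
      mem_nhdsWithin_of_mem_nhds (isOpen_im_pos.mem_nhds z.im_pos)] with p hp hp'
    rw [hgr.symm]
    simpa [ofComplex_apply_of_im_pos hp'] using hp
  have hlog : ∀ᶠ p in 𝓝[≠] (z : ℂ), |1 / vol Γ * Real.log p.im| ≤
      |1 / vol Γ * Real.log z.im| + 1 := by
    have h1 : ContinuousAt (fun p : ℂ => |1 / vol Γ * Real.log p.im|) z :=
      (continuousAt_const.mul (contDiffAt_log_im z.im_pos).continuousAt).abs
    exact Filter.Eventually.filter_mono nhdsWithin_le_nhds
      ((h1.eventually (gt_mem_nhds (lt_add_one _))).mono fun p hp => hp.le)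
  obtain ⟨R₁, hR₁, him, horb⟩ := exists_ball_orbit hΓ.discrete z
  obtain ⟨R₂, hR₂, hbd⟩ := Metric.eventually_nhds_iff_ball.mp
    (eventually_nhdsWithin_iff.mp (hgz.and hlog))
  have hsub : Metric.ball (z : ℂ) (min R₁ R₂) ⊆ Metric.ball (z : ℂ) R₁ :=
    Metric.ball_subset_ball (min_le_left _ _)
  -- A cutoff equal to `1` near `z` and supported near `z` has periodisation `1` at `z`, because
  -- only the identity contributes. The mass is therefore `n`, whence `2πc = n`.
  have key := eq_of_integral_mul_laplacian_eq (w := z) (R := min R₁ R₂) (c := c)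
    (D := C + (|1 / vol Γ * Real.log z.im| + 1)) (κ := centreCard Γ)
    (g := fun p : ℂ => gr z (ofComplex p) - 1 / vol Γ * Real.log p.im) (lt_min hR₁ hR₂) ?_ ?_ ?_
  · refine ⟨C, hgz.mono fun p hp => ?_⟩
    rwa [key, show 2 * Real.pi * c * (1 / (2 * Real.pi)) = c by field_simp]
  · rintro p ⟨hp, hpz⟩
    refine (hgr.contDiffAt_right hΓ (him (hsub hp)) fun t ht => ?_).continuousAt.continuousWithinAt
    have hp' : ((t • z : ℍ) : ℂ) = p := by rw [ht, ofComplex_apply_of_im_pos (him (hsub hp))]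
    refine horb t (fun h => hpz ?_) (hp' ▸ hsub hp)
    rw [← hp', h]
    rfl
  · rintro p ⟨hp, hpz⟩
    obtain ⟨h1, h2⟩ := hbd p (Metric.ball_subset_ball (min_le_right _ _) hp) hpz
    calc _ = |(gr z (ofComplex p) - c * Real.log ‖p - z‖) - 1 / vol Γ * Real.log p.im| := by
          congr 1; ring
      _ ≤ _ := (abs_sub _ _).trans (add_le_add h1 h2)
  · intro χ h1 h2 h3 h4
    have hχ : IsTestFunction χ := ⟨h1, h2, (h3.trans hsub).trans him⟩
    have hout : ∀ t : transformationGroup Γ, t ≠ 1 → ((t • z : ℍ) : ℂ) ∉ tsupport χ :=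
      fun t ht hmem => horb t (fun h => ht (hz t h)) (hsub (h3 hmem))
    have h5 : (z : ℂ) ∉ tsupport (Laplacian.laplacian χ) := by
      rw [notMem_tsupport_iff_eventuallyEq]
      have h6 : χ =ᶠ[𝓝 (z : ℂ)] fun _ => 1 := h4
      filter_upwards [InnerProductSpace.laplacian_congr_nhds h6] with p hp
      rw [hp]
      simp
    rw [hgr.integral_sub_log_mul_laplacian hΓ hχ, periodise, finsum_eq_single _ 1, one_smul,
      h4.self_of_nhds, mul_one]
    · exact fun t ht => image_eq_zero_of_notMem_tsupport (hout t ht)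
    · intro t
      by_cases ht : t = 1
      · rwa [ht, one_smul]
      · exact fun hmem => hout t ht (tsupport_laplacian_subset χ hmem)

/-! ### Geometry of the cusps -/

theorem u_smul_smul (g : SL(2, ℝ)) (z w : ℍ) : u (g • z) (g • w) = u z w := by
  simp [u]

theorem u_eq (z w : ℍ) : u z w = 1 + ‖(z : ℂ) - w‖ ^ 2 / (2 * z.im * w.im) := by
  rw [u, UpperHalfPlane.cosh_dist, dist_eq_norm]

/-- Hyperbolic distance is at least the logarithm of the ratio of heights, and `δ + √(δ² - 1) = exp
(arcosh δ)`. Algebraically, it is the larger root of `s² - 2δs + 1`, the other root being `2δ - s`.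
-/
theorem le_u_of_im_ratio {δ : ℝ} (hδ : 1 < δ) {z w : ℍ}
    (h : (δ + √(δ ^ 2 - 1)) * w.im ≤ z.im) : δ ≤ u z w := by
  set s := δ + √(δ ^ 2 - 1) with hs
  have hsq : √(δ ^ 2 - 1) ^ 2 = δ ^ 2 - 1 := Real.sq_sqrt (by nlinarith)
  have hs0 : 0 ≤ √(δ ^ 2 - 1) := Real.sqrt_nonneg _
  have hs1 : s ^ 2 - 2 * δ * s + 1 = 0 := by rw [hs]; nlinarith
  have hz := z.im_pos
  have hw := w.im_pos
  have h1 : (z.im - w.im) ^ 2 ≤ ‖(z : ℂ) - w‖ ^ 2 := by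
    have := Complex.abs_im_le_norm ((z : ℂ) - w)
    rw [Complex.sub_im, coe_im, coe_im] at this
    exact sq_le_sq' (neg_le_of_abs_le this) (le_of_abs_le this)
  rw [u_eq, ← sub_le_iff_le_add', le_div_iff₀ (by positivity)]
  refine le_trans ?_ h1
  have h2 : 0 ≤ (z.im - s * w.im) * (z.im - (2 * δ - s) * w.im) := by
    refine mul_nonneg (by linarith) ?_
    have : (2 * δ - s) ≤ s := by rw [hs]; linarith
    nlinarith
  have h3 : (z.im - s * w.im) * (z.im - (2 * δ - s) * w.im) =
      (z.im - w.im) ^ 2 - (δ - 1) * (2 * z.im * w.im) := by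
    linear_combination -(w.im ^ 2) * hs1
  linarith

theorem toQuot_eq_iff {Γ : Subgroup SL(2, ℝ)} {z w : ℍ} :
    toQuot Γ z = toQuot Γ w ↔ ∃ γ ∈ Γ, γ • w = z := by
  rw [toQuot, toQuot, Quotient.eq, MulAction.orbitRel_apply, MulAction.mem_orbit_iff]
  exact ⟨fun ⟨γ, h⟩ => ⟨γ.1, γ.2, h⟩, fun ⟨γ, hγ, h⟩ => ⟨⟨γ, hγ⟩, h⟩⟩

theorem toQuot_smul {Γ : Subgroup SL(2, ℝ)} {γ : SL(2, ℝ)} (hγ : γ ∈ Γ) (z : ℍ) :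
    toQuot Γ (γ • z) = toQuot Γ z := toQuot_eq_iff.mpr ⟨γ, hγ, rfl⟩

theorem sl_neg_smul (g : SL(2, ℝ)) (z : ℍ) : -g • z = g • z := by
  refine UpperHalfPlane.ext ?_
  rw [coe_specialLinearGroup_apply, coe_specialLinearGroup_apply]
  simp only [Matrix.SpecialLinearGroup.coe_neg, Matrix.neg_apply, map_neg,
    Complex.ofReal_neg, neg_mul, ← neg_add, neg_div_neg_eq]

theorem coe_translation_smul (b : ℤ) (z : ℍ) : ((translation b • z : ℍ) : ℂ) = z + b := by
  rw [coe_specialLinearGroup_apply]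
  simp [translation]

/-- From `Im gz = Im z / |cz + d|²` and `|cz + d| ≥ |c| Im z`. Hence a lower bound for `|c|`
prevents two points of an orbit, related by an element outside the stabiliser, from both lying high
in the cusp. -/
theorem yCusp_smul_mul_le {σ γ : SL(2, ℝ)} (z : ℍ) :
    yCusp σ (γ • z) * yCusp σ z * CCusp σ γ ^ 2 ≤ 1 := by
  set g := σ⁻¹ * γ * σ with hg
  have h : σ⁻¹ • γ • z = g • σ⁻¹ • z := by simp [hg, mul_smul]
  rw [yCusp, h, yCusp, CCusp, ← hg, sq_abs, im_sl_smul]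
  set w := σ⁻¹ • z
  have hd : ((g 1 0 : ℂ) * w + g 1 1) ≠ 0 := denom_ne_zero g w
  have h1 : (g 1 0 * w.im) ^ 2 ≤ ‖(g 1 0 : ℂ) * w + g 1 1‖ ^ 2 := by
    have := Complex.abs_im_le_norm ((g 1 0 : ℂ) * w + g 1 1)
    simp only [Complex.add_im, Complex.mul_im, Complex.ofReal_re, Complex.ofReal_im, zero_mul,
      add_zero, coe_im] at this
    exact sq_le_sq' (neg_le_of_abs_le this) (le_of_abs_le this)
  have h2 : 0 < ‖(g 1 0 : ℂ) * w + g 1 1‖ ^ 2 := by positivity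
  rw [div_mul_eq_mul_div, div_mul_eq_mul_div, div_le_one h2]
  nlinarith

end

section

variable {Γ : Subgroup SL(2, ℝ)} {c : Cusps Γ} {σ : SL(2, ℝ)}

theorem FuchsianGreen.IsCuspScaling.exists_translation (hσ : IsCuspScaling Γ c σ) {γ : SL(2, ℝ)}
    (hγ : γ ∈ cuspStabiliser Γ σ) :
    ∃ b : ℤ, σ⁻¹ * γ * σ = translation b ∨ σ⁻¹ * γ * σ = -translation b :=
  (hσ.conj_eq _).mp ⟨γ, hγ, Or.inl rfl⟩

theorem coe_inv_smul_of_conj_eq {γ : SL(2, ℝ)} {b : ℤ}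
    (h : σ⁻¹ * γ * σ = translation b ∨ σ⁻¹ * γ * σ = -translation b) (z : ℍ) :
    ((σ⁻¹ • γ • z : ℍ) : ℂ) = (σ⁻¹ • z : ℍ) + b := by
  have h1 : σ⁻¹ • γ • z = (σ⁻¹ * γ * σ) • σ⁻¹ • z := by simp [mul_smul]
  rw [h1, ← coe_translation_smul]
  rcases h with h | h
  · rw [h]
  · rw [h, sl_neg_smul]

theorem FuchsianGreen.IsCuspScaling.exists_mem (hσ : IsCuspScaling Γ c σ) (b : ℤ) :
    ∃ γ ∈ cuspStabiliser Γ σ, σ⁻¹ * γ * σ = translation b ∨ σ⁻¹ * γ * σ = -translation b := by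
  obtain ⟨γ, hγ, h | h⟩ := (hσ.conj_eq (translation b)).mpr ⟨b, Or.inl rfl⟩
  · exact ⟨γ, hγ, Or.inl h.symm⟩
  · exact ⟨γ, hγ, Or.inr (by rw [h, neg_neg])⟩

theorem mem_of_mem_cuspStabiliser {γ : SL(2, ℝ)} (hγ : γ ∈ cuspStabiliser Γ σ) : γ ∈ Γ :=
  (Subgroup.mem_inf.mp hγ).1

theorem FuchsianGreen.IsCuspScaling.exists_add (hσ : IsCuspScaling Γ c σ) (b : ℤ) :
    ∃ γ ∈ Γ, ∀ z : ℍ, ((σ⁻¹ • γ • z : ℍ) : ℂ) = (σ⁻¹ • z : ℍ) + b := by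
  obtain ⟨γ, hγ, h⟩ := hσ.exists_mem b
  exact ⟨γ, mem_of_mem_cuspStabiliser hγ, coe_inv_smul_of_conj_eq h⟩

theorem FuchsianGreen.IsCuspScaling.yCusp_smul (hσ : IsCuspScaling Γ c σ) {γ : SL(2, ℝ)}
    (hγ : γ ∈ cuspStabiliser Γ σ) (z : ℍ) : yCusp σ (γ • z) = yCusp σ z := by
  obtain ⟨b, hb⟩ := hσ.exists_translation hγ
  have := congrArg Complex.im (coe_inv_smul_of_conj_eq hb z)
  simpa [yCusp] using this

theorem FuchsianGreen.IsCuspScaling.toQuot_mem_cuspDisc (hσ : IsCuspScaling Γ c σ) {ε : ℝ} {z : ℍ} :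
    toQuot Γ z ∈ cuspDisc Γ σ ε ↔ ∃ γ ∈ Γ, 1 / ε < yCusp σ (γ • z) := by
  constructor
  · rintro ⟨z', ⟨-, -, h⟩, heq⟩
    obtain ⟨γ, hγ, h'⟩ := toQuot_eq_iff.mp heq
    exact ⟨γ, hγ, by rw [yCusp, h', inv_smul_smul]; exact h⟩
  · rintro ⟨γ, hγ, h⟩
    obtain ⟨γ', hγ', h'⟩ := hσ.exists_add (-⌊(σ⁻¹ • γ • z).re⌋)
    have h1 := h' (γ • z)
    refine ⟨σ⁻¹ • γ' • γ • z, ⟨?_, ?_, ?_⟩, ?_⟩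
    · have := congrArg Complex.re h1
      rw [← coe_re, this]
      simp [Int.floor_le]
    · have := congrArg Complex.re h1
      rw [← coe_re, this]
      have := Int.lt_floor_add_one (σ⁻¹ • γ • z).re
      simp
      linarith
    · have := congrArg Complex.im h1
      rw [← coe_im, this]
      simpa [yCusp] using h
    · simp only [smul_inv_smul]
      rw [toQuot_smul hγ', toQuot_smul hγ]

theorem qCusp_smul {γ : SL(2, ℝ)} {b : ℤ}
    (h : ∀ z : ℍ, ((σ⁻¹ • γ • z : ℍ) : ℂ) = (σ⁻¹ • z : ℍ) + b) (z : ℍ) :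
    qCusp σ (γ • z) = qCusp σ z := by
  rw [qCusp, qCusp, h, Complex.exp_eq_exp_iff_exists_int]
  exact ⟨b, by ring⟩

/-! ### Growth of the Green function at the cusps -/

/-- A smooth radial function supported on the disc of radius `R` around `w`. -/
noncomputable def radialBump (w : ℂ) (R : ℝ) (p : ℂ) : ℝ :=
  Real.smoothTransition (1 - ‖p - w‖ ^ 2 / R ^ 2)

theorem contDiff_radialBump (w : ℂ) (R : ℝ) : ContDiff ℝ ∞ (radialBump w R) :=
  Real.smoothTransition.contDiff.comp
    (contDiff_const.sub (((contDiff_id.sub contDiff_const).norm_sq ℝ).div_const _))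

theorem radialBump_nonneg (w : ℂ) (R : ℝ) (p : ℂ) : 0 ≤ radialBump w R p :=
  Real.smoothTransition.nonneg _

theorem radialBump_le_one (w : ℂ) (R : ℝ) (p : ℂ) : radialBump w R p ≤ 1 :=
  Real.smoothTransition.le_one _

theorem tsupport_radialBump_subset (w : ℂ) {R : ℝ} (hR : 0 < R) :
    tsupport (radialBump w R) ⊆ Metric.closedBall w R := by
  refine closure_minimal (fun p hp => ?_) Metric.isClosed_closedBall
  by_contra h
  rw [Metric.mem_closedBall, dist_eq_norm, not_le] at h
  refine hp (Real.smoothTransition.zero_of_nonpos ?_)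
  rw [sub_nonpos, one_le_div (by positivity)]
  gcongr

theorem hasCompactSupport_radialBump (w : ℂ) {R : ℝ} (hR : 0 < R) :
    HasCompactSupport (radialBump w R) :=
  (isCompact_closedBall w R).of_isClosed_subset (isClosed_tsupport _)
    (tsupport_radialBump_subset w hR)

theorem integral_radialBump (w : ℂ) (R : ℝ) :
    ∫ p, radialBump w R p = ∫ p, radialBump 0 R p := by
  rw [← integral_sub_right_eq_self (radialBump 0 R) w]
  simp [radialBump]

theorem integral_radialBump_pos (w : ℂ) {R : ℝ} (hR : 0 < R) : 0 < ∫ p, radialBump w R p := by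
  refine (contDiff_radialBump w R).continuous.integral_pos_of_hasCompactSupport_nonneg_nonzero
    (hasCompactSupport_radialBump w hR) (radialBump_nonneg w R) (x := w) ?_
  simp [radialBump, Real.smoothTransition.one_of_one_le]

theorem continuous_yCusp (σ : SL(2, ℝ)) : Continuous (yCusp σ) :=
  continuous_im.comp (continuous_const_smul σ⁻¹)

theorem yCusp_pos (σ : SL(2, ℝ)) (z : ℍ) : 0 < yCusp σ z := UpperHalfPlane.im_pos _

theorem yCusp_smul_ofComplex (σ : SL(2, ℝ)) {p : ℂ} (hp : 0 < p.im) :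
    yCusp σ (σ • ofComplex p) = p.im := by
  rw [yCusp, inv_smul_smul, ← coe_im, ofComplex_apply_of_im_pos hp]

end

section

variable {Γ : Subgroup SL(2, ℝ)} {gr : ℍ → ℍ → ℝ} {c : Cusps Γ} {σ : SL(2, ℝ)} {C₀ : ℝ}

theorem yCusp_smul_le (hσ : IsCuspScaling Γ c σ) (hC₀ : 0 < C₀)
    (hC : ∀ γ ∈ Γ, γ ∉ cuspStabiliser Γ σ → C₀ ≤ CCusp σ γ) {γ : SL(2, ℝ)} (hγ : γ ∈ Γ) (z : ℍ) :
    yCusp σ (γ • z) ≤ max (yCusp σ z) (1 / (yCusp σ z * C₀ ^ 2)) := by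
  by_cases h : γ ∈ cuspStabiliser Γ σ
  · exact (hσ.yCusp_smul h z).le.trans (le_max_left _ _)
  · refine le_trans ?_ (le_max_right _ _)
    have hz := yCusp_pos σ z
    rw [le_div_iff₀ (by positivity)]
    have h1 := yCusp_smul_mul_le (σ := σ) (γ := γ) z
    have h2 : C₀ ^ 2 ≤ CCusp σ γ ^ 2 := by gcongr; exact hC γ hγ h
    have h3 := mul_le_mul_of_nonneg_left h2 (mul_pos (yCusp_pos σ (γ • z)) hz).le
    linarith

/-- Elements of the stabiliser preserve the height `y`, and all others bring it to at most `1/(y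
C₀²)`. Both quantities are bounded on a compact set. -/
theorem exists_forall_yCusp_smul_le (hσ : IsCuspScaling Γ c σ) (hC₀ : 0 < C₀)
    (hC : ∀ γ ∈ Γ, γ ∉ cuspStabiliser Γ σ → C₀ ≤ CCusp σ γ) {K : Set ℍ} (hK : IsCompact K) :
    ∃ Y, ∀ z ∈ K, ∀ t : transformationGroup Γ, yCusp σ (t • z) ≤ Y := by
  have hc : Continuous fun z : ℍ => max (yCusp σ z) (1 / (yCusp σ z * C₀ ^ 2)) := by
    have hy := continuous_yCusp σ
    refine hy.max (continuous_const.div (hy.mul continuous_const) fun z => ?_)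
    have := yCusp_pos σ z
    positivity
  obtain ⟨Y, hY⟩ := hK.exists_bound_of_continuousOn hc.continuousOn
  refine ⟨Y, fun z hz t => ?_⟩
  obtain ⟨γ, hγ, h⟩ := exists_smul_eq t
  rw [h]
  exact (yCusp_smul_le hσ hC₀ hC hγ z).trans ((le_abs_self _).trans (hY z hz))

/-- High up in the cusp, `gr_Γ(·, w)` agrees with a square integrable invariant function. -/
theorem FuchsianGreen.IsGreenFunction.exists_memLp_eq (hΓ : IsCofinite Γ)
    (hgr : IsGreenFunction Γ gr) (hσ : IsCuspScaling Γ c σ) (hC₀ : 0 < C₀)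
    (hC : ∀ γ ∈ Γ, γ ∉ cuspStabiliser Γ σ → C₀ ≤ CCusp σ γ) (w : ℍ) :
    ∃ (Y : ℝ) (ψ : ℍ → ℝ), MemLp ψ 2 (quotVolume Γ) ∧
      ∀ z, (∃ t : transformationGroup Γ, Y < yCusp σ (t • z)) → gr z w = ψ z := by
  have hw := w.im_pos
  set R := w.im / 2 with hRdef
  have hR : 0 < R := by positivity
  have hball : Metric.closedBall (w : ℂ) R ⊆ {p : ℂ | 0 < p.im} := by
    intro p hp
    rw [Metric.mem_closedBall, dist_eq_norm] at hp
    have := (Complex.abs_im_le_norm (p - w)).trans hp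
    rw [Complex.sub_im, coe_im, abs_le] at this
    show 0 < p.im
    linarith [this.1]
  have hρ : IsTestFunction (radialBump w R) := ⟨contDiff_radialBump _ _,
    hasCompactSupport_radialBump _ hR, (tsupport_radialBump_subset _ hR).trans hball⟩
  have hK : IsCompact ((fun z : ℍ => (z : ℂ)) ⁻¹' Metric.closedBall (w : ℂ) R) := by
    refine isOpenEmbedding_coe.isInducing.isCompact_preimage_iff ?_ |>.mpr
      (isCompact_closedBall _ _)
    exact fun p hp => ⟨⟨p, hball hp⟩, rfl⟩
  obtain ⟨Y, hY⟩ := exists_forall_yCusp_smul_le hσ hC₀ hC hK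
  have hf := isSmoothBounded_periodise hΓ.discrete (hρ.mul_left contDiff_im_sq.contDiffOn)
  set f := periodise Γ (fun p => p.im ^ 2 * radialBump w R p) with hfdef
  have hk := hgr.memLp_integral hΓ hf
  set k := fun z => ∫ w, gr z w * f w ∂(quotVolume Γ) with hkdef
  set I := ∫ p, radialBump w R p with hI
  have hIpos : 0 < I := integral_radialBump_pos _ hR
  set l := ∫ p : ℂ, 1 / vol Γ * Real.log p.im * radialBump w R p with hl
  have := isFiniteMeasure_quotVolume hΓ
  refine ⟨Y, fun z => centreCard Γ / I * k z + (1 / vol Γ * Real.log w.im - l / I),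
    (hk.const_mul _).add (memLp_const _), ?_⟩
  rintro z ⟨s, hs⟩
  -- A point high enough in the cusp has no orbit point in the disc around `w`, so the singularities
  -- stay out of the region of averaging.
  have hne : ∀ p ∈ Metric.closedBall (w : ℂ) R, ∀ t : transformationGroup Γ,
      t • z ≠ ofComplex p := by
    intro p hp t ht
    have h1 := hY (ofComplex p) (by simpa [ofComplex_apply_of_im_pos (hball hp)] using hp) (s * t⁻¹)
    rw [← ht, mul_smul, inv_smul_smul] at h1
    exact absurd hs (not_lt.mpr h1)
  have hharm : InnerProductSpace.HarmonicOnNhd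
      (fun p : ℂ => gr z (ofComplex p) - 1 / vol Γ * Real.log p.im)
      (Metric.closedBall (w : ℂ) R) :=
    fun p hp => hgr.harmonicAt_sub_log hΓ (hball hp) (hne p hp)
  -- Averaging over the second variable expresses `gr z w` through the integral of `gr z` against a
  -- fixed bump. After unfolding, this is `G` applied to a smooth bounded function, which is square
  -- integrable.
  have hmv := integral_mul_radial_eq (ρ := radialBump w R)
    (b := fun r => Real.smoothTransition (1 - r ^ 2 / R ^ 2)) hharm
    (contDiff_radialBump _ _).continuous (fun p => rfl) (tsupport_radialBump_subset _ hR)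
  have hi : ∀ g : ℂ → ℝ, (∀ p ∈ tsupport (radialBump w R), ContinuousAt g p) →
      Integrable fun p => g p * radialBump w R p := fun g hg => by
    simp_rw [mul_comm (g _)]
    exact (continuous_mul_of_tsupport hρ.smooth.continuous hg).integrable_of_hasCompactSupport
      hρ.compact.mul_right
  have i2 : Integrable fun p : ℂ => 1 / vol Γ * Real.log p.im * radialBump w R p :=
    hi _ fun p hp => continuousAt_const.mul (contDiffAt_log_im (hρ.support hp)).continuousAt
  have i1 : Integrable fun p : ℂ => gr z (ofComplex p) * radialBump w R p := by
    refine hi _ fun p hp => ?_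
    have h1 := (hharm p (tsupport_radialBump_subset _ hR hp)).1.continuousAt
    have h2 : ContinuousAt (fun p : ℂ => 1 / vol Γ * Real.log p.im) p :=
      continuousAt_const.mul (contDiffAt_log_im (hρ.support hp)).continuousAt
    refine (h1.add h2).congr (Filter.Eventually.of_forall fun q => ?_)
    simp
  simp_rw [sub_mul] at hmv
  rw [integral_sub i1 i2] at hmv
  have hint : ∫ p : ℂ, gr z (ofComplex p) * radialBump w R p = centreCard Γ * k z := by
    rw [hkdef, hgr.integral_mul_periodise hΓ (hρ.mul_left contDiff_im_sq.contDiffOn)]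
    · refine integral_congr_ae (Filter.Eventually.of_forall fun p => ?_)
      by_cases hp : p ∈ tsupport (radialBump w R)
      · have hp0 : 0 < p.im := hρ.support hp
        field_simp
      · simp [image_eq_zero_of_notMem_tsupport hp]
    · intro t ht
      exact hne _ (tsupport_radialBump_subset _ hR (tsupport_mul_subset_right ht)) t
        (ofComplex_apply _).symm
  rw [hint, ofComplex_apply, coe_im, ← sub_mul, ← hI, ← hl] at hmv
  have h1 : gr z w - 1 / vol Γ * Real.log w.im = (centreCard Γ * k z - l) / I := by
    rw [eq_div_iff hIpos.ne', hmv]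
  rw [sub_div] at h1
  have h2 : (centreCard Γ : ℝ) / I * k z = centreCard Γ * k z / I := by ring
  simp only [h2]
  linarith

/-- The integral of `gr_Γ(·, w)²` over a neighbourhood of a cusp tends to `0` as the neighbourhood
shrinks. -/
theorem FuchsianGreen.IsGreenFunction.exists_setLIntegral_lt (hΓ : IsCofinite Γ)
    (hgr : IsGreenFunction Γ gr) (hσ : IsCuspScaling Γ c σ) (hC₀ : 0 < C₀)
    (hC : ∀ γ ∈ Γ, γ ∉ cuspStabiliser Γ σ → C₀ ≤ CCusp σ γ) (w : ℍ) {τ : ℝ≥0∞} (hτ : 0 < τ) :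
    ∃ (Y : ℝ) (F : ℍ → ℝ≥0∞), Measurable F ∧
      (∀ z, ∀ t : transformationGroup Γ, F (t • z) = F z) ∧
      (∀ z, Y < yCusp σ z → F z = ENNReal.ofReal (gr z w ^ 2)) ∧
      (∀ z, Y < yCusp σ z → ∀ t : transformationGroup Γ, t • w ≠ z) ∧
      ∫⁻ z in {z | ∃ t : transformationGroup Γ, Y < yCusp σ (t • z)}, F z ∂(quotVolume Γ) < τ := by
  obtain ⟨Y₀, ψ, hψ, heq⟩ := hgr.exists_memLp_eq hΓ hσ hC₀ hC w
  obtain ⟨Y₁, hY₁⟩ := exists_forall_yCusp_smul_le hσ hC₀ hC (isCompact_singleton (x := w))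
  set Y₂ := max Y₀ Y₁
  set S : ℝ → Set ℍ := fun Y => {z | ∃ t : transformationGroup Γ, Y < yCusp σ (t • z)} with hS
  have hSo : ∀ Y, IsOpen (S Y) := fun Y => by
    have : S Y = ⋃ t : transformationGroup Γ, {z | Y < yCusp σ (t • z)} := by
      ext z; simp [hS]
    rw [this]
    exact isOpen_iUnion fun t => isOpen_lt continuous_const
      ((continuous_yCusp σ).comp (continuous_const_smul t))
  have hSanti : Antitone S := fun a b hab z ⟨t, ht⟩ => ⟨t, hab.trans_lt ht⟩
  have hSinv : ∀ Y, ∀ z, ∀ t : transformationGroup Γ, t • z ∈ S Y ↔ z ∈ S Y := by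
    intro Y z t
    constructor
    · rintro ⟨s, hs⟩
      exact ⟨s * t, by rwa [mul_smul]⟩
    · rintro ⟨s, hs⟩
      exact ⟨s * t⁻¹, by rwa [mul_smul, inv_smul_smul]⟩
  have hgrt : ∀ z, ∀ t : transformationGroup Γ, gr (t • z) w = gr z w := by
    intro z t
    obtain ⟨γ, hγ, h⟩ := exists_smul_eq t
    rw [h, hgr.invariant_left γ hγ]
  -- Cutting off below height `Y₂` discards the singularities of `gr(·, w)`; the result is
  -- invariant, measurable and of finite integral.
  set F : ℍ → ℝ≥0∞ := (S Y₂).indicator fun z => ENNReal.ofReal (gr z w ^ 2) with hF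
  have hne : ∀ z ∈ S Y₂, ∀ t : transformationGroup Γ, t • w ≠ z := by
    rintro z ⟨s, hs⟩ t ht
    have := hY₁ w rfl (s * t)
    rw [mul_smul, ht] at this
    exact absurd ((le_max_right _ _).trans_lt hs) (not_lt.mpr this)
  have hFm : Measurable F := by
    classical
    rw [hF, ← Set.piecewise_eq_indicator]
    refine ContinuousOn.measurable_piecewise (fun z hz => ?_) continuousOn_const
      (hSo _).measurableSet
    refine ContinuousAt.continuousWithinAt ?_
    have h1 : ContinuousAt (fun z => gr z w) z := by
      simp_rw [hgr.symm _ w]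
      exact hgr.continuousAt_right hΓ (forall_smul_ne_symm (hne z hz))
    exact ENNReal.continuous_ofReal.continuousAt.comp (h1.pow 2)
  have hFinv : ∀ z, ∀ t : transformationGroup Γ, F (t • z) = F z := by
    intro z t
    by_cases hz : z ∈ S Y₂
    · rw [hF, Set.indicator_of_mem hz, Set.indicator_of_mem ((hSinv _ _ _).mpr hz), hgrt]
    · rw [hF, Set.indicator_of_notMem hz,
        Set.indicator_of_notMem (fun h => hz ((hSinv _ _ _).mp h))]
  have hfin : ∫⁻ z, F z ∂(quotVolume Γ) ≠ ⊤ := by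
    have h1 : ∫⁻ z, ‖ψ z ^ 2‖ₑ ∂(quotVolume Γ) < ⊤ := hψ.integrable_sq.2
    refine ne_top_of_le_ne_top h1.ne (lintegral_mono fun z => ?_)
    by_cases hz : z ∈ S Y₂
    · rw [hF, Set.indicator_of_mem hz, heq z (hSanti (le_max_left _ _) hz),
        Real.enorm_of_nonneg (sq_nonneg _)]
    · rw [hF, Set.indicator_of_notMem hz]
      exact zero_le
  -- The cusp neighbourhoods decrease to the empty set, as the heights along any orbit are bounded.
  -- Their measures with density `F` therefore tend to `0`.
  have htend := tendsto_measure_iInter_atTop (μ := (quotVolume Γ).withDensity F)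
    (s := fun m : ℕ => S m) (fun m => (hSo m).nullMeasurableSet)
    (fun a b hab => hSanti (Nat.cast_le.mpr hab))
    ⟨0, by
      rw [withDensity_apply _ (hSo _).measurableSet]
      exact ne_top_of_le_ne_top hfin (setLIntegral_le_lintegral _ _)⟩
  have hempty : ⋂ m : ℕ, S m = ∅ := by
    rw [Set.eq_empty_iff_forall_notMem]
    intro z hz
    obtain ⟨Y, hY⟩ := exists_forall_yCusp_smul_le hσ hC₀ hC (isCompact_singleton (x := z))
    obtain ⟨m, hm⟩ := exists_nat_gt Y
    obtain ⟨t, ht⟩ := Set.mem_iInter.mp hz m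
    exact absurd (hm.trans ht) (not_lt.mpr (hY z rfl t))
  rw [hempty, measure_empty] at htend
  obtain ⟨m, hm, hm'⟩ := ((htend.eventually (gt_mem_nhds hτ)).and
    (Filter.eventually_ge_atTop ⌈Y₂⌉₊)).exists
  have hmY : Y₂ ≤ m := (Nat.le_ceil _).trans (Nat.cast_le.mpr hm')
  rw [Function.comp_apply, withDensity_apply _ (hSo _).measurableSet] at hm
  have hin : ∀ z, (m : ℝ) < yCusp σ z → z ∈ S Y₂ := fun z hz =>
    ⟨1, by rw [one_smul]; exact hmY.trans_lt hz⟩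
  exact ⟨m, F, hFm, hFinv, fun z hz => by rw [hF, Set.indicator_of_mem (hin z hz)],
    fun z hz => hne z (hin z hz), hm⟩

end

section

variable {Γ : Subgroup SL(2, ℝ)} {gr : ℍ → ℍ → ℝ} {c : Cusps Γ} {σ : SL(2, ℝ)} {C₀ : ℝ}

theorem lintegral_smul_upperHalfPlane (g : SL(2, ℝ)) (F : ℍ → ℝ≥0∞) :
    ∫⁻ z, F (g • z) = ∫⁻ z, F z :=
  (measurePreserving_smul (Matrix.SpecialLinearGroup.mapGL ℝ g : GL (Fin 2) ℝ)
    (volume : Measure ℍ)).lintegral_comp_emb (measurableEmbedding_const_smul _) F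

/-- Otherwise the product of the two heights, both greater than `1/C₀`, would be at most `1/C₀²`. -/
theorem mem_cuspStabiliser_of_lt_yCusp (hC₀ : 0 < C₀)
    (hC : ∀ γ ∈ Γ, γ ∉ cuspStabiliser Γ σ → C₀ ≤ CCusp σ γ) {z : ℍ} {γ : SL(2, ℝ)} (hγ : γ ∈ Γ)
    (hz : 1 / C₀ < yCusp σ z) (hγz : 1 / C₀ < yCusp σ (γ • z)) : γ ∈ cuspStabiliser Γ σ := by
  by_contra hn
  have h1 := yCusp_smul_mul_le (σ := σ) (γ := γ) z
  have h2 : C₀ ^ 2 ≤ CCusp σ γ ^ 2 := by gcongr; exact hC γ hγ hn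
  rw [div_lt_iff₀ hC₀] at hz hγz
  have h3 : 1 < (yCusp σ (γ • z) * C₀) * (yCusp σ z * C₀) := one_lt_mul_of_lt_of_le hγz hz.le
  have h4 := mul_le_mul_of_nonneg_left h2 (mul_pos (yCusp_pos σ (γ • z)) (yCusp_pos σ z)).le
  nlinarith

/-- Small discs high up in the cusp embed into the quotient. -/
theorem eq_one_of_smul_mem_disc (hσ : IsCuspScaling Γ c σ) (hC₀ : 0 < C₀)
    (hC : ∀ γ ∈ Γ, γ ∉ cuspStabiliser Γ σ → C₀ ≤ CCusp σ γ) {z : ℍ} {t : transformationGroup Γ}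
    (hz : 1 / C₀ < yCusp σ z) (ht : 1 / C₀ < yCusp σ (t • z))
    (hd : ‖((σ⁻¹ • t • z : ℍ) : ℂ) - (σ⁻¹ • z : ℍ)‖ < 1) : t = 1 := by
  obtain ⟨γ, hγ, h⟩ := exists_smul_eq t
  rw [h] at ht hd
  have hmem := mem_cuspStabiliser_of_lt_yCusp hC₀ hC hγ hz ht
  obtain ⟨b, hb⟩ := hσ.exists_translation hmem
  have hcoe := coe_inv_smul_of_conj_eq hb
  rw [hcoe z, add_sub_cancel_left, Complex.norm_intCast] at hd
  have hb0 : b = 0 := Int.abs_lt_one_iff.mp (by exact_mod_cast hd)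
  refine transformation_ext fun z' => ?_
  rw [h, one_smul]
  refine (MulAction.injective σ⁻¹) (UpperHalfPlane.ext ?_)
  rw [hcoe z', hb0]
  simp

/-- A disc of radius `1/4` high in the cusp embeds into the quotient. On it the hyperbolic density
is at least `1/(4y²)`, `y` being the height of the centre, so the Euclidean integral costs a factor
`4y²`. -/
theorem FuchsianGreen.IsGreenFunction.setIntegral_sq_le (hΓ : IsCofinite Γ)
    (hσ : IsCuspScaling Γ c σ) (hC₀ : 0 < C₀)
    (hC : ∀ γ ∈ Γ, γ ∉ cuspStabiliser Γ σ → C₀ ≤ CCusp σ γ) {w : ℍ} {τ Y : ℝ} (hτ : 0 ≤ τ)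
    {F : ℍ → ℝ≥0∞} (hF : Measurable F) (hFinv : ∀ z, ∀ t : transformationGroup Γ, F (t • z) = F z)
    (hFgr : ∀ z, Y < yCusp σ z → F z = ENNReal.ofReal (gr z w ^ 2))
    (hFint : ∫⁻ z in {z | ∃ t : transformationGroup Γ, Y < yCusp σ (t • z)}, F z ∂(quotVolume Γ) <
      ENNReal.ofReal τ)
    {p : ℂ} (hp : 2 < p.im) (hpY : Y + 1 < p.im) (hpC : 1 / C₀ + 1 < p.im)
    (hcont : ContinuousOn (fun q => gr (σ • ofComplex q) w) (Metric.closedBall p (1 / 4))) :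
    ∫ q in Metric.closedBall p (1 / 4), gr (σ • ofComplex q) w ^ 2 ≤
      4 * p.im ^ 2 * (centreCard Γ * τ) := by
  set B := Metric.closedBall p (1 / 4) with hB
  have him : ∀ q ∈ B, p.im - 1 / 4 ≤ q.im ∧ q.im ≤ p.im + 1 / 4 := by
    intro q hq
    rw [hB, Metric.mem_closedBall, dist_eq_norm] at hq
    have := (Complex.abs_im_le_norm (q - p)).trans hq
    rw [Complex.sub_im, abs_le] at this
    constructor <;> linarith [this.1, this.2]
  set S : Set ℍ := {z | ((σ⁻¹ • z : ℍ) : ℂ) ∈ B} with hS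
  have hSm : MeasurableSet S :=
    (Metric.isClosed_closedBall.preimage
      (continuous_coe.comp (continuous_const_smul σ⁻¹))).measurableSet
  have hSy : ∀ z ∈ S, p.im - 1 / 4 ≤ yCusp σ z := fun z hz => (him _ hz).1
  have h1 : ∫⁻ z in S, F z ≤ centreCard Γ * ENNReal.ofReal τ := by
    refine (setLIntegral_le_quotVolume hΓ hSm ?_ ?_ hF hFinv).trans
      (mul_le_mul' le_rfl hFint.le)
    · intro z hz t ht
      have h1 := hSy z hz
      have h2 := hSy _ ht
      refine eq_one_of_smul_mem_disc hσ hC₀ hC (z := z) (by linarith) (by linarith) ?_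
      have h3 : ((σ⁻¹ • z : ℍ) : ℂ) ∈ B := hz
      have h4 : ((σ⁻¹ • t • z : ℍ) : ℂ) ∈ B := ht
      rw [hB, Metric.mem_closedBall] at h3 h4
      rw [← dist_eq_norm]
      linarith [dist_triangle_right ((σ⁻¹ • t • z : ℍ) : ℂ) (σ⁻¹ • z : ℍ) p]
    · intro z t ht
      exact ⟨t, by linarith [hSy _ ht]⟩
  have hBpos : B ⊆ {q : ℂ | 0 < q.im} := fun q hq => by
    have := (him q hq).1
    show 0 < q.im
    linarith
  have hint : IntegrableOn (fun q => gr (σ • ofComplex q) w ^ 2) B :=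
    (hcont.pow 2).integrableOn_compact (isCompact_closedBall _ _)
  have h2 : ENNReal.ofReal (∫ q in B, gr (σ • ofComplex q) w ^ 2) *
      ENNReal.ofReal (1 / (4 * p.im ^ 2)) ≤ ∫⁻ z in S, F z := by
    rw [ofReal_integral_eq_lintegral_ofReal hint
      (Filter.Eventually.of_forall fun q => sq_nonneg _),
      ← lintegral_mul_const' _ _ ENNReal.ofReal_ne_top, ← lintegral_indicator hSm,
      ← lintegral_smul_upperHalfPlane σ, lintegral_upperHalfPlane]
    refine le_trans ?_ (lintegral_mono_set hBpos)
    refine setLIntegral_mono' Metric.isClosed_closedBall.measurableSet fun q hq => ?_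
    have hq0 : 0 < q.im := hBpos hq
    have hmem : σ • ofComplex q ∈ S := by
      show ((σ⁻¹ • σ • ofComplex q : ℍ) : ℂ) ∈ B
      rwa [inv_smul_smul, ofComplex_apply_of_im_pos hq0]
    rw [Set.indicator_of_mem hmem, hFgr]
    · refine mul_le_mul' le_rfl (ENNReal.ofReal_le_ofReal ?_)
      have := (him q hq).2
      refine one_div_le_one_div_of_le (by positivity) ?_
      nlinarith
    · rw [yCusp_smul_ofComplex σ hq0]
      linarith [(him q hq).1]
  have h3 := h2.trans h1
  have hp0 : 0 < p.im := by linarith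
  rw [← ENNReal.ofReal_natCast, ← ENNReal.ofReal_mul (integral_nonneg fun q => sq_nonneg _),
    ← ENNReal.ofReal_mul (Nat.cast_nonneg _),
    ENNReal.ofReal_le_ofReal_iff (by positivity), mul_one_div, div_le_iff₀ (by positivity)] at h3
  linarith

/-- At a cusp, `gr_Γ(·, w)` grows like `(1 / vol_Γ) log y` up to `o(y)`. -/
theorem FuchsianGreen.IsGreenFunction.exists_abs_sub_log_le_mul_im (hΓ : IsCofinite Γ)
    (hgr : IsGreenFunction Γ gr) (hσ : IsCuspScaling Γ c σ) (hC₀ : 0 < C₀)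
    (hC : ∀ γ ∈ Γ, γ ∉ cuspStabiliser Γ σ → C₀ ≤ CCusp σ γ) (w : ℍ) {η : ℝ} (hη : 0 < η) :
    ∃ Y, ∀ p : ℂ, Y < p.im →
      |gr w (σ • ofComplex p) - 1 / vol Γ * Real.log p.im| ≤ η * p.im := by
  set I := ∫ p, radialBump 0 (1 / 4) p with hI
  have hI0 : 0 < I := integral_radialBump_pos 0 (by norm_num)
  set b := volume.real (Metric.closedBall (0 : ℂ) (1 / 4)) with hb
  have hb0 : 0 ≤ b := measureReal_nonneg
  set n : ℝ := (centreCard Γ : ℝ) with hn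
  have hn0 : 0 < n := Nat.cast_pos.mpr (centreCard_pos Γ)
  -- `a` and `τ` are chosen so that the constant term, the logarithm and the `L²` term below each
  -- contribute at most `ηyI/3`.
  set a := η * I / (3 * (b + 1)) with ha
  have ha0 : 0 < a := by positivity
  set τ := a * η * I / (12 * n) with hτ
  have hτ0 : 0 < τ := by positivity
  obtain ⟨Y, F, hF, hFinv, hFgr, hne, hFint⟩ :=
    hgr.exists_setLIntegral_lt hΓ hσ hC₀ hC w (ENNReal.ofReal_pos.mpr hτ0)
  have hlog : ∀ᶠ y in Filter.atTop, |1 / vol Γ| * b * Real.log (2 * y) ≤ η * I / 3 * y := by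
    have h1 := (Real.isLittleO_log_id_atTop.comp_tendsto
      (Filter.tendsto_id.const_mul_atTop (zero_lt_two' ℝ))).const_mul_left (|1 / vol Γ| * b)
    filter_upwards [h1.bound (show 0 < η * I / 6 by positivity), Filter.eventually_ge_atTop 0]
      with y hy hy0
    have h2 := (le_abs_self _).trans hy
    simp only [Function.comp_apply, id_eq, Real.norm_eq_abs] at h2
    rw [abs_of_nonneg (show 0 ≤ 2 * y by positivity)] at h2
    linarith
  obtain ⟨Y', hY'⟩ := Filter.eventually_atTop.mp hlog
  refine ⟨max (max 2 Y') (max (Y + 1) (1 / C₀ + 1)), fun p hp => ?_⟩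
  simp only [max_lt_iff] at hp
  obtain ⟨⟨hp2, hpY'⟩, hpY, hpC⟩ := hp
  set y := p.im with hy
  have hy0 : 0 < y := by linarith
  set B := Metric.closedBall p (1 / 4) with hB
  have him : ∀ q ∈ B, y - 1 / 4 ≤ q.im ∧ q.im ≤ y + 1 / 4 := by
    intro q hq
    rw [hB, Metric.mem_closedBall, dist_eq_norm] at hq
    have := (Complex.abs_im_le_norm (q - p)).trans hq
    rw [Complex.sub_im, abs_le] at this
    constructor <;> linarith [this.1, this.2]
  have hBpos : ∀ q ∈ B, 0 < q.im := fun q hq => by linarith [(him q hq).1]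
  have hharm : InnerProductSpace.HarmonicOnNhd
      (fun q : ℂ => gr w (σ • ofComplex q) - 1 / vol Γ * Real.log q.im) B := by
    intro q hq
    refine hgr.harmonicAt_smul hΓ σ (hBpos q hq) (hne _ ?_)
    rw [yCusp_smul_ofComplex σ (hBpos q hq)]
    linarith [(him q hq).1]
  set h : ℂ → ℝ := fun q => gr w (σ • ofComplex q) - 1 / vol Γ * Real.log q.im with hh
  have hhc : ContinuousOn h B := fun q hq => (hharm q hq).1.continuousAt.continuousWithinAt
  have hlogc : ContinuousOn (fun q : ℂ => 1 / vol Γ * Real.log q.im) B := fun q hq =>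
    (continuousAt_const.mul (contDiffAt_log_im (hBpos q hq)).continuousAt).continuousWithinAt
  have hgc : ContinuousOn (fun q => gr (σ • ofComplex q) w) B := by
    refine (hhc.add hlogc).congr fun q hq => ?_
    simp [hh, hgr.symm _ w]
  have hBc : IsCompact B := isCompact_closedBall _ _
  have hQ := FuchsianGreen.IsGreenFunction.setIntegral_sq_le hΓ hσ hC₀ hC hτ0.le hF hFinv hFgr
    hFint hp2 hpY hpC hgc
  set Q := ∫ q in B, gr (σ • ofComplex q) w ^ 2
  have hmv := integral_mul_radial_eq (ρ := radialBump p (1 / 4))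
    (b := fun r => Real.smoothTransition (1 - r ^ 2 / (1 / 4) ^ 2)) hharm
    (contDiff_radialBump _ _).continuous (fun p => rfl)
    (tsupport_radialBump_subset _ (by norm_num))
  rw [integral_radialBump, ← hI] at hmv
  have hvB : volume.real B = b := by
    simp only [hB, hb, Measure.real, Complex.volume_closedBall]
  have hbound : ∀ q ∈ B, ‖h q * radialBump p (1 / 4) q‖ ≤
      (a * y + |1 / vol Γ| * Real.log (2 * y)) + gr (σ • ofComplex q) w ^ 2 / (a * y) := by
    intro q hq
    have h1 : |radialBump p (1 / 4) q| ≤ 1 := by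
      rw [abs_of_nonneg (radialBump_nonneg _ _ _)]
      exact radialBump_le_one _ _ _
    have h2 : |Real.log q.im| ≤ Real.log (2 * y) := by
      have h3 := him q hq
      rw [abs_of_nonneg (Real.log_nonneg (by linarith))]
      exact Real.log_le_log (hBpos q hq) (by linarith)
    -- The inequality `|g| ≤ ay + g²/(ay)` replaces Cauchy–Schwarz. The square has integral at most
    -- `4nτy²`, so after division by `ay` only a small multiple of `y` remains.
    have h4 : |gr w (σ • ofComplex q)| ≤ a * y + gr (σ • ofComplex q) w ^ 2 / (a * y) := by
      rw [hgr.symm _ w, ← sq_abs (gr w _)]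
      have hay : 0 < a * y := by positivity
      rw [← sub_le_iff_le_add', le_div_iff₀ hay]
      nlinarith [sq_nonneg (|gr w (σ • ofComplex q)| - a * y),
        abs_nonneg (gr w (σ • ofComplex q))]
    rw [norm_mul, Real.norm_eq_abs, Real.norm_eq_abs]
    calc |h q| * |radialBump p (1 / 4) q| ≤ |h q| * 1 := by gcongr
      _ ≤ |gr w (σ • ofComplex q)| + |1 / vol Γ * Real.log q.im| := by
        rw [mul_one]; exact abs_sub _ _
      _ ≤ |gr w (σ • ofComplex q)| + |1 / vol Γ| * Real.log (2 * y) := by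
        rw [abs_mul]; gcongr
      _ ≤ _ := by linarith
  have hint : IntegrableOn (fun q => (a * y + |1 / vol Γ| * Real.log (2 * y)) +
      gr (σ • ofComplex q) w ^ 2 / (a * y)) B :=
    (continuousOn_const.add ((hgc.pow 2).div_const _)).integrableOn_compact hBc
  have hint2 : IntegrableOn (fun q => gr (σ • ofComplex q) w ^ 2 / (a * y)) B :=
    ((hgc.pow 2).div_const _).integrableOn_compact hBc
  have hle : |h p| * I ≤ (a * y + |1 / vol Γ| * Real.log (2 * y)) * b + Q / (a * y) := by
    calc |h p| * I = ‖∫ q, h q * radialBump p (1 / 4) q‖ := by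
          rw [hmv, norm_mul, Real.norm_eq_abs, Real.norm_of_nonneg hI0.le]
      _ = ‖∫ q in B, h q * radialBump p (1 / 4) q‖ := by
          rw [setIntegral_eq_integral_of_forall_compl_eq_zero]
          intro q hq
          rw [image_eq_zero_of_notMem_tsupport
            fun hq' => hq (tsupport_radialBump_subset p (by norm_num) hq'), mul_zero]
      _ ≤ ∫ q in B, ((a * y + |1 / vol Γ| * Real.log (2 * y)) +
            gr (σ • ofComplex q) w ^ 2 / (a * y)) := by
          refine norm_integral_le_of_norm_le hint ?_
          filter_upwards [ae_restrict_mem Metric.isClosed_closedBall.measurableSet] with q hq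
          exact hbound q hq
      _ = _ := by
          rw [integral_add (continuousOn_const.integrableOn_compact hBc) hint2, integral_div,
            setIntegral_const, hvB, smul_eq_mul, mul_comm b]
  have e1 : a * y * b ≤ η * I / 3 * y := by
    have : a * b ≤ η * I / 3 := by
      rw [ha, div_mul_eq_mul_div, div_le_div_iff₀ (by positivity) (by norm_num)]
      nlinarith [mul_pos hη hI0]
    nlinarith
  have e2 : Q / (a * y) ≤ η * I / 3 * y := by
    rw [div_le_iff₀ (by positivity)]
    refine hQ.trans (le_of_eq ?_)
    rw [hτ]
    field_simp
    ring
  have e3 := hY' y hpY'.le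
  have : |h p| * I ≤ η * y * I := by linarith
  exact le_of_mul_le_mul_right this hI0

/-! ### The maximum principle for the Green function in a cusp -/

end

section

variable {Γ : Subgroup SL(2, ℝ)} {gr : ℍ → ℍ → ℝ} {c : Cusps Γ} {σ : SL(2, ℝ)} {C₀ : ℝ}

theorem FuchsianGreen.IsGreenFunction.smul_add_int (hgr : IsGreenFunction Γ gr)
    (hσ : IsCuspScaling Γ c σ) (w : ℍ) (b : ℤ) {p : ℂ} (hp : 0 < p.im) :
    gr w (σ • ofComplex (p + b)) = gr w (σ • ofComplex p) := by
  obtain ⟨γ, hγ, h⟩ := hσ.exists_add b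
  have h1 := h (σ • ofComplex p)
  rw [inv_smul_smul, ofComplex_apply_of_im_pos hp] at h1
  have h2 : γ • σ • ofComplex p = σ • ofComplex (p + b) := by
    rw [← h1, ofComplex_apply, smul_inv_smul, ofComplex_apply_of_im_pos hp]
  rw [← h2, hgr.invariant_right γ hγ]

theorem analyticAt_exp_two_pi_I (p : ℂ) :
    AnalyticAt ℂ (fun p : ℂ => Complex.exp (2 * Real.pi * Complex.I * p)) p := by
  have : Differentiable ℂ (fun p : ℂ => Complex.exp (2 * Real.pi * Complex.I * p)) := by fun_prop
  exact this.analyticAt p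

theorem exists_abs_log_exp_sub_le {q₁ : ℂ} (hq₁ : q₁ ≠ 0) :
    ∃ M Y, ∀ p : ℂ, Y < p.im →
      |Real.log ‖Complex.exp (2 * Real.pi * Complex.I * p) - q₁‖| ≤ M := by
  have hc : ContinuousAt (fun q : ℂ => |Real.log ‖q - q₁‖|) 0 :=
    (ContinuousAt.log (by fun_prop) (by simpa using hq₁)).abs
  obtain ⟨r, hr, hr'⟩ := Metric.eventually_nhds_iff.mp (hc.eventually (gt_mem_nhds (lt_add_one _)))
  refine ⟨|Real.log ‖0 - q₁‖| + 1, -Real.log r / (2 * Real.pi), fun p hp => (hr' ?_).le⟩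
  rw [dist_zero_right, norm_exp_two_pi_I, ← Real.lt_log_iff_exp_lt hr]
  rw [div_lt_iff₀ (by positivity)] at hp
  linarith

/-- The maximum principle is applied to the corrected function and to its negative. The condition
`q₁ ≠ 0` keeps `log|q - q₁|` bounded at the cusp, so the growth there is that of `gr - (1/vol) log
y`. -/
theorem FuchsianGreen.IsGreenFunction.cusp_le (hΓ : IsCofinite Γ) (hgr : IsGreenFunction Γ gr)
    (hσ : IsCuspScaling Γ c σ) (hC₀ : 0 < C₀)
    (hC : ∀ γ ∈ Γ, γ ∉ cuspStabiliser Γ σ → C₀ ≤ CCusp σ γ) {w : ℍ} {y₀ A B κ : ℝ} (hy₀ : 0 < y₀)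
    {q₁ : ℂ} (hq₁ : q₁ ≠ 0)
    (hne : ∀ p : ℂ, y₀ ≤ p.im → Complex.exp (2 * Real.pi * Complex.I * p) ≠ q₁ →
      ∀ t : transformationGroup Γ, t • w ≠ σ • ofComplex p)
    (hsing : ∃ D, ∃ r > 0, ∀ p : ℂ, y₀ ≤ p.im →
      Complex.exp (2 * Real.pi * Complex.I * p) ≠ q₁ →
      ‖Complex.exp (2 * Real.pi * Complex.I * p) - q₁‖ < r →
      |gr w (σ • ofComplex p) - κ * Real.log ‖Complex.exp (2 * Real.pi * Complex.I * p) - q₁‖ -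
        1 / vol Γ * Real.log p.im| ≤ D)
    (hbd : ∀ p : ℂ, p.im = y₀ → Complex.exp (2 * Real.pi * Complex.I * p) ≠ q₁ →
      A ≤ gr w (σ • ofComplex p) - κ * Real.log ‖Complex.exp (2 * Real.pi * Complex.I * p) - q₁‖ -
        1 / vol Γ * Real.log p.im ∧
      gr w (σ • ofComplex p) - κ * Real.log ‖Complex.exp (2 * Real.pi * Complex.I * p) - q₁‖ -
        1 / vol Γ * Real.log p.im ≤ B)
    {p : ℂ} (hp : y₀ ≤ p.im) (hpq : Complex.exp (2 * Real.pi * Complex.I * p) ≠ q₁) :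
    A ≤ gr w (σ • ofComplex p) - κ * Real.log ‖Complex.exp (2 * Real.pi * Complex.I * p) - q₁‖ -
        1 / vol Γ * Real.log p.im ∧
      gr w (σ • ofComplex p) - κ * Real.log ‖Complex.exp (2 * Real.pi * Complex.I * p) - q₁‖ -
        1 / vol Γ * Real.log p.im ≤ B := by
  set h : ℂ → ℝ := fun p => gr w (σ • ofComplex p) -
    κ * Real.log ‖Complex.exp (2 * Real.pi * Complex.I * p) - q₁‖ -
    1 / vol Γ * Real.log p.im with hh
  have hper : ∀ p : ℂ, 0 < p.im → h (p + 1) = h p := by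
    intro p hp
    have := hgr.smul_add_int hσ w 1 hp
    simp only [hh, exp_two_pi_I_add_one]
    rw [Int.cast_one] at this
    simp [this]
  have hharm : ∀ p : ℂ, y₀ ≤ p.im → Complex.exp (2 * Real.pi * Complex.I * p) ≠ q₁ →
      InnerProductSpace.HarmonicAt h p := by
    intro p hp hpq
    have h1 := hgr.harmonicAt_smul hΓ σ (hy₀.trans_le hp) (hne p hp hpq)
    have h2 : InnerProductSpace.HarmonicAt
        (fun p : ℂ => Real.log ‖Complex.exp (2 * Real.pi * Complex.I * p) - q₁‖) p :=
      AnalyticAt.harmonicAt_log_norm ((analyticAt_exp_two_pi_I p).sub analyticAt_const)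
        (sub_ne_zero.mpr hpq)
    refine (InnerProductSpace.harmonicAt_congr_nhds (Filter.Eventually.of_forall fun q => ?_)).mp
      (h1.sub (h2.const_smul (c := κ)))
    simp only [hh, Pi.sub_apply, Pi.smul_apply, smul_eq_mul]
    ring
  have hcont : ContinuousOn h
      {p | y₀ ≤ p.im ∧ Complex.exp (2 * Real.pi * Complex.I * p) ≠ q₁} :=
    fun p hp => (hharm p hp.1 hp.2).1.continuousAt.continuousWithinAt
  have hgrow : ∀ η > 0, ∃ Y : ℝ, ∀ p : ℂ, Y < p.im → |h p| ≤ η * p.im := by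
    intro η hη
    obtain ⟨Y₁, hY₁⟩ := hgr.exists_abs_sub_log_le_mul_im hΓ hσ hC₀ hC w (half_pos hη)
    obtain ⟨M, Y₂, hY₂⟩ := exists_abs_log_exp_sub_le hq₁
    refine ⟨max (max Y₁ Y₂) (|κ| * M / (η / 2)), fun p hp => ?_⟩
    simp only [max_lt_iff] at hp
    have h1 := hY₁ p hp.1.1
    have h2 := mul_le_mul_of_nonneg_left (hY₂ p hp.1.2) (abs_nonneg κ)
    have h3 := (div_lt_iff₀ (half_pos hη)).mp hp.2
    calc |h p| = |(gr w (σ • ofComplex p) - 1 / vol Γ * Real.log p.im) -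
          κ * Real.log ‖Complex.exp (2 * Real.pi * Complex.I * p) - q₁‖| := by
          simp only [hh]; congr 1; ring
      _ ≤ _ := abs_sub _ _
      _ ≤ _ := by rw [abs_mul]; linarith
  have hsing' : ∀ η > 0, ∃ r > 0, ∀ p : ℂ, y₀ ≤ p.im →
      Complex.exp (2 * Real.pi * Complex.I * p) ≠ q₁ →
      ‖Complex.exp (2 * Real.pi * Complex.I * p) - q₁‖ < r →
      |h p| ≤ -η * Real.log ‖Complex.exp (2 * Real.pi * Complex.I * p) - q₁‖ := by
    intro η hη
    obtain ⟨D, r, hr, hD⟩ := hsing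
    refine ⟨min r (Real.exp (-D / η)), lt_min hr (Real.exp_pos _), fun p hp hpq hlt => ?_⟩
    refine (hD p hp hpq (hlt.trans_le (min_le_left _ _))).trans ?_
    have h1 := Real.log_lt_log (norm_pos_iff.mpr (sub_ne_zero.mpr hpq))
      (hlt.trans_le (min_le_right _ _))
    rw [Real.log_exp, lt_div_iff₀ hη] at h1
    linarith
  constructor
  · have := cusp_max_principle (h := fun p => -h p) (B := -A) hy₀ (q₁ := q₁)
      (fun p hp => by simp only [hper p hp]) (fun p hp hpq => (hharm p hp.le hpq).neg) hcont.neg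
      (fun η hη => (hgrow η hη).imp fun Y hY p hp => (neg_le_abs _).trans (hY p hp))
      (fun η hη => by
        obtain ⟨r, hr, h1⟩ := hsing' η hη
        exact ⟨r, hr, fun p hp hpq hlt => (neg_le_abs _).trans (h1 p hp hpq hlt)⟩)
      (fun p hp hpq => neg_le_neg (hbd p hp hpq).1) p hp hpq
    exact neg_le_neg_iff.mp this
  · exact cusp_max_principle (h := h) (B := B) hy₀ (q₁ := q₁) hper
      (fun p hp hpq => hharm p hp.le hpq) hcont
      (fun η hη => (hgrow η hη).imp fun Y hY p hp => (le_abs_self _).trans (hY p hp))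
      (fun η hη => by
        obtain ⟨r, hr, h1⟩ := hsing' η hη
        exact ⟨r, hr, fun p hp hpq hlt => (le_abs_self _).trans (h1 p hp hpq hlt)⟩)
      (fun p hp hpq => (hbd p hp hpq).2) p hp hpq

/-- Both `σ` and `p ↦ exp(2πip)` have nonzero derivative, so the singularity keeps its coefficient
in the coordinate `q`. The estimate must hold for all `p` with `q` near `q(w)`, that is, near every
integer translate of `σ⁻¹ • w`. -/
theorem FuchsianGreen.IsGreenFunction.exists_abs_sub_log_exp_le (hΓ : IsCofinite Γ)
    (hgr : IsGreenFunction Γ gr) (hσ : IsCuspScaling Γ c σ) {w : ℍ}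
    (hw : ∀ t : transformationGroup Γ, t • w = w → t = 1) :
    ∃ D, ∃ r > 0, ∀ p : ℂ, 0 < p.im →
      Complex.exp (2 * Real.pi * Complex.I * p) ≠ qCusp σ w →
      ‖Complex.exp (2 * Real.pi * Complex.I * p) - qCusp σ w‖ < r →
      |gr w (σ • ofComplex p) - centreCard Γ * (1 / (2 * Real.pi)) *
        Real.log ‖Complex.exp (2 * Real.pi * Complex.I * p) - qCusp σ w‖ -
        1 / vol Γ * Real.log p.im| ≤ D := by
  set E : ℂ → ℂ := fun p => Complex.exp (2 * Real.pi * Complex.I * p) with hE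
  set v : ℍ := σ⁻¹ • w with hv
  have hEw : qCusp σ w = E v := rfl
  set κ : ℝ := centreCard Γ * (1 / (2 * Real.pi)) with hκ
  set m : ℂ → ℂ := fun q => ((σ • ofComplex q : ℍ) : ℂ) with hm
  have hmv : m v = w := by simp [hm, hv]
  obtain ⟨hman, hmd⟩ := analyticAt_sl_smul σ v.im_pos
  obtain ⟨D₀, hD₀⟩ := hgr.exists_abs_sub_log_le hΓ hw
  have hm0 : deriv m v ≠ 0 := by
    rw [← norm_ne_zero_iff, hmd]
    exact (div_pos (UpperHalfPlane.im_pos _) v.im_pos).ne'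
  obtain ⟨D₁, hD₁⟩ := exists_abs_log_norm_sub_le hman.differentiableAt.hasDerivAt hm0
  have hEd : HasStrictDerivAt E (Complex.exp (2 * Real.pi * Complex.I * v) *
      (2 * Real.pi * Complex.I * 1)) v :=
    ((hasStrictDerivAt_id (v : ℂ)).const_mul (2 * Real.pi * Complex.I)).cexp
  have hE0 : Complex.exp (2 * Real.pi * Complex.I * v) * (2 * Real.pi * Complex.I * 1) ≠ 0 := by
    simp [Real.pi_ne_zero]
  obtain ⟨D₂, hD₂⟩ := exists_abs_log_norm_sub_le hEd.hasDerivAt hE0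
  have htend : Filter.Tendsto m (𝓝[≠] (v : ℂ)) (𝓝[≠] (w : ℂ)) := by
    refine tendsto_nhdsWithin_iff.mpr ⟨?_, ?_⟩
    · rw [← hmv]
      exact hman.continuousAt.tendsto.mono_left nhdsWithin_le_nhds
    · filter_upwards [hD₁] with q hq
      rw [Set.mem_compl_iff, Set.mem_singleton_iff, ← hmv]
      exact hq.1
  have hlog : ∀ᶠ p in 𝓝[≠] (v : ℂ), |1 / vol Γ * Real.log p.im| ≤
      |1 / vol Γ * Real.log (v : ℂ).im| + 1 := by
    have h1 : ContinuousAt (fun p : ℂ => |1 / vol Γ * Real.log p.im|) v :=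
      (continuousAt_const.mul (contDiffAt_log_im v.im_pos).continuousAt).abs
    exact Filter.Eventually.filter_mono nhdsWithin_le_nhds
      ((h1.eventually (gt_mem_nhds (lt_add_one _))).mono fun p hp => hp.le)
  set D := D₀ + |κ| * (D₁ + D₂) + (|1 / vol Γ * Real.log (v : ℂ).im| + 1) with hD
  have hnear : ∀ᶠ p in 𝓝[≠] (v : ℂ), |gr w (σ • ofComplex p) - κ * Real.log ‖E p - E v‖ -
      1 / vol Γ * Real.log p.im| ≤ D := by
    filter_upwards [htend.eventually hD₀, hD₁, hD₂, hlog] with p h0 h1 h2 h3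
    simp only [hm, ofComplex_apply] at h0
    have h1' := h1.2
    rw [show ((σ • ofComplex (v : ℂ) : ℍ) : ℂ) = w from hmv] at h1'
    set a := gr w (σ • ofComplex p)
    set l₀ := Real.log ‖((σ • ofComplex p : ℍ) : ℂ) - w‖
    set l₁ := Real.log ‖p - v‖
    have h2' : |Real.log ‖E p - E v‖ - l₁| ≤ D₂ := h2.2
    set l₂ := Real.log ‖E p - E v‖
    set l₃ := 1 / vol Γ * Real.log p.im
    have e : a - κ * l₂ - l₃ = (a - κ * l₀) + κ * ((l₀ - l₁) - (l₂ - l₁)) - l₃ := by ring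
    have e2 : |κ * ((l₀ - l₁) - (l₂ - l₁))| ≤ |κ| * (D₁ + D₂) := by
      rw [abs_mul]
      exact mul_le_mul_of_nonneg_left ((abs_sub _ _).trans (add_le_add h1' h2')) (abs_nonneg κ)
    rw [e]
    exact (abs_sub _ _).trans (add_le_add ((abs_add_le _ _).trans (add_le_add h0 e2)) h3)
  have hnear' : ∀ᶠ p : ℂ in 𝓝 (v : ℂ), 0 < p.im ∧ (p ≠ (v : ℂ) → |gr w (σ • ofComplex p) -
      κ * Real.log ‖E p - E v‖ - 1 / vol Γ * Real.log p.im| ≤ D) :=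
    Filter.Eventually.and (isOpen_im_pos.mem_nhds v.im_pos) (eventually_nhdsWithin_iff.mp hnear)
  -- The exponential is open at `σ⁻¹ • w`, so each nearby value of `q` has a preimage near that
  -- point. It differs from `p` by an integer, and `gr` is invariant under this translation.
  have himage := Filter.image_mem_map (m := E) hnear'
  rw [hEd.map_nhds_eq hE0] at himage
  obtain ⟨r, hr, hball⟩ := Metric.mem_nhds_iff.mp himage
  refine ⟨D, r, hr, fun p hp hpq hlt => ?_⟩
  obtain ⟨p', ⟨hp'0, hp'⟩, hpp'⟩ := hball (show E p ∈ Metric.ball (E v) r by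
    rwa [Metric.mem_ball, dist_eq_norm])
  obtain ⟨b, hb⟩ := Complex.exp_eq_exp_iff_exists_int.mp hpp'
  have hpb : p' = p + b := by
    have h2 : (2 * (Real.pi : ℂ) * Complex.I) ≠ 0 := by simp [Real.pi_ne_zero]
    refine mul_left_cancel₀ h2 ?_
    rw [hb]
    ring
  have h1 := hp' (fun h => hpq (by rw [hEw, ← h]; exact hpp'.symm))
  rwa [hpp', hpb, hgr.smul_add_int hσ w b hp, show (p + (b : ℂ)).im = p.im by simp] at h1

/-! ### The desingularised Green function near a cusp -/

end

section

variable {Γ : Subgroup SL(2, ℝ)} {c : Cusps Γ} {σ : SL(2, ℝ)} {δ : ℝ}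

/-- Terms with `u > δ` are excluded from the sum and those with `u = δ` vanish, so the weak
inequality suffices. -/
theorem desingularised_eq (gr : ℍ → ℍ → ℝ) {z w : ℍ} (h : ∀ γ ∈ Γ, δ ≤ u z (γ • w)) :
    desingularised Γ gr δ z w = gr z w := by
  classical
  rw [desingularised, add_eq_left]
  refine finsum_eq_zero_of_forall_eq_zero fun γ => ?_
  rw [finsum_eq_if]
  split_ifs with hγ
  · rw [le_antisymm hγ.2 (h γ hγ.1), sub_self]
  · rfl

theorem L_one_add {t y : ℝ} (ht : t ≠ 0) (hy : 0 < y) :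
    L (1 + t ^ 2 / (2 * y ^ 2)) = 1 / (4 * Real.pi) * Real.log (1 + 4 * y ^ 2 / t ^ 2) := by
  rw [L]
  congr 2
  have : t ^ 2 ≠ 0 := pow_ne_zero 2 ht
  field_simp
  ring

/-- Elements outside the stabiliser contribute zero. Those inside act as integer translations, each
induced by exactly `n` elements of `Γ`. At equal heights `u = 1 + (x + b)²/(2y²)`, so `u ≤ δ` means
`|x + b| ≤ X`. -/
theorem desingularised_eq_sum (hσ : IsCuspScaling Γ c σ) (gr : ℍ → ℍ → ℝ) {z w : ℍ}
    {x y X : ℝ} (hy : 0 < y) (hX : 0 < X) (hXδ : X ^ 2 = 2 * y ^ 2 * (δ - 1))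
    (hzy : yCusp σ z = y) (hwy : yCusp σ w = y)
    (hx : (σ⁻¹ • z).re - (σ⁻¹ • w).re = x) (hx0 : ∀ b : ℤ, x + b ≠ 0)
    (hu : ∀ γ ∈ Γ, γ ∉ cuspStabiliser Γ σ → δ ≤ u z (γ • w))
    {B : Finset ℤ} (hB : ∀ b, b ∈ B ↔ |x + b| ≤ X) :
    desingularised Γ gr δ z w = gr z w + centreCard Γ * ∑ b ∈ B, 1 / (4 * Real.pi) *
      (Real.log (1 + 4 * y ^ 2 / (x + b) ^ 2) - Real.log (1 + 4 * y ^ 2 / X ^ 2)) := by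
  classical
  -- Translating `w` by `-b` makes the horizontal difference of the two points `x + b`.
  choose g hg hg' using fun b : ℤ => hσ.exists_mem (-b)
  have hgc : ∀ b (z : ℍ), ((σ⁻¹ • g b • z : ℍ) : ℂ) = (σ⁻¹ • z : ℍ) + (-b : ℤ) :=
    fun b => coe_inv_smul_of_conj_eq (hg' b)
  have hub : ∀ b, u z (g b • w) = 1 + (x + b) ^ 2 / (2 * y ^ 2) := by
    intro b
    rw [← u_smul_smul σ⁻¹, u_eq]
    have him : (σ⁻¹ • g b • w).im = y := (hσ.yCusp_smul (hg b) w).trans hwy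
    have h1 : ((σ⁻¹ • z : ℍ) : ℂ) - (σ⁻¹ • g b • w : ℍ) = ((x + b : ℝ) : ℂ) := by
      refine Complex.ext ?_ ?_
      · rw [hgc, ← hx]
        simp
        ring
      · rw [Complex.sub_im, coe_im, coe_im, him]
        change yCusp σ z - y = _
        rw [hzy, sub_self, Complex.ofReal_im]
    rw [h1, Complex.norm_real, Real.norm_eq_abs, sq_abs, him]
    change 1 + _ / (2 * yCusp σ z * y) = _
    rw [hzy, mul_assoc, ← sq]
  set C : Finset SL(2, ℝ) := ((Set.toFinite {1, -1}).inter_of_right (Γ : Set SL(2, ℝ))).toFinset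
    with hC
  have hCcard : C.card = centreCard Γ := (Set.ncard_eq_toFinset_card _ _).symm
  have hCmem : ∀ κ, κ ∈ C ↔ κ ∈ Γ ∧ (κ = 1 ∨ κ = -1) := fun κ => by simp [hC]
  have hCsmul : ∀ κ ∈ C, ∀ (h : SL(2, ℝ)) (z : ℍ), (κ * h) • z = h • z := by
    intro κ hκ h z
    rcases ((hCmem κ).mp hκ).2 with rfl | rfl
    · rw [one_mul]
    · rw [neg_one_mul, sl_neg_smul]
  set f : ℤ × SL(2, ℝ) → SL(2, ℝ) := fun q => q.2 * g q.1
  have hinj : Set.InjOn f ((B ×ˢ C : Finset _) : Set (ℤ × SL(2, ℝ))) := by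
    rintro ⟨b, κ⟩ h1 ⟨b', κ'⟩ h2 heq
    simp only [Finset.coe_product, Set.mem_prod, Finset.mem_coe] at h1 h2
    have h3 := congrArg (fun h : SL(2, ℝ) => ((σ⁻¹ • h • z : ℍ) : ℂ)) heq
    simp only [f] at h3
    rw [hCsmul κ h1.2, hCsmul κ' h2.2, hgc, hgc, add_right_inj, Int.cast_inj, neg_inj] at h3
    subst h3
    simpa [f] using heq
  have hterm : ∀ γ : SL(2, ℝ), (∑ᶠ _ : γ ∈ Γ ∧ u z (γ • w) ≤ δ, (L (u z (γ • w)) - L δ)) =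
      if γ ∈ Γ ∧ u z (γ • w) ≤ δ then L (u z (γ • w)) - L δ else 0 := fun γ => finsum_eq_if
  rw [desingularised, finsum_congr hterm, add_right_inj,
    finsum_eq_sum_of_support_subset (s := (B ×ˢ C).image f), Finset.sum_image hinj,
    Finset.sum_product, Finset.mul_sum]
  · refine Finset.sum_congr rfl fun b hb => ?_
    have hle : (x + b) ^ 2 / (2 * y ^ 2) ≤ δ - 1 := by
      rw [div_le_iff₀ (by positivity)]
      have := sq_le_sq' (neg_le_of_abs_le ((hB b).mp hb)) (le_of_abs_le ((hB b).mp hb))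
      linarith
    have hδX : δ = 1 + X ^ 2 / (2 * y ^ 2) := by
      rw [hXδ]
      field_simp
      ring
    rw [Finset.sum_congr rfl (g := fun _ => 1 / (4 * Real.pi) *
      (Real.log (1 + 4 * y ^ 2 / (x + b) ^ 2) - Real.log (1 + 4 * y ^ 2 / X ^ 2))),
      Finset.sum_const, hCcard, nsmul_eq_mul]
    intro κ hκ
    have hmem : f (b, κ) ∈ Γ :=
      Γ.mul_mem ((hCmem κ).mp hκ).1 (mem_of_mem_cuspStabiliser (hg b))
    have huf : u z (f (b, κ) • w) = 1 + (x + b) ^ 2 / (2 * y ^ 2) := by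
      rw [← hub b]
      simp only [f]
      rw [hCsmul κ hκ]
    rw [if_pos ⟨hmem, by rw [huf]; linarith⟩, huf, L_one_add (hx0 b) hy]
    conv_lhs => rw [hδX]
    rw [L_one_add hX.ne' hy]
    ring
  · intro γ hγ
    rw [Function.mem_support, ne_eq, ite_eq_right_iff, not_forall] at hγ
    obtain ⟨⟨hγΓ, hγu⟩, hne⟩ := hγ
    have hst : γ ∈ cuspStabiliser Γ σ := by
      by_contra hn
      rw [le_antisymm hγu (hu γ hγΓ hn), sub_self] at hne
      exact hne rfl
    obtain ⟨b, hb⟩ := hσ.exists_translation hst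
    have hsmul : ∀ z : ℍ, γ • z = g (-b) • z := fun z =>
      (MulAction.injective σ⁻¹) (UpperHalfPlane.ext (by
        rw [coe_inv_smul_of_conj_eq hb, hgc, neg_neg]))
    have hκ : γ * (g (-b))⁻¹ ∈ C := by
      rw [hCmem]
      refine ⟨Γ.mul_mem hγΓ (Γ.inv_mem (mem_of_mem_cuspStabiliser (hg _))), ?_⟩
      have e1 : σ⁻¹ * γ * σ = σ⁻¹ * g (-b) * σ ∨ σ⁻¹ * γ * σ = -(σ⁻¹ * g (-b) * σ) := by
        have hgb := hg' (-b)
        rw [neg_neg] at hgb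
        rcases hb with h | h <;> rcases hgb with h' | h' <;> rw [h, h'] <;> simp
      rcases e1 with h | h
      · left
        rw [mul_inv_eq_one]
        exact mul_left_cancel (mul_right_cancel h)
      · right
        have : σ⁻¹ * γ * σ = σ⁻¹ * (-g (-b)) * σ := by rw [h]; simp
        have h2 : γ = -g (-b) := mul_left_cancel (mul_right_cancel this)
        nth_rewrite 1 [h2]
        rw [neg_mul, mul_inv_cancel]
    have hbB : -b ∈ B := by
      rw [hB]
      rw [hsmul, hub, ← le_sub_iff_add_le', div_le_iff₀ (by positivity)] at hγu
      exact abs_le_of_sq_le_sq (by linarith) hX.le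
    simp only [Finset.coe_image, Set.mem_image, Finset.mem_coe, Finset.mem_product]
    exact ⟨(-b, γ * (g (-b))⁻¹), ⟨hbB, hκ⟩, by simp [f]⟩

/-! ### Bounds in the discs around the cusps -/

theorem norm_qCusp_sub {σ : SL(2, ℝ)} {z w : ℍ} {x y : ℝ} (hz : yCusp σ z = y) (hw : yCusp σ w = y)
    (hx : (σ⁻¹ • z).re - (σ⁻¹ • w).re = x) (hx0 : 0 < x) (hx1 : x < 1) :
    ‖qCusp σ z - qCusp σ w‖ = Real.exp (-(2 * Real.pi * y)) * (2 * Real.sin (Real.pi * x)) := by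
  have hzw : ((σ⁻¹ • z : ℍ) : ℂ) = (σ⁻¹ • w : ℍ) + (x : ℝ) := by
    refine Complex.ext ?_ ?_
    · simp only [Complex.add_re, coe_re, Complex.ofReal_re]
      linarith
    · simp only [Complex.add_im, coe_im, Complex.ofReal_im, add_zero]
      exact hz.trans hw.symm
  have h1 : qCusp σ z - qCusp σ w =
      qCusp σ w * (Complex.exp (Complex.I * ((2 * Real.pi * x : ℝ) : ℂ)) - 1) := by
    rw [qCusp, qCusp, hzw, mul_add, Complex.exp_add, mul_sub, mul_one]
    push_cast
    ring_nf
  have h2 : 0 < Real.sin (Real.pi * x) :=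
    Real.sin_pos_of_pos_of_lt_pi (by positivity) (by nlinarith [Real.pi_pos])
  rw [h1, norm_mul, Complex.norm_exp_I_mul_ofReal_sub_one, qCusp, norm_exp_two_pi_I, coe_im,
    show (σ⁻¹ • w).im = y from hw, show 2 * Real.pi * x / 2 = Real.pi * x by ring,
    Real.norm_of_nonneg (by positivity)]

end

section

variable {Γ : Subgroup SL(2, ℝ)} {gr : ℍ → ℍ → ℝ} {c : Cusps Γ} {σ : SL(2, ℝ)} {C₀ : ℝ}

theorem smul_ofComplex_inv_smul (σ : SL(2, ℝ)) (z : ℍ) :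
    σ • ofComplex ((σ⁻¹ • z : ℍ) : ℂ) = z := by
  rw [ofComplex_apply, smul_inv_smul]

theorem qCusp_smul_ofComplex (σ : SL(2, ℝ)) {p : ℂ} (hp : 0 < p.im) :
    qCusp σ (σ • ofComplex p) = Complex.exp (2 * Real.pi * Complex.I * p) := by
  rw [qCusp, inv_smul_smul, ofComplex_apply_of_im_pos hp]

/-- Bounds for `gr_Γ(·, w)` on the boundary of a disc not containing `w` extend to the disc. -/
theorem FuchsianGreen.IsGreenFunction.bounds_outside (hΓ : IsCofinite Γ)
    (hgr : IsGreenFunction Γ gr)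
    (hσ : IsCuspScaling Γ c σ) (hC₀ : 0 < C₀)
    (hC : ∀ γ ∈ Γ, γ ∉ cuspStabiliser Γ σ → C₀ ≤ CCusp σ γ) {w : ℍ} {ε A B : ℝ} (hε : 0 < ε)
    (hw : ∀ γ ∈ Γ, yCusp σ (γ • w) < 1 / ε)
    (hbd : ∀ z, yCusp σ z = 1 / ε → A ≤ gr z w ∧ gr z w ≤ B) {z : ℍ} (hz : 1 / ε ≤ yCusp σ z) :
    A ≤ gr z w - 1 / vol Γ * Real.log (ε * yCusp σ z) ∧
      gr z w - 1 / vol Γ * Real.log (ε * yCusp σ z) ≤ B := by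
  have hy₀ : 0 < 1 / ε := by positivity
  have hlt : ∀ p : ℂ, 1 / ε ≤ p.im →
      ‖Complex.exp (2 * Real.pi * Complex.I * p)‖ ≤ Real.exp (-(2 * Real.pi * (1 / ε))) := by
    intro p hp
    rw [norm_exp_two_pi_I]
    gcongr
  have hexp : Real.exp (-(2 * Real.pi * (1 / ε))) < 1 := by
    rw [Real.exp_lt_one_iff]
    have := Real.pi_pos
    simp only [Left.neg_neg_iff]
    positivity
  have hsep : ∀ p : ℂ, 1 / ε ≤ p.im → 1 - Real.exp (-(2 * Real.pi * (1 / ε))) ≤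
      ‖Complex.exp (2 * Real.pi * Complex.I * p) - 1‖ := by
    intro p hp
    have h1 := norm_sub_norm_le (1 : ℂ) (Complex.exp (2 * Real.pi * Complex.I * p))
    rw [norm_one, norm_sub_rev] at h1
    linarith [hlt p hp]
  -- There is no singularity to remove, so `κ = 0` and `q₁ = 1` is a dummy point outside the closed
  -- disc. The shift by `(1/vol) log ε` makes the logarithm vanish at height `1/ε`.
  have key := hgr.cusp_le hΓ hσ hC₀ hC (w := w) (A := A + 1 / vol Γ * Real.log ε)
    (B := B + 1 / vol Γ * Real.log ε) (κ := 0) hy₀ one_ne_zero ?_ ?_ ?_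
    (p := ((σ⁻¹ • z : ℍ) : ℂ)) hz ?_
  · rw [smul_ofComplex_inv_smul, hgr.symm w z, zero_mul, sub_zero] at key
    change _ ≤ _ - _ * Real.log (yCusp σ z) ∧ _ - _ * Real.log (yCusp σ z) ≤ _ at key
    rw [Real.log_mul hε.ne' (yCusp_pos σ z).ne', mul_add]
    constructor <;> linarith [key.1, key.2]
  · intro p hp _ t ht
    obtain ⟨γ, hγ, h⟩ := exists_smul_eq t
    have h1 := hw γ hγ
    rw [← h, ht, yCusp_smul_ofComplex σ (hy₀.trans_le hp)] at h1
    exact absurd hp (not_le.mpr h1)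
  · refine ⟨0, _, sub_pos.mpr hexp, fun p hp _ h => ?_⟩
    exact absurd h (not_lt.mpr (hsep p hp))
  · intro p hp _
    have h1 := hbd _ ((yCusp_smul_ofComplex σ (hp ▸ hy₀)).trans hp)
    rw [hgr.symm _ w] at h1
    rw [hp, zero_mul, sub_zero, one_div ε, Real.log_inv]
    constructor <;> linarith [h1.1, h1.2]
  · intro h
    have h1 := hsep _ hz
    rw [h, sub_self, norm_zero] at h1
    linarith

/-- Bounds on the boundary of a disc containing `w` extend to the disc after removal of the
logarithmic singularity. -/
theorem FuchsianGreen.IsGreenFunction.bounds_inside (hΓ : IsCofinite Γ)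
    (hgr : IsGreenFunction Γ gr)
    (hσ : IsCuspScaling Γ c σ) (hC₀ : 0 < C₀)
    (hC : ∀ γ ∈ Γ, γ ∉ cuspStabiliser Γ σ → C₀ ≤ CCusp σ γ) {w : ℍ} {ε A B : ℝ} (hε : 0 < ε)
    (hεC : ε < C₀) (hw : 1 / ε ≤ yCusp σ w)
    (hbd : ∀ z, yCusp σ z = 1 / ε → qCusp σ z ≠ qCusp σ w →
      A ≤ gr z w - centreCard Γ * (1 / (2 * Real.pi)) * Real.log ‖qCusp σ z - qCusp σ w‖ ∧
      gr z w - centreCard Γ * (1 / (2 * Real.pi)) * Real.log ‖qCusp σ z - qCusp σ w‖ ≤ B)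
    {z : ℍ} (hz : 1 / ε ≤ yCusp σ z) (hzw : qCusp σ z ≠ qCusp σ w) :
    A ≤ gr z w - centreCard Γ * (1 / (2 * Real.pi)) * Real.log ‖qCusp σ z - qCusp σ w‖ -
        1 / vol Γ * Real.log (ε * yCusp σ z) ∧
      gr z w - centreCard Γ * (1 / (2 * Real.pi)) * Real.log ‖qCusp σ z - qCusp σ w‖ -
        1 / vol Γ * Real.log (ε * yCusp σ z) ≤ B := by
  have hy₀ : 0 < 1 / ε := by positivity
  have hyC : 1 / C₀ < 1 / ε := one_div_lt_one_div_of_lt hε hεC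
  -- Above height `1/C₀` a transformation fixing a point is a translation by zero, so the
  -- coefficient of the singularity is `n / 2π`.
  have hstab : ∀ t : transformationGroup Γ, t • w = w → t = 1 := fun t ht =>
    eq_one_of_smul_mem_disc hσ hC₀ hC (z := w) (hyC.trans_le hw) (by rw [ht]; exact hyC.trans_le hw)
      (by rw [ht, sub_self, norm_zero]; exact one_pos)
  have key := hgr.cusp_le hΓ hσ hC₀ hC (w := w) (A := A + 1 / vol Γ * Real.log ε)
    (B := B + 1 / vol Γ * Real.log ε) (κ := centreCard Γ * (1 / (2 * Real.pi))) (q₁ := qCusp σ w)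
    hy₀ (Complex.exp_ne_zero _) ?_ ?_ ?_ (p := ((σ⁻¹ • z : ℍ) : ℂ)) hz hzw
  · rw [smul_ofComplex_inv_smul, hgr.symm w z] at key
    change _ ≤ _ - _ * Real.log ‖qCusp σ z - _‖ - _ * Real.log (yCusp σ z) ∧
      _ - _ * Real.log ‖qCusp σ z - _‖ - _ * Real.log (yCusp σ z) ≤ _ at key
    rw [Real.log_mul hε.ne' (yCusp_pos σ z).ne', mul_add]
    constructor <;> linarith [key.1, key.2]
  · intro p hp hpq t ht
    obtain ⟨γ, hγ, h⟩ := exists_smul_eq t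
    rw [h] at ht
    have h1 : yCusp σ (γ • w) = p.im := by rw [ht, yCusp_smul_ofComplex σ (hy₀.trans_le hp)]
    have h2 := mem_cuspStabiliser_of_lt_yCusp hC₀ hC hγ (hyC.trans_le hw)
      (h1 ▸ hyC.trans_le hp)
    obtain ⟨b, hb⟩ := hσ.exists_translation h2
    have h3 := qCusp_smul (coe_inv_smul_of_conj_eq hb) w
    rw [ht, qCusp_smul_ofComplex σ (hy₀.trans_le hp)] at h3
    exact hpq h3
  · obtain ⟨D, r, hr, h⟩ := hgr.exists_abs_sub_log_exp_le hΓ hσ hstab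
    exact ⟨D, r, hr, fun p hp => h p (hy₀.trans_le hp)⟩
  · intro p hp hpq
    have hp0 : 0 < p.im := hp ▸ hy₀
    have h1 := hbd _ ((yCusp_smul_ofComplex σ hp0).trans hp)
      (by rwa [qCusp_smul_ofComplex σ hp0])
    rw [hgr.symm _ w, qCusp_smul_ofComplex σ hp0] at h1
    rw [hp, one_div ε, Real.log_inv]
    constructor <;> linarith [h1.1, h1.2]

/-- On the horocycle `|q(z) - q(w)| = exp(-2πy) · 2 sin πx`. The sine part of `-(n/2π) log|q(z) -
q(w)|` is matched by the lattice sum up to `(2y/π) arctan √((δ-1)/2)` and the error `ε r_δ`, both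
multiplied by `n`; the exponential part contributes `ny`. -/
theorem bounds_of_desingularised (gr : ℍ → ℍ → ℝ) (hσ : IsCuspScaling Γ c σ) {δ ε A B x : ℝ}
    (hδ : 1 < δ) (hε : 0 < ε) {z w : ℍ} (hw : yCusp σ w = 1 / ε) (hz : yCusp σ z = 1 / ε)
    (hu : ∀ γ ∈ Γ, γ ∉ cuspStabiliser Γ σ → δ ≤ u z (γ • w))
    (hAB : A ≤ desingularised Γ gr δ z w ∧ desingularised Γ gr δ z w ≤ B)
    (hx : (σ⁻¹ • z).re - (σ⁻¹ • w).re = x) (hx0 : 0 < x) (hx1 : x < 1) :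
    A + discCorrection Γ δ ε (-1) ≤
      gr z w - centreCard Γ * (1 / (2 * Real.pi)) * Real.log ‖qCusp σ z - qCusp σ w‖ ∧
    gr z w - centreCard Γ * (1 / (2 * Real.pi)) * Real.log ‖qCusp σ z - qCusp σ w‖ ≤
      B + discCorrection Γ δ ε 1 := by
  set y := 1 / ε with hy
  have hy0 : 0 < y := by positivity
  have hδ0 : 0 < δ - 1 := by linarith
  -- The Euclidean distance along the horocycle at which `u = δ`.
  set X := y * √(2 * (δ - 1)) with hX
  have hX0 : 0 < X := by positivity
  have hXδ : X ^ 2 = 2 * y ^ 2 * (δ - 1) := by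
    rw [hX, mul_pow, Real.sq_sqrt (by positivity)]
    ring
  obtain ⟨I, hI⟩ := exists_finset_abs_add_int_le x X
  have hxb : ∀ b : ℤ, x + b ≠ 0 := by
    intro b hb
    have h1 : (b : ℝ) < 0 := by linarith
    have h2 : (-1 : ℝ) < b := by linarith
    have h3 : b < 0 := by exact_mod_cast h1
    have h4 : -1 < b := by exact_mod_cast h2
    omega
  have hdes := desingularised_eq_sum hσ gr hy0 hX0 hXδ hz hw hx hxb hu hI
  have hexpl := abs_translate_sum_add_log_sin_le hx0 hx1 hX0 hy0 hI
  have hnorm := norm_qCusp_sub hz hw hx hx0 hx1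
  have hsin : 0 < Real.sin (Real.pi * x) :=
    Real.sin_pos_of_pos_of_lt_pi (by positivity) (by nlinarith [Real.pi_pos])
  have hA := hAB
  rw [hdes] at hA
  have e1 : X / (2 * y) = √((δ - 1) / 2) := by
    rw [eq_comm, Real.sqrt_eq_iff_mul_self_eq (by positivity) (by positivity), ← sq, div_pow, hXδ]
    field_simp
  have e2 : 2 * y / X = √(2 / (δ - 1)) := by
    rw [eq_comm, Real.sqrt_eq_iff_mul_self_eq (by positivity) (by positivity), ← sq, div_pow, hXδ]
    field_simp
  have e3 : 1 / (24 * Real.pi * y) * (2 * y / X + Real.arctan (X / (2 * y))) = ε * rDelta δ := by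
    rw [e1, e2, rDelta, hy]
    field_simp
  rw [e3, e1, abs_le] at hexpl
  rw [hnorm, Real.log_mul (Real.exp_pos _).ne' (by positivity), Real.log_exp, discCorrection,
    discCorrection, ← hy]
  set S := ∑ b ∈ I, 1 / (4 * Real.pi) *
    (Real.log (1 + 4 * y ^ 2 / (x + b) ^ 2) - Real.log (1 + 4 * y ^ 2 / X ^ 2))
  set l := Real.log (2 * Real.sin (Real.pi * x))
  set a := Real.arctan √((δ - 1) / 2)
  have e4 : (centreCard Γ : ℝ) * (1 / (2 * Real.pi)) * (-(2 * Real.pi * y) + l) =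
      -(centreCard Γ * y) + centreCard Γ * (1 / (2 * Real.pi) * l) := by
    have := Real.pi_ne_zero
    field_simp
  have hn : (0 : ℝ) ≤ centreCard Γ := Nat.cast_nonneg _
  have h1 := mul_le_mul_of_nonneg_left hexpl.1 hn
  have h2 := mul_le_mul_of_nonneg_left hexpl.2 hn
  have e5 : 2 * y / Real.pi * a = y * (2 / Real.pi * a) := by ring
  rw [e5] at h1 h2
  rw [e4]
  constructor <;> linarith [hA.1, hA.2]

/-- The desingularised Green function controls the Green function on horocycles. -/
theorem FuchsianGreen.IsGreenFunction.bounds_horocycle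
    (hgr : IsGreenFunction Γ gr) (hσ : IsCuspScaling Γ c σ) {δ ε A B : ℝ} (hδ : 1 < δ)
    (hε : 0 < ε) {w : ℍ} (hw : yCusp σ w = 1 / ε)
    (hu : ∀ z, yCusp σ z = 1 / ε → ∀ γ ∈ Γ, γ ∉ cuspStabiliser Γ σ → δ ≤ u z (γ • w))
    (hAB : ∀ z, yCusp σ z = 1 / ε → qCusp σ z ≠ qCusp σ w →
      A ≤ desingularised Γ gr δ z w ∧ desingularised Γ gr δ z w ≤ B)
    {z : ℍ} (hz : yCusp σ z = 1 / ε) (hzw : qCusp σ z ≠ qCusp σ w) :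
    A + discCorrection Γ δ ε (-1) ≤
      gr z w - centreCard Γ * (1 / (2 * Real.pi)) * Real.log ‖qCusp σ z - qCusp σ w‖ ∧
    gr z w - centreCard Γ * (1 / (2 * Real.pi)) * Real.log ‖qCusp σ z - qCusp σ w‖ ≤
      B + discCorrection Γ δ ε 1 := by
  -- An integer translation of `z` brings the horizontal difference into `[0, 1)`; it is not `0`
  -- because the values of `q` differ.
  set d := (σ⁻¹ • z).re - (σ⁻¹ • w).re with hd
  obtain ⟨γ, hγ, hγz⟩ := hσ.exists_add (-⌊d⌋)
  have hq : qCusp σ (γ • z) = qCusp σ z := qCusp_smul hγz z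
  rw [← hgr.invariant_left γ hγ z w, ← hq]
  rw [← hq] at hzw
  have hz' : yCusp σ (γ • z) = 1 / ε := by
    have := congrArg Complex.im (hγz z)
    rw [← hz, yCusp, yCusp, ← coe_im, this]
    simp
  set y := 1 / ε with hy
  have hy0 : 0 < y := by positivity
  set x := (σ⁻¹ • γ • z).re - (σ⁻¹ • w).re with hx
  have hxd : x = Int.fract d := by
    have := congrArg Complex.re (hγz z)
    rw [hx, ← coe_re, this, ← Int.self_sub_floor]
    simp only [Complex.add_re, coe_re, Complex.neg_re, Complex.intCast_re, Int.cast_neg]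
    linarith
  have hx1 : x < 1 := hxd ▸ Int.fract_lt_one d
  have hx0 : 0 < x := by
    refine lt_of_le_of_ne (hxd ▸ Int.fract_nonneg d) fun h => hzw ?_
    have : σ⁻¹ • γ • z = σ⁻¹ • w := by
      refine UpperHalfPlane.ext (Complex.ext ?_ ?_)
      · rw [coe_re, coe_re]
        linarith
      · exact hz'.trans hw.symm
    rw [qCusp, qCusp, this]
  exact bounds_of_desingularised gr hσ hδ hε hw hz' (hu _ hz') (hAB _ hz' hzw) hx.symm hx0 hx1

/-! ### Disjoint discs -/

/-- Moving vertically in the cusp coordinate raises the height. This reaches points on the boundary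
horocycle, although the discs are defined by strict inequalities. -/
theorem exists_yCusp_gt {σ : SL(2, ℝ)} {z : ℍ} {U : Set ℍ} (hU : IsOpen U) (hz : z ∈ U) :
    ∃ z' ∈ U, yCusp σ z < yCusp σ z' := by
  set v : ℂ := ((σ⁻¹ • z : ℍ) : ℂ) with hv
  have hv0 : 0 < v.im := UpperHalfPlane.im_pos _
  have hc : ContinuousAt (fun t : ℝ => σ • ofComplex (v + t * Complex.I)) 0 := by
    have h1 : ContinuousAt (fun t : ℝ => v + t * Complex.I) 0 := by fun_prop
    have h2 : Filter.Tendsto ofComplex (𝓝 ((fun t : ℝ => v + t * Complex.I) 0))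
        (𝓝 (ofComplex ((fun t : ℝ => v + t * Complex.I) 0))) := tendsto_ofComplex (by simpa using hv0)
    exact (continuous_const_smul σ).continuousAt.comp (h2.comp h1)
  have hmem : ∀ᶠ t : ℝ in 𝓝 0, σ • ofComplex (v + t * Complex.I) ∈ U := by
    refine hc.eventually (hU.mem_nhds ?_)
    simpa [hv] using hz
  obtain ⟨t, ht, ht0⟩ := ((hmem.filter_mono nhdsWithin_le_nhds).and
    (self_mem_nhdsWithin (s := Set.Ioi (0 : ℝ)))).exists
  have ht0' : 0 < t := ht0
  refine ⟨_, ht, ?_⟩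
  have him : (v + t * Complex.I).im = v.im + t := by simp
  rw [yCusp_smul_ofComplex σ (by rw [him]; linarith), him]
  exact lt_add_of_pos_right _ ht0'

end

section

variable {Γ : Subgroup SL(2, ℝ)} {c d : Cusps Γ} {σ τ : SL(2, ℝ)}

/-- If the orbit entered the second disc, a slightly higher point near `z` would lie in both discs.
-/
theorem yCusp_smul_le_of_disjoint (hσ : IsCuspScaling Γ c σ) (hτ : IsCuspScaling Γ d τ) {a b : ℝ}
    (hdisj : Disjoint (cuspDisc Γ σ a) (cuspDisc Γ τ b)) {z : ℍ} (hz : 1 / a ≤ yCusp σ z)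
    {γ : SL(2, ℝ)} (hγ : γ ∈ Γ) : yCusp τ (γ • z) ≤ 1 / b := by
  by_contra h
  have hU : IsOpen {z : ℍ | 1 / b < yCusp τ (γ • z)} :=
    isOpen_lt continuous_const ((continuous_yCusp τ).comp (continuous_const_smul γ))
  obtain ⟨z', hz', hlt⟩ := exists_yCusp_gt (σ := σ) hU (not_le.mp h)
  exact Set.disjoint_left.mp hdisj
    (hσ.toQuot_mem_cuspDisc.mpr ⟨1, Γ.one_mem, by rw [one_smul]; exact hz.trans_lt hlt⟩)
    (hτ.toQuot_mem_cuspDisc.mpr ⟨γ, hγ, hz'⟩)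

theorem yCusp_smul_le_self (hσ : IsCuspScaling Γ c σ) {C₀ : ℝ} (hC₀ : 0 < C₀)
    (hC : ∀ γ ∈ Γ, γ ∉ cuspStabiliser Γ σ → C₀ ≤ CCusp σ γ) {z : ℍ} (hz : 1 / C₀ < yCusp σ z)
    {γ : SL(2, ℝ)} (hγ : γ ∈ Γ) : yCusp σ (γ • z) ≤ yCusp σ z := by
  by_cases h : γ ∈ cuspStabiliser Γ σ
  · exact (hσ.yCusp_smul h z).le
  · by_contra hlt
    exact h (mem_cuspStabiliser_of_lt_yCusp hC₀ hC hγ hz (hz.trans (not_le.mp hlt)))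

/-- An element outside the stabiliser has `|c|² ≥ a² s` with `s = δ + √(δ² - 1)`. It lowers a point
of height `1/a` to at most `1/(a s)`, and this ratio of heights forces `u ≥ δ`. -/
theorem le_u_smul {δ a : ℝ} (hδ : 1 < δ) (ha : 0 < a)
    (hC : ∀ γ ∈ Γ, γ ∉ cuspStabiliser Γ σ → a * √(δ + √(δ ^ 2 - 1)) ≤ CCusp σ γ) {z w : ℍ}
    (hz : yCusp σ z = 1 / a) (hw : yCusp σ w = 1 / a) {γ : SL(2, ℝ)} (hγ : γ ∈ Γ)
    (hγ' : γ ∉ cuspStabiliser Γ σ) : δ ≤ u z (γ • w) := by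
  rw [← u_smul_smul σ⁻¹]
  refine le_u_of_im_ratio hδ ?_
  change _ * yCusp σ (γ • w) ≤ yCusp σ z
  set s := δ + √(δ ^ 2 - 1) with hs
  have hs0 : 0 < s := by positivity
  have h1 := yCusp_smul_mul_le (σ := σ) (γ := γ) w
  have h2 : (a * √s) ^ 2 ≤ CCusp σ γ ^ 2 := by gcongr; exact hC γ hγ hγ'
  rw [mul_pow, Real.sq_sqrt hs0.le] at h2
  have h3 := mul_le_mul_of_nonneg_left h2 (mul_pos (yCusp_pos σ (γ • w)) (yCusp_pos σ w)).le
  rw [hz, le_div_iff₀ ha]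
  rw [hw] at h1 h3
  have h4 : yCusp σ (γ • w) * (1 / a) * (a ^ 2 * s) = s * yCusp σ (γ • w) * a := by
    field_simp
  linarith

theorem one_lt_add_sqrt {δ : ℝ} (hδ : 1 < δ) : 1 < δ + √(δ ^ 2 - 1) :=
  lt_add_of_lt_of_nonneg hδ (Real.sqrt_nonneg _)

end

theorem mainTheorem5
    (Γ : Subgroup SL(2, ℝ)) (hΓ : IsCofinite Γ)
    (gr : ℍ → ℍ → ℝ) (hgr : IsGreenFunction Γ gr)
    (σ : Cusps Γ → SL(2, ℝ)) (hσ : ∀ c, IsCuspScaling Γ c (σ c))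
    (δ : ℝ) (hδ : 1 < δ)
    (ε ε' : Cusps Γ → ℝ) (hε : ∀ c, 0 < ε c) (hεε' : ∀ c, ε c < ε' c)
    (hmin : ∀ c, ∀ γ ∈ Γ, γ ∉ cuspStabiliser Γ (σ c) →
      ε' c * Real.sqrt (δ + Real.sqrt (δ ^ 2 - 1)) ≤ CCusp (σ c) γ)
    (hratio : ∀ c, (δ + Real.sqrt (δ ^ 2 - 1)) * ε c ≤ ε' c)
    (hdisj : ∀ c d, c ≠ d → Disjoint (cuspDisc Γ (σ c) (ε' c)) (cuspDisc Γ (σ d) (ε' d)))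
    (A B : ℝ)
    (hAB : ∀ z w : ℍ, toQuot Γ z ∈ cuspComplement Γ σ ε → toQuot Γ w ∈ cuspComplement Γ σ ε →
      toQuot Γ z ≠ toQuot Γ w →
      A ≤ desingularised Γ gr δ z w ∧ desingularised Γ gr δ z w ≤ B) :
    -- the point `z` lies in a disc, the point `w` lies outside the larger disc
    (∀ (c : Cusps Γ) (z w : ℍ), 1 / ε c < yCusp (σ c) z →
      toQuot Γ w ∈ cuspComplement Γ σ ε → toQuot Γ w ∉ cuspDisc Γ (σ c) (ε' c) →
      A ≤ gr z w - 1 / vol Γ * Real.log (ε c * yCusp (σ c) z) ∧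
      gr z w - 1 / vol Γ * Real.log (ε c * yCusp (σ c) z) ≤ B) ∧
    -- the same with `z` and `w` interchanged
    (∀ (c : Cusps Γ) (z w : ℍ), 1 / ε c < yCusp (σ c) w →
      toQuot Γ z ∈ cuspComplement Γ σ ε → toQuot Γ z ∉ cuspDisc Γ (σ c) (ε' c) →
      A ≤ gr z w - 1 / vol Γ * Real.log (ε c * yCusp (σ c) w) ∧
      gr z w - 1 / vol Γ * Real.log (ε c * yCusp (σ c) w) ≤ B) ∧
    -- the points lie in discs around distinct cusps
    (∀ (c d : Cusps Γ) (z w : ℍ), c ≠ d →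
      1 / ε c < yCusp (σ c) z → 1 / ε d < yCusp (σ d) w →
      A ≤ gr z w - 1 / vol Γ * Real.log (ε c * yCusp (σ c) z)
          - 1 / vol Γ * Real.log (ε d * yCusp (σ d) w) ∧
      gr z w - 1 / vol Γ * Real.log (ε c * yCusp (σ c) z)
          - 1 / vol Γ * Real.log (ε d * yCusp (σ d) w) ≤ B) ∧
    -- both points lie in the same larger disc
    (∀ (c : Cusps Γ) (z w : ℍ), 1 / ε' c < yCusp (σ c) z → 1 / ε' c < yCusp (σ c) w →
      toQuot Γ z ≠ toQuot Γ w →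
      A + discCorrection Γ δ (ε' c) (-1) ≤
        gr z w
          - centreCard Γ * (1 / (2 * Real.pi)) * Real.log ‖qCusp (σ c) z - qCusp (σ c) w‖
          - 1 / vol Γ * Real.log (ε' c * yCusp (σ c) z)
          - 1 / vol Γ * Real.log (ε' c * yCusp (σ c) w) ∧
      gr z w
          - centreCard Γ * (1 / (2 * Real.pi)) * Real.log ‖qCusp (σ c) z - qCusp (σ c) w‖
          - 1 / vol Γ * Real.log (ε' c * yCusp (σ c) z)
          - 1 / vol Γ * Real.log (ε' c * yCusp (σ c) w)
        ≤ B + discCorrection Γ δ (ε' c) 1) := by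
  set s := δ + √(δ ^ 2 - 1) with hs
  have hs1 : 1 < s := one_lt_add_sqrt hδ
  have hsq1 : 1 < √s := Real.lt_sqrt_of_sq_lt (by simpa using hs1)
  have hε' : ∀ c, 0 < ε' c := fun c => (hε c).trans (hεε' c)
  have hC₀ : ∀ c, 0 < ε' c * √s := fun c => mul_pos (hε' c) (by linarith)
  have hε'C : ∀ c, ε' c < ε' c * √s := fun c => lt_mul_of_one_lt_right (hε' c) hsq1
  have hinv : ∀ c, 1 / ε' c < 1 / ε c := fun c => one_div_lt_one_div_of_lt (hε c) (hεε' c)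
  have hinvC : ∀ c, 1 / (ε' c * √s) < 1 / ε' c := fun c =>
    one_div_lt_one_div_of_lt (hε' c) (hε'C c)
  -- horocycles of height between `1 / ε'` and `1 / ε` lie in `Y`
  have hY : ∀ c z, 1 / ε' c ≤ yCusp (σ c) z → yCusp (σ c) z ≤ 1 / ε c →
      toQuot Γ z ∈ cuspComplement Γ σ ε := by
    intro c z hz hz' hmem
    obtain ⟨d, hd⟩ := Set.mem_iUnion.mp hmem
    obtain ⟨γ, hγ, h⟩ := (hσ d).toQuot_mem_cuspDisc.mp hd
    by_cases hcd : c = d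
    · subst hcd
      have := yCusp_smul_le_self (hσ c) (hC₀ c) (hmin c) ((hinvC c).trans_le hz) hγ
      linarith
    · have := yCusp_smul_le_of_disjoint (hσ c) (hσ d) (hdisj c d hcd) hz hγ
      linarith [hinv d]
  have hout : ∀ c w, toQuot Γ w ∉ cuspDisc Γ (σ c) (ε' c) → ∀ γ ∈ Γ,
      yCusp (σ c) (γ • w) ≤ 1 / ε' c := by
    intro c w hw γ hγ
    by_contra h
    exact hw ((hσ c).toQuot_mem_cuspDisc.mpr ⟨γ, hγ, not_le.mp h⟩)
  have hin : ∀ c z, 1 / ε' c < yCusp (σ c) z → toQuot Γ z ∈ cuspDisc Γ (σ c) (ε' c) :=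
    fun c z hz => (hσ c).toQuot_mem_cuspDisc.mpr ⟨1, Γ.one_mem, by rwa [one_smul]⟩
  have ha : ∀ (c : Cusps Γ) (z w : ℍ), 1 / ε c < yCusp (σ c) z →
      toQuot Γ w ∈ cuspComplement Γ σ ε → toQuot Γ w ∉ cuspDisc Γ (σ c) (ε' c) →
      A ≤ gr z w - 1 / vol Γ * Real.log (ε c * yCusp (σ c) z) ∧
      gr z w - 1 / vol Γ * Real.log (ε c * yCusp (σ c) z) ≤ B := by
    intro c z w hz hwY hw
    refine hgr.bounds_outside hΓ (hσ c) (hC₀ c) (hmin c) (hε c)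
      (fun γ hγ => (hout c w hw γ hγ).trans_lt (hinv c)) ?_ hz.le
    intro z₁ hz₁
    have hlt : 1 / ε' c < yCusp (σ c) z₁ := hz₁ ▸ hinv c
    -- At height `1/ε` the desingularising sum is empty or zero: the orbit of `w` has height at most
    -- `1/ε'`, and `s/ε' ≤ 1/ε`.
    rw [← desingularised_eq (Γ := Γ) (δ := δ) gr (z := z₁) (w := w)]
    · refine hAB z₁ w (hY c z₁ hlt.le hz₁.le) hwY fun h => hw ?_
      rw [← h]
      exact hin c z₁ hlt
    · intro γ hγ
      rw [← u_smul_smul (σ c)⁻¹]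
      refine le_u_of_im_ratio hδ ?_
      change s * yCusp (σ c) (γ • w) ≤ yCusp (σ c) z₁
      have h1 := hout c w hw γ hγ
      rw [le_div_iff₀ (hε' c)] at h1
      rw [hz₁, le_div_iff₀ (hε c)]
      have h2 := mul_le_mul_of_nonneg_left (hratio c) (yCusp_pos (σ c) (γ • w)).le
      linarith
  refine ⟨ha, ?_, ?_, ?_⟩
  · intro c z w hw hzY hz
    rw [hgr.symm z w]
    exact ha c w z hw hzY hz
  · intro c d z w hcd hz hw
    rw [hgr.symm z w]
    have hzd : ∀ γ ∈ Γ, yCusp (σ d) (γ • z) ≤ 1 / ε' d := fun γ hγ =>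
      yCusp_smul_le_of_disjoint (hσ c) (hσ d) (hdisj c d hcd) ((hinv c).trans hz).le hγ
    -- With `z` fixed in the first disc, the bounds of (a) on the horocycle of the second cusp serve
    -- as boundary values there; the term in the height of `z` is constant and is moved into `A` and
    -- `B`.
    have key := hgr.bounds_outside hΓ (hσ d) (hC₀ d) (hmin d) (w := z)
      (A := A + 1 / vol Γ * Real.log (ε c * yCusp (σ c) z))
      (B := B + 1 / vol Γ * Real.log (ε c * yCusp (σ c) z)) (hε d)
      (fun γ hγ => (hzd γ hγ).trans_lt (hinv d)) ?_ hw.le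
    · constructor <;> linarith [key.1, key.2]
    · intro w₁ hw₁
      have hlt : 1 / ε' d < yCusp (σ d) w₁ := hw₁ ▸ hinv d
      have h1 := ha c z w₁ hz (hY d w₁ hlt.le hw₁.le) fun hmem =>
        Set.disjoint_left.mp (hdisj c d hcd) hmem (hin d w₁ hlt)
      rw [hgr.symm w₁ z]
      constructor <;> linarith [h1.1, h1.2]
  · intro c z w hz hw hzw
    have hne : ∀ z₁ w₁ : ℍ, 1 / ε' c ≤ yCusp (σ c) z₁ → 1 / ε' c ≤ yCusp (σ c) w₁ →
        qCusp (σ c) z₁ ≠ qCusp (σ c) w₁ → toQuot Γ z₁ ≠ toQuot Γ w₁ := by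
      intro z₁ w₁ hz₁ hw₁ hq h
      obtain ⟨γ, hγ, rfl⟩ := toQuot_eq_iff.mp h
      have hst := mem_cuspStabiliser_of_lt_yCusp (hC₀ c) (hmin c) hγ
        ((hinvC c).trans_le hw₁) ((hinvC c).trans_le hz₁)
      obtain ⟨b, hb⟩ := (hσ c).exists_translation hst
      exact hq (qCusp_smul (coe_inv_smul_of_conj_eq hb) w₁)
    have hq : qCusp (σ c) z ≠ qCusp (σ c) w := by
      intro h
      obtain ⟨b, hb⟩ := Complex.exp_eq_exp_iff_exists_int.mp h
      obtain ⟨γ, hγ, hγw⟩ := (hσ c).exists_add b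
      refine hzw (toQuot_eq_iff.mpr ⟨γ, hγ, ?_⟩)
      refine (MulAction.injective (σ c)⁻¹) (UpperHalfPlane.ext ?_)
      have h2 : (2 * (Real.pi : ℂ) * Complex.I) ≠ 0 := by simp [Real.pi_ne_zero]
      refine mul_left_cancel₀ h2 ?_
      rw [hγw, hb]
      ring
    -- First pass of the maximum principle: one point stays on the horocycle of height `1/ε'`, where
    -- its logarithmic term vanishes, and the other moves into the disc.
    have hhoro : ∀ w₁, yCusp (σ c) w₁ = 1 / ε' c → ∀ z₁, 1 / ε' c ≤ yCusp (σ c) z₁ →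
        qCusp (σ c) z₁ ≠ qCusp (σ c) w₁ → _ :=
      fun w₁ hw₁ z₁ hz₁ hzw₁ => hgr.bounds_inside hΓ (hσ c) (hC₀ c) (hmin c) (hε' c) (hε'C c)
        hw₁.ge (fun z₂ hz₂ hzw₂ => hgr.bounds_horocycle (hσ c) hδ (hε' c) hw₁
          (fun z₃ hz₃ γ hγ hγ' => le_u_smul hδ (hε' c) (hmin c) hz₃ hw₁ hγ hγ')
          (fun z₃ hz₃ hzw₃ => hAB z₃ w₁ (hY c z₃ hz₃.ge (hz₃ ▸ (hinv c).le))
            (hY c w₁ hw₁.ge (hw₁ ▸ (hinv c).le)) (hne z₃ w₁ hz₃.ge hw₁.ge hzw₃))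
          hz₂ hzw₂) hz₁ hzw₁
    -- Second pass, with the roles exchanged by symmetry: `w` is fixed in the disc, and the first
    -- pass supplies the bounds for `z₁` on the horocycle.
    have key := hgr.bounds_inside hΓ (hσ c) (hC₀ c) (hmin c) (w := w)
      (A := A + discCorrection Γ δ (ε' c) (-1) + 1 / vol Γ * Real.log (ε' c * yCusp (σ c) w))
      (B := B + discCorrection Γ δ (ε' c) 1 + 1 / vol Γ * Real.log (ε' c * yCusp (σ c) w))
      (hε' c) (hε'C c) hw.le ?_ hz.le hq
    · constructor <;> linarith [key.1, key.2]
    · intro z₁ hz₁ hzw₁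
      have h1 := hhoro z₁ hz₁ w hw.le hzw₁.symm
      rw [hgr.symm w z₁, norm_sub_rev] at h1
      constructor <;> linarith [h1.1, h1.2]
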